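/- Let $v\in\mathbb{C}^l$ with $\|v\|=1$ and $\xi\ge 0$, and let $q_r(X)=(v^*X-\xi)(v^*X-\xi)^*$, a quadratic polynomial $\sum_{i,j}X_iA_{ij}X_j+\sum_i b_iX_i+c$ in self-adjoint non-commuting variables $X_1,\dots,X_l$, with $v^*X=\sum_i\bar v_iX_i$. Its coefficients are $A_{ij}=\bar v_iv_j$, $b_i=-2\xi\,\mathrm{Re}\,v_i$, $c=\xi^2$. Let $\rho$ be the limiting spectral measure (self-consistent density of states) of $q_r$ evaluated at independent Wigner matrices. That is, $\rho$ is the probability measure on $\mathbb{R}$ whose Stieltjes transform $m(z)=\int\frac{\rho(dx)}{x-z}$ is the analytic function $m:\mathbb{H}\to\mathbb{H}$ with $zm(z)\to-1$ as $z\to\infty$ and $-m(z)^{-1}=z+\gamma(m(z))$ for all $z\in\mathbb{H}$, where $$\gamma(m)=-\mathrm{Tr}\,A(I+Am)^{-1}+m\,b^t\big((I+2m\widehat A)^{-2}(I+m\widehat A)\big)b-c,\qquad \widehat A=\tfrac12(A+A^t).$$ Let $\sigma=\|\mathrm{Re}\,v\|$ and $\mu=\langle\mathrm{Re}\,v,\mathrm{Im}\,v\rangle$.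 Call $v$ genuinely complex if $v\notin e^{i\varphi}\mathbb{R}^l$ for all $\varphi\in(-\pi,\pi]$; in that case define $s>0$ by $s^2=\sigma^{-4}$ if $\mu=0$, and otherwise by $$s^2=\sum_{a\in\{a_+,a_-\}}\big((\sigma^2+a^2(1-\sigma^2)+2a\mu)(\sigma^2+a\mu)\big)^{-1},\qquad a_\pm=\tfrac{1-2\sigma^2}{2\mu}\pm\sqrt{\big(\tfrac{1-2\sigma^2}{2\mu}\big)^2+1}.$$ An edge $\tau_0$ of $\rho$ is called regular if $\rho$ has a Lebesgue density, also denoted by $\rho$, in a neighbourhood of $\tau_0$ and $\lim_{E\to\tau_0,\,E\in\mathrm{supp}\,\rho}\rho(E)/\sqrt{|\tau_0-E|}$ exists and is nonzero. For $p\in\mathbb{R}$ we say that $\rho$ has exponent $p$ at $\tau_-$ if, for some $\kappa>0$, $\rho$ has a Lebesgue density on $(\tau_-,\tau_-+\kappa)$ bounded above and below there by positive constant multiples of $(E-\tau_-)^p$. Then $\tau_-=\min\mathrm{supp}\,\rho$ and $\tau_+=\max\mathrm{supp}\,\rho$ exist, $\rho$ has a regular edge at $\tau_+$, and at $\tau_-$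 the following holds. * If $\xi=0$, the exponent is $-\frac12$. * If $v\in e^{i\varphi}\mathbb{R}^l$ for some $\varphi$, the exponent is $-\frac12$ if $\sigma\xi<2$ and $-\frac14$ if $\sigma\xi=2$. In particular, for $v\in\mathbb{R}^l$, where $\sigma=1$, it is $-\frac12$ if $\xi<2$ and $-\frac14$ if $\xi=2$. * If $v$ is genuinely complex, the exponent is $-\frac12$ if $s\xi<2$ and $-\frac13$ if $s\xi=2$. * In all other cases the left edge is regular and the exponent is $\frac12$. -/

import Mathlib

open MeasureTheory Filter Topology

namespace QuadEdge

noncomputable section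

/-- The non-commutative quadratic polynomial `∑ i j, X i * A i j * X j + ∑ i, b i * X i + c`. -/
def quadraticPolynomial {l : ℕ} (A : Matrix (Fin l) (Fin l) ℂ) (b : Fin l → ℝ) (c : ℝ) :
    FreeAlgebra ℂ (Fin l) :=
  ∑ i, ∑ j, A i j • (FreeAlgebra.ι ℂ i * FreeAlgebra.ι ℂ j)
    + ∑ i, (b i : ℂ) • FreeAlgebra.ι ℂ i + algebraMap ℂ _ (c : ℂ)

/-- The polynomial `(v^* X - ξ) (v^* X - ξ)^*` in self-adjoint variables `X i`, where
`v^* X = ∑ i, conj (v i) X i` and hence `(v^* X)^* = ∑ i, v i X i`. -/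
def shiftedReducible {l : ℕ} (v : EuclideanSpace ℂ (Fin l)) (ξ : ℝ) : FreeAlgebra ℂ (Fin l) :=
  (∑ i, (starRingEnd ℂ (v i)) • FreeAlgebra.ι ℂ i - algebraMap ℂ _ (ξ : ℂ)) *
    (∑ i, v i • FreeAlgebra.ι ℂ i - algebraMap ℂ _ (ξ : ℂ))

/-- Quadratic coefficients of `(v^* X - ξ) (v^* X - ξ)^*`. -/
def redA {l : ℕ} (v : EuclideanSpace ℂ (Fin l)) : Matrix (Fin l) (Fin l) ℂ :=
  Matrix.of fun i j => starRingEnd ℂ (v i) * v j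

/-- Linear coefficients of `(v^* X - ξ) (v^* X - ξ)^*`. -/
def redB {l : ℕ} (v : EuclideanSpace ℂ (Fin l)) (ξ : ℝ) : Fin l → ℝ :=
  fun i => -(2 * ξ * (v i).re)

/-- Constant coefficient of `(v^* X - ξ) (v^* X - ξ)^*`. -/
def redC (ξ : ℝ) : ℝ := ξ ^ 2

/-- `redA`, `redB`, `redC` are the coefficients of `(v^* X - ξ) (v^* X - ξ)^*`. -/
theorem quadraticPolynomial_red {l : ℕ} (v : EuclideanSpace ℂ (Fin l)) (ξ : ℝ) :
    quadraticPolynomial (redA v) (redB v ξ) (redC ξ) = shiftedReducible v ξ := by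
  have h1 : ∀ i, ((redB v ξ i : ℝ) : ℂ)
      = -((ξ : ℂ) * v i) - (ξ : ℂ) * starRingEnd ℂ (v i) := by
    intro i
    apply Complex.ext <;> simp [redB]
    ring
  unfold quadraticPolynomial shiftedReducible
  have h2 : ∑ i, ∑ j, (redA v i j) • (FreeAlgebra.ι ℂ i * FreeAlgebra.ι ℂ j)
      = (∑ i, (starRingEnd ℂ (v i)) • FreeAlgebra.ι ℂ i) * (∑ j, v j • FreeAlgebra.ι ℂ j) := by
    rw [Finset.sum_mul_sum]
    refine Finset.sum_congr rfl fun i _ => Finset.sum_congr rfl fun j _ => ?_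
    rw [smul_mul_smul_comm]
    rfl
  have h3 : ∑ i, ((redB v ξ i : ℝ) : ℂ) • FreeAlgebra.ι ℂ i
      = -((ξ : ℂ) • ∑ i, v i • FreeAlgebra.ι ℂ i)
        - (ξ : ℂ) • ∑ i, (starRingEnd ℂ (v i)) • FreeAlgebra.ι ℂ i := by
    simp only [h1, sub_smul, neg_smul, Finset.sum_sub_distrib, Finset.sum_neg_distrib,
      Finset.smul_sum, smul_smul]
  rw [h2, h3]
  simp only [redC, Algebra.algebraMap_eq_smul_one, sub_mul, mul_sub, mul_one, one_mul,
    mul_smul_comm, smul_mul_assoc, smul_smul, smul_sub, Complex.ofReal_mul, pow_two]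
  abel

/-- The open upper half-plane. -/
def upperHalf : Set ℂ := {z | 0 < z.im}

/-- `Â = (A + Aᵗ) / 2`. -/
def hat {l : ℕ} (A : Matrix (Fin l) (Fin l) ℂ) : Matrix (Fin l) (Fin l) ℂ :=
  (1 / 2 : ℂ) • (A + A.transpose)

/-- `γ(m) = - Tr A (1 + A m)⁻¹ + m bᵗ ((1 + 2 m Â)⁻² (1 + m Â)) b - c`. For Hermitian `A` and `m`
in the upper half-plane the inverses are genuine matrix inverses. -/
def gammaFn {l : ℕ} (A : Matrix (Fin l) (Fin l) ℂ) (b : Fin l → ℝ) (c : ℝ) (m : ℂ) : ℂ :=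
  -(A * (1 + m • A)⁻¹).trace
    + m * ((fun i => (b i : ℂ)) ⬝ᵥ
        ((((1 + (2 * m) • hat A)⁻¹) ^ 2 * (1 + m • hat A)).mulVec (fun i => (b i : ℂ))))
    - (c : ℂ)

/-- `m` is an analytic self-map of the upper half-plane with `z m(z) → -1` as `z → ∞` that solves
the scalar Dyson equation `-1/m = z + γ(m)`. -/
structure IsDysonSolution {l : ℕ} (A : Matrix (Fin l) (Fin l) ℂ) (b : Fin l → ℝ) (c : ℝ)
    (m : ℂ → ℂ) : Prop where
  mapsTo : Set.MapsTo m upperHalf upperHalf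
  analytic : AnalyticOnNhd ℂ m upperHalf
  tendsto : Tendsto (fun z => z * m z) (Bornology.cobounded ℂ ⊓ 𝓟 upperHalf) (𝓝 (-1))
  eqn : ∀ z ∈ upperHalf, -(m z)⁻¹ = z + gammaFn A b c (m z)

/-- `ρ` is the limiting spectral measure (self-consistent density of states) of the quadratic
polynomial with coefficients `A`, `b`, `c`: the probability measure whose Stieltjes transform is
the solution of the scalar Dyson equation. -/
def IsLimitingSpectralMeasure {l : ℕ} (A : Matrix (Fin l) (Fin l) ℂ) (b : Fin l → ℝ) (c : ℝ)
    (ρ : Measure ℝ) : Prop :=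
  IsProbabilityMeasure ρ ∧ ∃ m : ℂ → ℂ, IsDysonSolution A b c m ∧
    ∀ z ∈ upperHalf, m z = ∫ x : ℝ, 1 / ((x : ℂ) - z) ∂ρ

/-- On the set `S` the measure `ρ` has the Lebesgue density `f`. -/
def HasDensityOn (ρ : Measure ℝ) (S : Set ℝ) (f : ℝ → ℝ) : Prop :=
  Measurable f ∧ (∀ x, 0 ≤ f x) ∧
    ρ.restrict S = (volume.restrict S).withDensity (fun x => ENNReal.ofReal (f x))

/-- Regular edge at `τ`: there is a Lebesgue density `f` in a neighbourhood of `τ`, and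
`f E / √|τ - E|` has a nonzero limit as `E → τ` within the support. -/
def IsRegularEdge (ρ : Measure ℝ) (τ : ℝ) : Prop :=
  ∃ δ > 0, ∃ f : ℝ → ℝ, HasDensityOn ρ (Set.Ioo (τ - δ) (τ + δ)) f ∧
    ∃ L : ℝ, L ≠ 0 ∧
      Tendsto (fun E => f E / Real.sqrt |τ - E|) (𝓝[ρ.support \ {τ}] τ) (𝓝 L)

/-- `ρ(E) ∼ (E - τ)^p` on `(τ, τ + κ)` for some `κ > 0`, where `∼` means two-sided bounds up to
positive constants. -/
def HasLeftEdgeExponent (ρ : Measure ℝ) (τ p : ℝ) : Prop :=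
  ∃ κ > 0, ∃ f : ℝ → ℝ, HasDensityOn ρ (Set.Ioo τ (τ + κ)) f ∧
    ∃ c > 0, ∃ C > 0, ∀ E ∈ Set.Ioo τ (τ + κ),
      c * (E - τ) ^ p ≤ f E ∧ f E ≤ C * (E - τ) ^ p

/-- Entrywise real part. -/
def reVec {l : ℕ} (v : EuclideanSpace ℂ (Fin l)) : EuclideanSpace ℝ (Fin l) :=
  WithLp.toLp 2 fun i => (v i).re

/-- Entrywise imaginary part. -/
def imVec {l : ℕ} (v : EuclideanSpace ℂ (Fin l)) : EuclideanSpace ℝ (Fin l) :=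
  WithLp.toLp 2 fun i => (v i).im

/-- `σ = ‖Re v‖`. -/
def sigma {l : ℕ} (v : EuclideanSpace ℂ (Fin l)) : ℝ := ‖reVec v‖

/-- `μ = ⟨Re v, Im v⟩`. -/
def mu {l : ℕ} (v : EuclideanSpace ℂ (Fin l)) : ℝ := inner ℝ (reVec v) (imVec v)

/-- `a₊` -/
def aPlus {l : ℕ} (v : EuclideanSpace ℂ (Fin l)) : ℝ :=
  (1 - 2 * sigma v ^ 2) / (2 * mu v) + Real.sqrt (((1 - 2 * sigma v ^ 2) / (2 * mu v)) ^ 2 + 1)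

/-- `a₋` -/
def aMinus {l : ℕ} (v : EuclideanSpace ℂ (Fin l)) : ℝ :=
  (1 - 2 * sigma v ^ 2) / (2 * mu v) - Real.sqrt (((1 - 2 * sigma v ^ 2) / (2 * mu v)) ^ 2 + 1)

/-- The summand `((σ² + a² (1 - σ²) + 2 a μ) (σ² + a μ))⁻¹` of `s²`. -/
def sTerm {l : ℕ} (v : EuclideanSpace ℂ (Fin l)) (a : ℝ) : ℝ :=
  ((sigma v ^ 2 + a ^ 2 * (1 - sigma v ^ 2) + 2 * a * mu v) * (sigma v ^ 2 + a * mu v))⁻¹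

open Classical in
/-- The quantity `s`, used only for `v` outside all `e^{iφ} ℝ^l`, where `0 < σ < 1`. -/
def sConst {l : ℕ} (v : EuclideanSpace ℂ (Fin l)) : ℝ :=
  Real.sqrt (if mu v = 0 then (sigma v ^ 4)⁻¹ else sTerm v (aPlus v) + sTerm v (aMinus v))

/-- `v ∈ ℝ^l`. -/
def IsRealVec {l : ℕ} (v : EuclideanSpace ℂ (Fin l)) : Prop := ∀ i, (v i).im = 0

/-- `v ∈ e^{iφ} ℝ^l` for some `φ ∈ (-π, π]`. -/
def IsPhaseReal {l : ℕ} (v : EuclideanSpace ℂ (Fin l)) : Prop :=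
  ∃ φ ∈ Set.Ioc (-Real.pi) Real.pi, ∃ w : Fin l → ℝ,
    ∀ i, v i = Complex.exp (φ * Complex.I) * (w i : ℂ)

end

end QuadEdge

open QuadEdge

/-!
The coefficient matrix `A` is a rank one projection and its symmetrisation `Â` maps `u` to
`⟨Re v, u⟩ Re v + ⟨Im v, u⟩ Im v`. Expanding `Re v` in eigenvectors of `Â` therefore turns the Dyson
equation into `Z (m z) = z` with the rational function
`Z m = d - 1 / m + 1 / (1 + m) + ∑ qᵢ / (1 + 2 αᵢ m) ^ 2`, where `0 < αᵢ ≤ 1` and `qᵢ ≥ 0`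
(`isStieltjesInverse_of_eigen`). Here `α = 1` and `q = (σ ξ)²` for a vector with a real phase, while
in the genuinely complex case the `αᵢ` lie in `(0, 1)` and `∑ qᵢ / αᵢ² = (s ξ)²`
(`exists_params_of_isPhaseReal`, `exists_params_of_not_isPhaseReal`).

To the left of its support, the Stieltjes transform `m` of `ρ` is the inverse of `Z` on the positive
half-line, followed from `m = 0` at `z = -∞` up to the first obstruction. That obstruction is the
left edge. If `∑ qᵢ / αᵢ² ≤ 4`, then `Z' > 0` on `(0, ∞)` (`zDeriv_pos`), and the edge is the limit `d` of
`Z` at infinity, where `Z - d ∼ -c m ^ (-k)`, so that `m ∼ (d - z) ^ (-1 / k)`. The leading coefficient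
of `Z - d` is a positive multiple of `∑ qᵢ / αᵢ² - 4`, whence `k = 2` below the critical value; at the
critical value `k = 3`, or `k = 4` if `α = 1` makes the next coefficient vanish as well. Otherwise
the edge is the first zero of `Z'`, where `Z'' < 0` (`critConst_pos`), which gives a square root
singularity of `m`. The right edge is the left edge of the reflected measure, for which `Z` is
replaced by `m ↦ -Z (-m)`; it is always of the latter kind (`exists_isEdgeBranch_right`).

The passage from `Z` to `ρ` is the content of `IsEdgeBranch`. A connectedness argument along the
real branch identifies the boundary values of `m` left of the edge (`tendsto_boundary_of_tendsto`);
extracting a `k`-th root of the edge expansion of `Z` and applying the identity theorem on a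
half-disc expresses `m` through `(τ - z) ^ (1 / k)` near the edge `τ` (`exists_edge_expansion`); and
Stieltjes inversion turns the boundary values of `Im m` into the density of `ρ`
(`hasDensityOn_of_tendsto`).
-/

open QuadEdge

namespace QuadEdge

/-! ### Boundary values of holomorphic right inverses -/

theorem isOpen_upperHalf : IsOpen upperHalf := isOpen_lt continuous_const Complex.continuous_im

theorem convex_upperHalf : Convex ℝ upperHalf := convex_halfSpace_im_gt 0

theorem ofReal_add_mul_I_mem_upperHalf {E η : ℝ} (h : 0 < η) :
    (E : ℂ) + η * Complex.I ∈ upperHalf := by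
  simp [upperHalf, h]

theorem neBot_nhdsWithin_upperHalf (E : ℝ) : (𝓝[upperHalf] (E : ℂ)).NeBot := by
  have h : upperHalf = {z : ℂ | 0 < z.im} := rfl
  rw [← mem_closure_iff_nhdsWithin_neBot, h, Complex.closure_setOfPred_lt_im]
  simp

theorem tendsto_ofReal_nhdsGT : Tendsto (fun x : ℝ => (x : ℂ)) (𝓝[>] 0) (𝓝[≠] 0) := by
  refine tendsto_nhdsWithin_iff.2 ⟨?_, ?_⟩
  · exact (Complex.continuous_ofReal.tendsto' 0 0 (by simp)).mono_left nhdsWithin_le_nhds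
  · filter_upwards [self_mem_nhdsWithin] with x hx
    simpa using (ne_of_gt hx)

/-- A holomorphic function with nonzero derivative has a holomorphic local inverse. -/
theorem exists_analytic_local_inverse {f : ℂ → ℂ} {a : ℂ} (hf : AnalyticAt ℂ f a)
    (hf' : deriv f a ≠ 0) :
    ∃ ψ : ℂ → ℂ, AnalyticAt ℂ ψ (f a) ∧ ψ (f a) = a ∧ (∀ᶠ x in 𝓝 a, ψ (f x) = x) ∧
      (∀ᶠ y in 𝓝 (f a), f (ψ y) = y) ∧ HasDerivAt ψ (deriv f a)⁻¹ (f a) := by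
  refine ⟨_, hf.analyticAt_localInverse hf', ?_, hf.hasStrictDerivAt.eventually_left_inverse hf',
    hf.hasStrictDerivAt.eventually_right_inverse hf',
    (hf.hasStrictDerivAt.to_localInverse hf').hasDerivAt⟩
  exact (hf.hasStrictDerivAt.eventually_left_inverse hf').self_of_nhds

/-- Two right inverses of `Z` with a common limit at which `Z` is locally injective agree. -/
theorem eventually_eq_of_tendsto_of_rightInverse {Z f₁ f₂ : ℂ → ℂ} {l : Filter ℂ} {x : ℂ}
    (hZ : AnalyticAt ℂ Z x) (hZ' : deriv Z x ≠ 0) (h₁ : Tendsto f₁ l (𝓝 x))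
    (h₂ : Tendsto f₂ l (𝓝 x)) (e₁ : ∀ᶠ z in l, Z (f₁ z) = z) (e₂ : ∀ᶠ z in l, Z (f₂ z) = z) :
    f₁ =ᶠ[l] f₂ := by
  obtain ⟨ψ, -, -, hl, -, -⟩ := exists_analytic_local_inverse hZ hZ'
  filter_upwards [h₁.eventually hl, h₂.eventually hl, e₁, e₂] with z a b c d
  rw [c] at a
  rw [d] at b
  rw [← a, ← b]

/-- Identity theorem on a half-disc: agreement near one point of the diameter is enough. -/
theorem eqOn_halfDisc {f₁ f₂ : ℂ → ℂ} {E₀ E : ℝ} {r : ℝ}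
    (h₁ : AnalyticOnNhd ℂ f₁ (Metric.ball (E₀ : ℂ) r ∩ upperHalf))
    (h₂ : AnalyticOnNhd ℂ f₂ (Metric.ball (E₀ : ℂ) r ∩ upperHalf))
    (hE : (E : ℂ) ∈ Metric.ball (E₀ : ℂ) r) (h : f₁ =ᶠ[𝓝[upperHalf] (E : ℂ)] f₂) :
    Set.EqOn f₁ f₂ (Metric.ball (E₀ : ℂ) r ∩ upperHalf) := by
  have hconv : Convex ℝ (Metric.ball (E₀ : ℂ) r ∩ upperHalf) :=
    (convex_ball _ _).inter convex_upperHalf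
  have h' : ∀ᶠ z in 𝓝[upperHalf] (E : ℂ), z ∈ upperHalf ∧ z ∈ Metric.ball (E₀ : ℂ) r ∧
      ∀ᶠ w in 𝓝 z, f₁ w = f₂ w := by
    have e1 : ∀ᶠ z in 𝓝[upperHalf] (E : ℂ), z ∈ upperHalf := self_mem_nhdsWithin
    have e2 : ∀ᶠ z in 𝓝[upperHalf] (E : ℂ), z ∈ Metric.ball (E₀ : ℂ) r :=
      mem_nhdsWithin_of_mem_nhds (Metric.isOpen_ball.mem_nhds hE)
    have e3 := eventually_eventually_nhdsWithin.2 h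
    filter_upwards [e1, e2, e3] with z a b c
    refine ⟨a, b, ?_⟩
    rwa [isOpen_upperHalf.nhdsWithin_eq a] at c
  have := neBot_nhdsWithin_upperHalf E
  obtain ⟨z, hz1, hz2, hz3⟩ := h'.exists
  exact h₁.eqOn_of_preconnected_of_eventuallyEq h₂ hconv.isPreconnected ⟨hz2, hz1⟩ hz3

/-- Let `m` be a holomorphic right inverse of `Z` on the upper half-plane, and let `Z` be real
with non-vanishing derivative on a real interval `I`. If `m` attains one boundary value `x ∈ I` at
`Z x`, then it attains all of them: along `Z(I)` the function `m` continues the real inverse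
branch of `Z` with values in `I`. -/
theorem tendsto_boundary_of_tendsto {Z m : ℂ → ℂ} {I : Set ℝ} (hI : IsOpen I)
    (hIc : IsPreconnected I) (hZ : ∀ x ∈ I, AnalyticAt ℂ Z (x : ℂ))
    (hZ' : ∀ x ∈ I, deriv Z (x : ℂ) ≠ 0) (hreal : ∀ x ∈ I, (Z (x : ℂ)).im = 0)
    (hm : AnalyticOnNhd ℂ m upperHalf) (hmZ : ∀ z ∈ upperHalf, Z (m z) = z)
    {x₁ : ℝ} (hx₁ : x₁ ∈ I) (h₁ : Tendsto m (𝓝[upperHalf] (Z x₁)) (𝓝 (x₁ : ℂ)))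
    {x : ℝ} (hx : x ∈ I) : Tendsto m (𝓝[upperHalf] (Z x)) (𝓝 (x : ℂ)) := by
  have hre : ∀ x ∈ I, Z x = (((Z x).re : ℝ) : ℂ) := fun x hx => by
    apply Complex.ext <;> simp [hreal x hx]
  have hcont : ∀ x ∈ I, ContinuousAt (fun x : ℝ => Z x) x := fun x hx =>
    ContinuousAt.comp (f := fun x : ℝ => (x : ℂ)) (hZ x hx).continuousAt
      Complex.continuous_ofReal.continuousAt
  set S : Set ℝ := {x | x ∈ I ∧ Tendsto m (𝓝[upperHalf] (Z x)) (𝓝 (x : ℂ))} with hS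
  -- a point of `I`, together with one boundary value near it, has a neighbourhood inside `S`
  have key : ∀ x₀ ∈ I, ∀ᶠ y in 𝓝 x₀, y ∈ S → ∀ᶠ x in 𝓝 x₀, x ∈ S := by
    intro x₀ hx₀
    obtain ⟨ψ, hψ, hψ0, hl, hr, -⟩ := exists_analytic_local_inverse (hZ x₀ hx₀) (hZ' x₀ hx₀)
    obtain ⟨r, hr0, hball⟩ := Metric.eventually_nhds_iff_ball.1
      (hψ.eventually_analyticAt.and hr)
    have hin : ∀ᶠ y : ℝ in 𝓝 x₀, Z y ∈ Metric.ball (Z x₀) r :=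
      (hcont x₀ hx₀).eventually (Metric.isOpen_ball.mem_nhds (Metric.mem_ball_self hr0))
    have hl' : ∀ᶠ y : ℝ in 𝓝 x₀, ψ (Z y) = y :=
      Complex.continuous_ofReal.continuousAt.eventually hl
    have hII : ∀ᶠ y : ℝ in 𝓝 x₀, y ∈ I := hI.mem_nhds hx₀
    have htend : ∀ y : ℝ, Z y ∈ Metric.ball (Z x₀) r → ψ (Z y) = y →
        Tendsto ψ (𝓝[upperHalf] (Z y)) (𝓝 (y : ℂ)) := by
      intro y hy1 hy2
      have := (hball _ hy1).1.continuousAt.tendsto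
      rw [hy2] at this
      exact this.mono_left nhdsWithin_le_nhds
    filter_upwards [hin, hl'] with y hy1 hy2 hyS
    have hev : m =ᶠ[𝓝[upperHalf] (Z y)] ψ := by
      refine eventually_eq_of_tendsto_of_rightInverse (hZ y hyS.1) (hZ' y hyS.1) hyS.2
        (htend y hy1 hy2) ?_ ?_
      · filter_upwards [self_mem_nhdsWithin] with z hz using hmZ z hz
      · have := Metric.isOpen_ball.mem_nhds hy1
        filter_upwards [mem_nhdsWithin_of_mem_nhds this] with z hz using (hball z hz).2
    rw [hre y hyS.1] at hev
    have heq : Set.EqOn m ψ (Metric.ball (((Z x₀).re : ℝ) : ℂ) r ∩ upperHalf) := by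
      refine eqOn_halfDisc (E := (Z y).re) (hm.mono Set.inter_subset_right) ?_ ?_ hev
      · intro z hz
        rw [← hre x₀ hx₀] at hz
        exact (hball z hz.1).1
      · rwa [← hre x₀ hx₀, ← hre y hyS.1]
    rw [← hre x₀ hx₀] at heq
    filter_upwards [hin, hl', hII] with x hx1 hx2 hx3
    refine ⟨hx3, (htend x hx1 hx2).congr' ?_⟩
    filter_upwards [self_mem_nhdsWithin,
      mem_nhdsWithin_of_mem_nhds (Metric.isOpen_ball.mem_nhds hx1)] with z h1 h2
    exact (heq ⟨h2, h1⟩).symm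
  have hSopen : IsOpen S := by
    rw [isOpen_iff_mem_nhds]
    intro x₀ hx₀
    exact (key x₀ hx₀.1).self_of_nhds hx₀
  have hsub : I ⊆ S := by
    refine hIc.subset_of_closure_inter_subset hSopen ⟨x₁, hx₁, hx₁, h₁⟩ ?_
    rintro x₀ ⟨hcl, hx₀⟩
    obtain ⟨y, hyS, hy⟩ := ((mem_closure_iff_frequently.1 hcl).and_eventually (key x₀ hx₀)).exists
    exact (hy hyS).self_of_nhds
  exact (hsub hx).2

/-- Starting point of the continuation: if `Z w = N w / w` with `N 0 = -1` and `m` is a right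
inverse of `Z` vanishing at infinity, then `m` has boundary value `x` at `Z x` for all small
positive `x`. -/
theorem tendsto_boundary_near_zero {Z N m : ℂ → ℂ} (hN : AnalyticAt ℂ N 0) (hN0 : N 0 = -1)
    (hZN : ∀ᶠ w in 𝓝[≠] (0 : ℂ), Z w = N w / w)
    (hmU : ∀ z ∈ upperHalf, m z ∈ upperHalf)
    (hmZ : ∀ z ∈ upperHalf, Z (m z) = z)
    (hm0 : Tendsto m (Bornology.cobounded ℂ ⊓ 𝓟 upperHalf) (𝓝 0)) :
    ∀ᶠ x : ℝ in 𝓝[>] 0, Tendsto m (𝓝[upperHalf] (Z x)) (𝓝 (x : ℂ)) := by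
  have hN0' : N 0 ≠ 0 := by rw [hN0]; norm_num
  set G : ℂ → ℂ := fun w => w / N w with hG
  have hGan : AnalyticAt ℂ G 0 := analyticAt_id.div hN hN0'
  have hGd : HasDerivAt G ((1 * N 0 - 0 * deriv N 0) / N 0 ^ 2) 0 :=
    (hasDerivAt_id (0 : ℂ)).div hN.differentiableAt.hasDerivAt hN0'
  have hG' : deriv G 0 ≠ 0 := by rw [hGd.deriv, hN0]; norm_num
  have hG0 : G 0 = 0 := by simp [hG]
  obtain ⟨ψ, hψ, -, hl, -, -⟩ := exists_analytic_local_inverse hGan hG'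
  rw [hG0] at hψ
  -- near the origin, `Z w = z` amounts to `w = ψ z⁻¹`
  have hinv : ∀ᶠ w in 𝓝[≠] (0 : ℂ), ψ (Z w)⁻¹ = w := by
    filter_upwards [hZN, mem_nhdsWithin_of_mem_nhds hl] with w h1 h2
    rw [h1, inv_div]
    exact h2
  have hZtop : Tendsto Z (𝓝[≠] (0 : ℂ)) (Bornology.cobounded ℂ) := by
    have h1 : Tendsto G (𝓝[≠] (0 : ℂ)) (𝓝[≠] 0) := by
      refine tendsto_nhdsWithin_iff.2 ⟨?_, ?_⟩
      · have := hGan.continuousAt.tendsto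
        rw [hG0] at this
        exact this.mono_left nhdsWithin_le_nhds
      · filter_upwards [self_mem_nhdsWithin,
          mem_nhdsWithin_of_mem_nhds (hN.continuousAt.eventually_ne hN0')] with w h1 h2
        exact div_ne_zero h1 h2
    refine (tendsto_inv₀_nhdsNE_zero.comp h1).congr' ?_
    filter_upwards [hZN] with w hw
    simp [hG, hw]
  have hm0' : Tendsto m (Bornology.cobounded ℂ ⊓ 𝓟 upperHalf) (𝓝[≠] 0) := by
    refine tendsto_nhdsWithin_iff.2 ⟨hm0, ?_⟩
    filter_upwards [mem_inf_of_right (mem_principal_self upperHalf)] with z hz h0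
    have := hmU z hz
    rw [h0] at this
    simp [upperHalf] at this
  have hmψ : ∀ᶠ z in Bornology.cobounded ℂ ⊓ 𝓟 upperHalf, m z = ψ z⁻¹ := by
    filter_upwards [hm0'.eventually hinv, mem_inf_of_right (mem_principal_self upperHalf)]
      with z h1 h2
    rw [hmZ z h2] at h1
    exact h1.symm
  rw [eventually_inf_principal] at hmψ
  -- the filter of neighbourhoods of a large point
  have hmψ' : ∀ᶠ z in Bornology.cobounded ℂ, ∀ᶠ y in 𝓝 z, y ∈ upperHalf → m y = ψ y⁻¹ := by
    obtain ⟨r, -, hr⟩ := (Metric.hasBasis_cobounded_compl_closedBall (0 : ℂ)).eventually_iff.1 hmψ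
    refine (Metric.hasBasis_cobounded_compl_closedBall (0 : ℂ)).eventually_iff.2 ⟨r, trivial, ?_⟩
    intro z hz
    filter_upwards [Metric.isClosed_closedBall.isOpen_compl.mem_nhds hz] with y hy using hr hy
  have h0ne : ∀ᶠ z : ℂ in Bornology.cobounded ℂ, z ≠ 0 := by
    refine (Metric.hasBasis_cobounded_compl_closedBall (0 : ℂ)).eventually_iff.2 ⟨0, trivial, ?_⟩
    intro z hz h
    simp [h] at hz
  have hψan : ∀ᶠ z in Bornology.cobounded ℂ, ContinuousAt (fun z => ψ z⁻¹) z := by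
    have h1 : ∀ᶠ z in Bornology.cobounded ℂ, AnalyticAt ℂ ψ z⁻¹ :=
      tendsto_inv₀_cobounded.eventually hψ.eventually_analyticAt
    filter_upwards [h1, h0ne] with z h1 h2
    exact ContinuousAt.comp (f := fun z : ℂ => z⁻¹) h1.continuousAt (continuousAt_inv₀ h2)
  have hcast := tendsto_ofReal_nhdsGT
  filter_upwards [hcast.eventually hinv, (hZtop.comp hcast).eventually hmψ',
    (hZtop.comp hcast).eventually hψan] with x h1 h2 h3
  simp only [Function.comp] at h2 h3
  have h4 : Tendsto (fun z => ψ z⁻¹) (𝓝[upperHalf] (Z x)) (𝓝 (x : ℂ)) := by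
    have := h3.tendsto
    rw [h1] at this
    exact this.mono_left nhdsWithin_le_nhds
  refine h4.congr' ?_
  filter_upwards [self_mem_nhdsWithin, mem_nhdsWithin_of_mem_nhds h2] with z h5 h6
  exact (h6 h5).symm

end QuadEdge

namespace QuadEdge

noncomputable section

/-! ### The branch at the edge -/

/-- The branch of `(τ - z)^(1/k)` on the closed upper half-plane that is positive for real
`z < τ`; for real `z > τ` it equals `e^{-iπ/k} (z - τ)^(1/k)`. -/
def edgeRoot (k : ℕ) (τ : ℝ) (z : ℂ) : ℂ :=
  Complex.exp ((Complex.log (z - τ) - Real.pi * Complex.I) / k)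

theorem edgeRoot_pow {k : ℕ} (hk : k ≠ 0) {τ : ℝ} {z : ℂ} (hz : z ≠ τ) :
    edgeRoot k τ z ^ k = τ - z := by
  have hk' : (k : ℂ) ≠ 0 := Nat.cast_ne_zero.2 hk
  rw [edgeRoot, ← Complex.exp_nat_mul, mul_div_cancel₀ _ hk', Complex.exp_sub,
    Complex.exp_log (sub_ne_zero.2 hz), Complex.exp_pi_mul_I]
  ring

theorem edgeRoot_ne_zero (k : ℕ) (τ : ℝ) (z : ℂ) : edgeRoot k τ z ≠ 0 := Complex.exp_ne_zero _

theorem norm_edgeRoot_lt {k : ℕ} (hk : k ≠ 0) {τ : ℝ} {z : ℂ} (hz : z ≠ τ) {s : ℝ} (hs : 0 ≤ s)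
    (h : ‖z - τ‖ < s ^ k) : ‖edgeRoot k τ z‖ < s := by
  refine lt_of_pow_lt_pow_left₀ k hs ?_
  rw [← norm_pow, edgeRoot_pow hk hz, norm_sub_rev]
  exact h

theorem analyticAt_edgeRoot (k : ℕ) {τ : ℝ} {z : ℂ} (hz : z - τ ∈ Complex.slitPlane) :
    AnalyticAt ℂ (edgeRoot k τ) z := by
  unfold edgeRoot
  have h1 : AnalyticAt ℂ (fun z : ℂ => Complex.log (z - τ)) z :=
    (analyticAt_id.sub analyticAt_const).clog hz
  exact AnalyticAt.cexp ((h1.sub analyticAt_const).div_const)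

theorem sub_mem_slitPlane_of_mem_upperHalf {τ : ℝ} {z : ℂ} (hz : z ∈ upperHalf) :
    z - τ ∈ Complex.slitPlane := by
  refine Or.inr ?_
  have : 0 < z.im := hz
  simp [this.ne']

theorem ne_ofReal_of_mem_upperHalf {τ : ℝ} {z : ℂ} (hz : z ∈ upperHalf) : z ≠ τ := by
  rintro rfl
  simp [upperHalf] at hz

/-- Boundary values of `edgeRoot` to the left of `τ`. -/
theorem edgeRoot_sub_pow {k : ℕ} (hk : k ≠ 0) {τ y : ℝ} (hy : 0 < y) :
    edgeRoot k τ ((τ - y ^ k : ℝ) : ℂ) = y := by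
  have h1 : ((τ - y ^ k : ℝ) : ℂ) - τ = ((-(y ^ k) : ℝ) : ℂ) := by push_cast; ring
  have hk' : (k : ℂ) ≠ 0 := Nat.cast_ne_zero.2 hk
  have hlog : Complex.log (((-(y ^ k) : ℝ)) : ℂ) = (k * Real.log y : ℝ) + Real.pi * Complex.I := by
    rw [Complex.log, Complex.arg_ofReal_of_neg (by simpa using pow_pos hy k), Complex.norm_real,
      norm_neg, norm_pow, Real.norm_of_nonneg hy.le, Real.log_pow]
  rw [edgeRoot, h1, hlog, add_sub_cancel_right]
  push_cast
  rw [mul_div_cancel_left₀ _ hk', ← Complex.ofReal_exp, Real.exp_log hy]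

theorem continuousWithinAt_edgeRoot (k : ℕ) {τ E : ℝ} (hE : E < τ) :
    ContinuousWithinAt (edgeRoot k τ) upperHalf (E : ℂ) := by
  unfold edgeRoot
  have h0 : ContinuousWithinAt Complex.log {z | 0 ≤ z.im} ((E : ℂ) - τ) :=
    Complex.continuousWithinAt_log_of_re_neg_of_im_zero (by simpa using hE) (by simp)
  have h1 : ContinuousWithinAt (fun z : ℂ => Complex.log (z - τ)) upperHalf (E : ℂ) := by
    refine ContinuousWithinAt.comp (f := fun z : ℂ => z - τ) h0 (by fun_prop) ?_
    intro z hz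
    have : 0 < z.im := hz
    simpa using this.le
  exact ((h1.sub continuousWithinAt_const).div_const _).cexp

/-- Boundary values of `edgeRoot` to the right of `τ`. -/
theorem edgeRoot_of_lt (k : ℕ) {τ E : ℝ} (hE : τ < E) :
    edgeRoot k τ E = Complex.exp (-(Real.pi / k : ℝ) * Complex.I) *
      (((E - τ) ^ ((k : ℝ)⁻¹) : ℝ) : ℂ) := by
  have h : 0 < E - τ := sub_pos.2 hE
  rw [edgeRoot, Real.rpow_def_of_pos h, ← Complex.ofReal_sub, ← Complex.ofReal_log h.le,
    Complex.ofReal_exp, ← Complex.exp_add]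
  congr 1
  push_cast
  ring

/-- Let `m` be a holomorphic right inverse of `Z` whose boundary values along `Z(I)` are the real
branch of `Z⁻¹` in `I`, and let `g` be a coordinate (a finite point of the line, or the point at
infinity) at the end of `I` in which `Z ∘ g = τ - c w^k (1 + o(1))`. Extracting the `k`-th root
makes this `τ - φ(w)^k` with `φ` locally biholomorphic, so `m = g ∘ φ⁻¹ ∘ (τ - ·)^(1/k)` near the
edge `τ`. -/
theorem exists_edge_expansion {Z m g h : ℂ → ℂ} {I : Set ℝ} {τ c : ℝ} {k : ℕ} (hk : k ≠ 0)
    (hZ : ∀ x ∈ I, AnalyticAt ℂ Z (x : ℂ)) (hZ' : ∀ x ∈ I, deriv Z (x : ℂ) ≠ 0)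
    (hreal : ∀ x ∈ I, (Z (x : ℂ)).im = 0)
    (hm : AnalyticOnNhd ℂ m upperHalf) (hmZ : ∀ z ∈ upperHalf, Z (m z) = z)
    (hbd : ∀ x ∈ I, Tendsto m (𝓝[upperHalf] (Z x)) (𝓝 (x : ℂ)))
    (hh : AnalyticAt ℂ h 0) (hh0 : h 0 = c) (hc : 0 < c)
    (hg : ∀ᶠ w in 𝓝[≠] (0 : ℂ), AnalyticAt ℂ g w)
    (hZg : ∀ᶠ w in 𝓝[≠] (0 : ℂ), Z (g w) = τ - w ^ k * h w)
    (hgI : ∀ᶠ t : ℝ in 𝓝[>] 0, ∃ x ∈ I, g t = x) :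
    ∃ ψ : ℂ → ℂ, ∃ a : ℝ, AnalyticAt ℂ ψ 0 ∧ ψ 0 = 0 ∧ 0 < a ∧ HasDerivAt ψ a 0 ∧
      (∀ᶠ u in 𝓝[≠] (0 : ℂ), ψ u ≠ 0) ∧
      ∀ᶠ z in 𝓝[upperHalf] (τ : ℂ), m z = g (ψ (edgeRoot k τ z)) := by
  have hslit : h 0 ∈ Complex.slitPlane := by rw [hh0]; exact Or.inl (by simpa using hc)
  set φ : ℂ → ℂ := fun w => w * h w ^ ((k : ℂ)⁻¹) with hφ
  have hpan : AnalyticAt ℂ (fun w => h w ^ ((k : ℂ)⁻¹)) 0 := hh.cpow analyticAt_const hslit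
  have hφan : AnalyticAt ℂ φ 0 := analyticAt_id.mul hpan
  have hφpow : ∀ w, φ w ^ k = w ^ k * h w := fun w => by
    simp only [hφ]
    rw [mul_pow, Complex.cpow_nat_inv_pow _ hk]
  have hcpow : ((c : ℂ)) ^ ((k : ℂ)⁻¹) = ((c ^ ((k : ℝ)⁻¹) : ℝ) : ℂ) := by
    rw [Complex.ofReal_cpow hc.le]; simp
  have hcpos : 0 < c ^ ((k : ℝ)⁻¹) := Real.rpow_pos_of_pos hc _
  have hφd : deriv φ 0 = ((c ^ ((k : ℝ)⁻¹) : ℝ) : ℂ) := by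
    have := ((hasDerivAt_id (0 : ℂ)).mul hpan.differentiableAt.hasDerivAt).deriv
    simp only [id, zero_mul, add_zero, one_mul] at this
    rw [hφ, ← hcpow, ← hh0]
    exact this
  have hφ0 : φ 0 = 0 := by simp [hφ]
  have hφd' : deriv φ 0 ≠ 0 := by rw [hφd]; exact_mod_cast hcpos.ne'
  obtain ⟨ψ, hψ, hψ0, hl, hr, hψd⟩ := exists_analytic_local_inverse hφan hφd'
  rw [hφ0] at hψ hψ0 hr hψd
  rw [hφd, ← Complex.ofReal_inv] at hψd
  have hψt : Tendsto ψ (𝓝 0) (𝓝 0) := by simpa [hψ0] using hψ.continuousAt.tendsto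
  have hne : ∀ u, φ (ψ u) = u → u ≠ 0 → ψ u ≠ 0 := fun u h1 h2 h3 => by
    rw [h3, hφ0] at h1
    exact h2 h1.symm
  have hgood : ∀ᶠ u in 𝓝 (0 : ℂ), AnalyticAt ℂ ψ u ∧ φ (ψ u) = u ∧
      (ψ u ≠ 0 → AnalyticAt ℂ g (ψ u) ∧ Z (g (ψ u)) = τ - ψ u ^ k * h (ψ u)) := by
    have e := hψt.eventually (eventually_nhdsWithin_iff.1 (hg.and hZg))
    filter_upwards [hψ.eventually_analyticAt, hr, e] with u h1 h2 h3
    exact ⟨h1, h2, h3⟩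
  refine ⟨ψ, _, hψ, hψ0, inv_pos.2 hcpos, hψd, ?_, ?_⟩
  · filter_upwards [mem_nhdsWithin_of_mem_nhds hr, self_mem_nhdsWithin] with u h1 h2
    exact hne u h1 h2
  obtain ⟨s, hs, hball⟩ := Metric.eventually_nhds_iff_ball.1 hgood
  set r : ℝ := s ^ k with hrdef
  have hr0 : 0 < r := pow_pos hs k
  have hu : ∀ z ∈ Metric.ball (τ : ℂ) r, z ≠ τ → edgeRoot k τ z ∈ Metric.ball (0 : ℂ) s := by
    intro z hz hz'
    rw [mem_ball_zero_iff]
    exact norm_edgeRoot_lt hk hz' hs.le (by simpa [dist_eq_norm] using hz)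
  have hψu : ∀ z ∈ Metric.ball (τ : ℂ) r, z ≠ τ → ψ (edgeRoot k τ z) ≠ 0 := fun z hz hz' =>
    hne _ (hball _ (hu z hz hz')).2.1 (edgeRoot_ne_zero _ _ _)
  have han : AnalyticOnNhd ℂ (fun z => g (ψ (edgeRoot k τ z)))
      (Metric.ball (τ : ℂ) r ∩ upperHalf) := by
    intro z hz
    have hz' : z ≠ τ := ne_ofReal_of_mem_upperHalf hz.2
    have h1 := hball _ (hu z hz.1 hz')
    have h2 : AnalyticAt ℂ (fun z => ψ (edgeRoot k τ z)) z :=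
      h1.1.comp (analyticAt_edgeRoot k (sub_mem_slitPlane_of_mem_upperHalf hz.2))
    exact AnalyticAt.comp (f := fun z => ψ (edgeRoot k τ z))
      (h1.2.2 (hψu z hz.1 hz')).1 h2
  have hinv : ∀ z ∈ Metric.ball (τ : ℂ) r, z ≠ τ → Z (g (ψ (edgeRoot k τ z))) = z := by
    intro z hz hz'
    have h1 := hball _ (hu z hz hz')
    rw [(h1.2.2 (hψu z hz hz')).2, ← hφpow, h1.2.1, edgeRoot_pow hk hz']
    ring
  -- a real point `x = g t` of `I` close to its end
  have hcast := tendsto_ofReal_nhdsGT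
  have hcast0 : Tendsto (fun x : ℝ => (x : ℂ)) (𝓝[>] 0) (𝓝 0) :=
    hcast.mono_right nhdsWithin_le_nhds
  have hφs : ∀ᶠ w in 𝓝 (0 : ℂ), φ w ∈ Metric.ball (0 : ℂ) s := by
    have := hφan.continuousAt.tendsto
    rw [hφ0] at this
    exact this.eventually (Metric.ball_mem_nhds 0 hs)
  have hhre : ∀ᶠ w in 𝓝 (0 : ℂ), 0 < (h w).re := by
    have := (Complex.continuous_re.continuousAt.comp hh.continuousAt).tendsto
    simp only [Function.comp, hh0, Complex.ofReal_re] at this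
    exact this.eventually (lt_mem_nhds hc)
  obtain ⟨t, ⟨⟨x, hxI, hxt⟩, ht1, ht2, ht3⟩, ht4, ht5, ht6⟩ := ((hgI.and
    ((hcast0.eventually hl).and ((hcast0.eventually hφs).and (hcast0.eventually hhre)))).and
    ((hcast.eventually hZg).and ((hcast.eventually hg).and self_mem_nhdsWithin))).exists
  have ht6' : (0 : ℝ) < t := ht6
  have htk : (t : ℂ) ^ k ≠ 0 := pow_ne_zero _ (by exact_mod_cast ht6'.ne')
  have hxre : Z x = (((Z x).re : ℝ) : ℂ) := by apply Complex.ext <;> simp [hreal x hxI]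
  have hhb : h t = (((τ - (Z x).re) / t ^ k : ℝ) : ℂ) := by
    rw [hxt, hxre] at ht4
    push_cast
    rw [ht4]
    field_simp
    ring
  set b : ℝ := (τ - (Z x).re) / t ^ k with hb
  have hbpos : 0 < b := by rw [hhb] at ht3; simpa using ht3
  set y : ℝ := t * b ^ ((k : ℝ)⁻¹) with hy
  have hypos : 0 < y := mul_pos ht6' (Real.rpow_pos_of_pos hbpos _)
  have hφt : φ t = y := by
    simp only [hφ, hhb, hy]
    push_cast
    rw [Complex.ofReal_cpow hbpos.le]
    simp
  have hyk : y ^ k = τ - (Z x).re := by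
    rw [hy, mul_pow, Real.rpow_inv_natCast_pow hbpos.le hk, hb]
    field_simp
  have hE : (Z x).re = τ - y ^ k := by linarith
  rw [hφt] at ht1 ht2
  have hys : y < s := by
    rw [mem_ball_zero_iff, Complex.norm_real, Real.norm_of_nonneg hypos.le] at ht2
    exact ht2
  have hElt : (Z x).re < τ := by
    have := pow_pos hypos k
    linarith
  have hEball : (((Z x).re : ℝ) : ℂ) ∈ Metric.ball (τ : ℂ) r := by
    rw [mem_ball_iff_norm, ← Complex.ofReal_sub, Complex.norm_real, Real.norm_eq_abs, hE,
      sub_sub_cancel_left, abs_neg, abs_of_pos (pow_pos hypos k), hrdef]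
    exact pow_lt_pow_left₀ hys hypos.le hk
  have hrootE : edgeRoot k τ (((Z x).re : ℝ) : ℂ) = y := by rw [hE]; exact edgeRoot_sub_pow hk hypos
  have htend : Tendsto (fun z => g (ψ (edgeRoot k τ z))) (𝓝[upperHalf] (((Z x).re : ℝ) : ℂ))
      (𝓝 (x : ℂ)) := by
    have h1 : ContinuousAt ψ (edgeRoot k τ (((Z x).re : ℝ) : ℂ)) := by
      rw [hrootE]; exact (hball _ ht2).1.continuousAt
    have h2 : ContinuousAt (fun u => g (ψ u)) (edgeRoot k τ (((Z x).re : ℝ) : ℂ)) := by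
      refine ContinuousAt.comp (f := ψ) ?_ h1
      rw [hrootE, ht1]
      exact ht5.continuousAt
    have h3 := (h2.comp_continuousWithinAt (continuousWithinAt_edgeRoot k hElt)).tendsto
    simp only [Function.comp_def, hrootE, ht1, hxt] at h3
    exact h3
  have hmx := hbd x hxI
  rw [hxre] at hmx
  have hev : m =ᶠ[𝓝[upperHalf] (((Z x).re : ℝ) : ℂ)] fun z => g (ψ (edgeRoot k τ z)) := by
    refine eventually_eq_of_tendsto_of_rightInverse (hZ x hxI) (hZ' x hxI) hmx htend ?_ ?_
    · filter_upwards [self_mem_nhdsWithin] with z hz using hmZ z hz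
    · filter_upwards [self_mem_nhdsWithin,
        mem_nhdsWithin_of_mem_nhds (Metric.isOpen_ball.mem_nhds hEball)] with z h1 h2
      exact hinv z h2 (ne_ofReal_of_mem_upperHalf h1)
  have heq := eqOn_halfDisc (hm.mono Set.inter_subset_right) han hEball hev
  filter_upwards [self_mem_nhdsWithin,
    mem_nhdsWithin_of_mem_nhds (Metric.ball_mem_nhds (τ : ℂ) hr0)] with z h1 h2
  exact heq ⟨h2, h1⟩

end

end QuadEdge

namespace QuadEdge

/-! ### Stieltjes inversion -/

theorem im_one_div_sub (x E η : ℝ) :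
    (1 / ((x : ℂ) - (E + η * Complex.I))).im = η / ((x - E) ^ 2 + η ^ 2) := by
  rw [one_div, Complex.inv_im]
  simp [Complex.normSq_apply]
  ring_nf

theorem integrable_one_div_sub (ρ : Measure ℝ) [IsFiniteMeasure ρ] {z : ℂ} (hz : z ∈ upperHalf) :
    Integrable (fun x : ℝ => 1 / ((x : ℂ) - z)) ρ := by
  have hz' : 0 < z.im := hz
  have hne : ∀ x : ℝ, (x : ℂ) - z ≠ 0 := fun x h => by
    have := congrArg Complex.im h
    simp at this
    exact hz'.ne' this
  have hcont : Continuous fun x : ℝ => 1 / ((x : ℂ) - z) :=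
    continuous_const.div (by fun_prop) hne
  refine Integrable.of_bound hcont.aestronglyMeasurable (1 / z.im) (Eventually.of_forall ?_)
  intro x
  rw [norm_div, norm_one]
  refine one_div_le_one_div_of_le hz' ?_
  have := Complex.abs_im_le_norm ((x : ℂ) - z)
  simp only [Complex.sub_im, Complex.ofReal_im, zero_sub, abs_neg] at this
  exact (le_abs_self _).trans this

theorem im_stieltjes (ρ : Measure ℝ) [IsFiniteMeasure ρ] (E : ℝ) {η : ℝ} (hη : 0 < η) :
    (∫ x : ℝ, 1 / ((x : ℂ) - (E + η * Complex.I)) ∂ρ).im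
      = ∫ x : ℝ, η / ((x - E) ^ 2 + η ^ 2) ∂ρ := by
  have h := integral_im (integrable_one_div_sub ρ (ofReal_add_mul_I_mem_upperHalf (E := E) hη))
  simp only [RCLike.im_to_complex] at h
  rw [← h]
  exact integral_congr_ae (Eventually.of_forall fun x => im_one_div_sub x E η)

theorem poisson_le {y η : ℝ} (hη : 0 < η) : η / (y ^ 2 + η ^ 2) ≤ 1 / η := by
  rw [div_le_div_iff₀ (by positivity) hη]
  nlinarith [sq_nonneg y]

theorem integrable_poisson (ρ : Measure ℝ) [IsFiniteMeasure ρ] (E : ℝ) {η : ℝ} (hη : 0 < η) :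
    Integrable (fun x : ℝ => η / ((x - E) ^ 2 + η ^ 2)) ρ := by
  have hcont : Continuous fun x : ℝ => η / ((x - E) ^ 2 + η ^ 2) :=
    continuous_const.div (by fun_prop) fun x => by positivity
  refine Integrable.of_bound hcont.aestronglyMeasurable (1 / η) (Eventually.of_forall fun x => ?_)
  rw [Real.norm_of_nonneg (by positivity)]
  exact poisson_le hη

/-- An atom of `ρ` makes the Stieltjes transform blow up. -/
theorem measureReal_singleton_le (ρ : Measure ℝ) [IsFiniteMeasure ρ] (E : ℝ) {η : ℝ}
    (hη : 0 < η) :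
    ρ.real {E} ≤ η * (∫ x : ℝ, 1 / ((x : ℂ) - (E + η * Complex.I)) ∂ρ).im := by
  rw [im_stieltjes ρ E hη, ← integral_const_mul, ← integral_indicator_one (measurableSet_singleton E)]
  refine integral_mono ?_ ((integrable_poisson ρ E hη).const_mul η) ?_
  · exact (integrable_const (1 : ℝ)).indicator (measurableSet_singleton E)
  · intro x
    by_cases hx : x = E
    · subst hx
      simp only [Set.mem_singleton_iff, Set.indicator_of_mem, Pi.one_apply, sub_self]
      field_simp
      norm_num
    · rw [Set.indicator_of_notMem (by simpa using hx)]
      positivity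

theorem tendsto_ofReal_add_mul_I (E : ℝ) :
    Tendsto (fun η : ℝ => (E : ℂ) + η * Complex.I) (𝓝[>] 0) (𝓝[upperHalf] (E : ℂ)) := by
  refine tendsto_nhdsWithin_iff.2 ⟨?_, ?_⟩
  · have : Continuous fun η : ℝ => (E : ℂ) + η * Complex.I := by fun_prop
    exact (this.tendsto' 0 _ (by simp)).mono_left nhdsWithin_le_nhds
  · filter_upwards [self_mem_nhdsWithin] with η hη using ofReal_add_mul_I_mem_upperHalf hη

theorem measure_singleton_eq_zero {ρ : Measure ℝ} [IsFiniteMeasure ρ] {m : ℂ → ℂ}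
    (hm : ∀ z ∈ upperHalf, m z = ∫ x : ℝ, 1 / ((x : ℂ) - z) ∂ρ) {E L : ℝ}
    (h : Tendsto (fun z => (m z).im) (𝓝[upperHalf] (E : ℂ)) (𝓝 L)) : ρ {E} = 0 := by
  have h1 : Tendsto (fun η : ℝ => η * (m (E + η * Complex.I)).im) (𝓝[>] 0) (𝓝 (0 * L)) :=
    Tendsto.mul (tendsto_id.mono_left nhdsWithin_le_nhds) (h.comp (tendsto_ofReal_add_mul_I E))
  have h2 : ρ.real {E} ≤ 0 * L := by
    refine ge_of_tendsto h1 ?_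
    filter_upwards [self_mem_nhdsWithin] with η hη
    rw [hm _ (ofReal_add_mul_I_mem_upperHalf hη)]
    exact measureReal_singleton_le ρ E hη
  rw [zero_mul] at h2
  exact (measureReal_eq_zero_iff (measure_ne_top ρ {E})).1 (le_antisymm h2 measureReal_nonneg)

theorem hasDerivAt_arctan_div (x E : ℝ) {η : ℝ} (hη : 0 < η) :
    HasDerivAt (fun E => Real.arctan ((E - x) / η)) (η / ((x - E) ^ 2 + η ^ 2)) E := by
  have h1 : HasDerivAt (fun E => (E - x) / η) (1 / η) E :=
    ((hasDerivAt_id E).sub_const x).div_const η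
  convert h1.arctan using 1
  have := hη.ne'
  have h3 : (x - E) ^ 2 + η ^ 2 ≠ 0 := by positivity
  have h4 : 1 + ((E - x) / η) ^ 2 ≠ 0 := by positivity
  field_simp
  ring

theorem integral_im_stieltjes (ρ : Measure ℝ) [IsFiniteMeasure ρ] {c d : ℝ} (hcd : c ≤ d) {η : ℝ}
    (hη : 0 < η) :
    ∫ E in c..d, (∫ x : ℝ, 1 / ((x : ℂ) - (E + η * Complex.I)) ∂ρ).im
      = ∫ x : ℝ, (Real.arctan ((d - x) / η) - Real.arctan ((c - x) / η)) ∂ρ := by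
  have h1 : ∀ x : ℝ, ∫ E in c..d, η / ((x - E) ^ 2 + η ^ 2)
      = Real.arctan ((d - x) / η) - Real.arctan ((c - x) / η) := fun x => by
    refine intervalIntegral.integral_eq_sub_of_hasDerivAt
      (fun E _ => hasDerivAt_arctan_div x E hη) ?_
    refine Continuous.intervalIntegrable ?_ _ _
    exact continuous_const.div (by fun_prop) fun E => by positivity
  simp_rw [im_stieltjes ρ _ hη, ← h1, intervalIntegral.integral_of_le hcd]
  refine integral_integral_swap ?_
  have hcont : Continuous (Function.uncurry fun E x : ℝ => η / ((x - E) ^ 2 + η ^ 2)) := by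
    unfold Function.uncurry
    exact continuous_const.div (by fun_prop) fun p => by positivity
  refine Integrable.of_bound hcont.aestronglyMeasurable (1 / η) (Eventually.of_forall fun p => ?_)
  simp only [Function.uncurry]
  rw [Real.norm_of_nonneg (by positivity)]
  exact poisson_le hη

theorem tendsto_div_nhdsGT_zero_atTop {y : ℝ} (hy : 0 < y) :
    Tendsto (fun η : ℝ => y / η) (𝓝[>] 0) atTop := by
  simpa [div_eq_mul_inv] using tendsto_inv_nhdsGT_zero.const_mul_atTop hy

theorem tendsto_arctan_div_pos {y : ℝ} (hy : 0 < y) :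
    Tendsto (fun η : ℝ => Real.arctan (y / η)) (𝓝[>] 0) (𝓝 (Real.pi / 2)) :=
  (Real.tendsto_arctan_atTop.mono_right nhdsWithin_le_nhds).comp
    (tendsto_div_nhdsGT_zero_atTop hy)

theorem tendsto_arctan_div_neg {y : ℝ} (hy : y < 0) :
    Tendsto (fun η : ℝ => Real.arctan (y / η)) (𝓝[>] 0) (𝓝 (-(Real.pi / 2))) := by
  have := (tendsto_arctan_div_pos (neg_pos.2 hy)).neg
  refine this.congr fun η => ?_
  rw [neg_div, Real.arctan_neg, neg_neg]

/-- Stieltjes inversion on an interval without atoms at its end points. -/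
theorem tendsto_integral_im_stieltjes (ρ : Measure ℝ) [IsFiniteMeasure ρ] {c d : ℝ} (hcd : c < d)
    (hc : ρ {c} = 0) (hd : ρ {d} = 0) :
    Tendsto (fun η : ℝ =>
        ∫ E in c..d, (∫ x : ℝ, 1 / ((x : ℂ) - (E + η * Complex.I)) ∂ρ).im)
      (𝓝[>] 0) (𝓝 (Real.pi * ρ.real (Set.Ioo c d))) := by
  have hlim : Tendsto (fun η : ℝ =>
      ∫ x : ℝ, (Real.arctan ((d - x) / η) - Real.arctan ((c - x) / η)) ∂ρ) (𝓝[>] 0)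
      (𝓝 (∫ x : ℝ, (Set.Ioo c d).indicator (fun _ => Real.pi) x ∂ρ)) := by
    refine tendsto_integral_filter_of_dominated_convergence (fun _ => Real.pi) ?_ ?_
      (integrable_const _) ?_
    · refine Eventually.of_forall fun η => Continuous.aestronglyMeasurable ?_
      fun_prop
    · refine Eventually.of_forall fun η => Eventually.of_forall fun x => ?_
      have h1 := Real.neg_pi_div_two_lt_arctan ((d - x) / η)
      have h2 := Real.arctan_lt_pi_div_two ((d - x) / η)
      have h3 := Real.neg_pi_div_two_lt_arctan ((c - x) / η)
      have h4 := Real.arctan_lt_pi_div_two ((c - x) / η)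
      rw [Real.norm_eq_abs, abs_le]
      constructor <;> linarith
    · have hc' : ∀ᵐ x ∂ρ, x ≠ c := by
        rw [ae_iff]; simpa using hc
      have hd' : ∀ᵐ x ∂ρ, x ≠ d := by
        rw [ae_iff]; simpa using hd
      filter_upwards [hc', hd'] with x h1 h2
      rcases lt_or_gt_of_ne h1 with h1 | h1
      · rw [Set.indicator_of_notMem (fun h => absurd h.1 (not_lt.2 h1.le))]
        have := (tendsto_arctan_div_pos (sub_pos.2 (h1.trans hcd))).sub
          (tendsto_arctan_div_pos (sub_pos.2 h1))
        simpa using this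
      · rcases lt_or_gt_of_ne h2 with h2 | h2
        · rw [Set.indicator_of_mem (show x ∈ Set.Ioo c d from ⟨h1, h2⟩)]
          have := (tendsto_arctan_div_pos (sub_pos.2 h2)).sub
            (tendsto_arctan_div_neg (sub_neg.2 h1))
          simpa using this
        · rw [Set.indicator_of_notMem (fun h => absurd h.2 (not_lt.2 h2.le))]
          have := (tendsto_arctan_div_neg (sub_neg.2 h2)).sub
            (tendsto_arctan_div_neg (sub_neg.2 h1))
          simpa using this
  rw [integral_indicator_const _ measurableSet_Ioo, smul_eq_mul, mul_comm] at hlim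
  refine hlim.congr' ?_
  filter_upwards [self_mem_nhdsWithin] with η hη
  exact (integral_im_stieltjes ρ hcd.le hη).symm

/-- Boundary values that exist along an interval are approached with a uniform bound on compact
subsets. -/
theorem exists_bound_of_tendsto {F : ℂ → ℝ} {K : Set ℝ} (hK : IsCompact K) {L : ℝ → ℝ}
    (h : ∀ E ∈ K, Tendsto F (𝓝[upperHalf] (E : ℂ)) (𝓝 (L E))) :
    ∃ C : ℝ, ∃ η₀ > (0 : ℝ), ∀ E ∈ K, ∀ η : ℝ, 0 < η → η < η₀ → ‖F (E + η * Complex.I)‖ ≤ C := by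
  refine hK.induction_on (p := fun s => ∃ C : ℝ, ∃ η₀ > (0 : ℝ), ∀ E ∈ s, ∀ η : ℝ, 0 < η → η < η₀ →
    ‖F (E + η * Complex.I)‖ ≤ C) ⟨0, 1, one_pos, by simp⟩ ?_ ?_ ?_
  · rintro s t hst ⟨C, η₀, h0, hC⟩
    exact ⟨C, η₀, h0, fun E hE => hC E (hst hE)⟩
  · rintro s t ⟨C, η₀, h0, hC⟩ ⟨C', η₀', h0', hC'⟩
    refine ⟨max C C', min η₀ η₀', lt_min h0 h0', ?_⟩
    rintro E (hE | hE) η h1 h2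
    · exact (hC E hE η h1 (h2.trans_le (min_le_left _ _))).trans (le_max_left _ _)
    · exact (hC' E hE η h1 (h2.trans_le (min_le_right _ _))).trans (le_max_right _ _)
  · intro E hE
    have h1 : ∀ᶠ z in 𝓝[upperHalf] (E : ℂ), ‖F z‖ < ‖L E‖ + 1 :=
      (h E hE).norm.eventually (gt_mem_nhds (lt_add_one _))
    rw [eventually_nhdsWithin_iff] at h1
    obtain ⟨r, hr, hball⟩ := Metric.eventually_nhds_iff_ball.1 h1
    refine ⟨Metric.ball E (r / 2), mem_nhdsWithin_of_mem_nhds (Metric.ball_mem_nhds E (by linarith)),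
      ‖L E‖ + 1, r / 2, by linarith, ?_⟩
    intro E' hE' η h1 h2
    refine (hball _ ?_ (ofReal_add_mul_I_mem_upperHalf h1)).le
    rw [mem_ball_iff_norm] at hE' ⊢
    have h3 : (E' : ℂ) + η * Complex.I - E = ((E' - E : ℝ) : ℂ) + η * Complex.I := by
      push_cast; ring
    rw [h3]
    refine (norm_add_le _ _).trans_lt ?_
    rw [Complex.norm_real, norm_mul, Complex.norm_real, Complex.norm_I, mul_one,
      Real.norm_of_nonneg h1.le]
    linarith

/-- Measures that agree on the intervals compactly contained in `(a, b)` agree on `(a, b)`. -/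
theorem restrict_Ioo_eq_of_Ioo {μ ν : Measure ℝ} [IsFiniteMeasure μ] {a b : ℝ}
    (h : ∀ c d, a < c → c < d → d < b → μ (Set.Ioo c d) = ν (Set.Ioo c d)) :
    μ.restrict (Set.Ioo a b) = ν.restrict (Set.Ioo a b) := by
  have key : ∀ c d, a ≤ c → d ≤ b → μ (Set.Ioo c d) = ν (Set.Ioo c d) := by
    intro c d hc hd
    have hmono : Monotone fun n : ℕ => Set.Ioo (c + 1 / ((n : ℝ) + 1)) (d - 1 / ((n : ℝ) + 1)) := by
      intro p q hpq
      have : 1 / ((q : ℝ) + 1) ≤ 1 / ((p : ℝ) + 1) := Nat.one_div_le_one_div hpq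
      exact Set.Ioo_subset_Ioo (by linarith) (by linarith)
    have hU : Set.Ioo c d
        = ⋃ n : ℕ, Set.Ioo (c + 1 / ((n : ℝ) + 1)) (d - 1 / ((n : ℝ) + 1)) := by
      ext x
      simp only [Set.mem_iUnion, Set.mem_Ioo]
      constructor
      · rintro ⟨h1, h2⟩
        obtain ⟨n, hn⟩ := exists_nat_one_div_lt (lt_min (sub_pos.2 h1) (sub_pos.2 h2))
        have h3 := hn.trans_le (min_le_left _ _)
        have h4 := hn.trans_le (min_le_right _ _)
        exact ⟨n, by linarith, by linarith⟩
      · rintro ⟨n, h1, h2⟩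
        have : (0 : ℝ) < 1 / ((n : ℝ) + 1) := Nat.one_div_pos_of_nat
        exact ⟨by linarith, by linarith⟩
    rw [hU, hmono.measure_iUnion, hmono.measure_iUnion]
    refine iSup_congr fun n => ?_
    have : (0 : ℝ) < 1 / ((n : ℝ) + 1) := Nat.one_div_pos_of_nat
    rcases lt_or_ge (c + 1 / ((n : ℝ) + 1)) (d - 1 / ((n : ℝ) + 1)) with h1 | h1
    · exact h _ _ (by linarith) h1 (by linarith)
    · rw [Set.Ioo_eq_empty (not_lt.2 h1)]
      simp
  refine Real.measure_ext_Ioo_rat fun p q => ?_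
  rw [Measure.restrict_apply measurableSet_Ioo, Measure.restrict_apply measurableSet_Ioo,
    Set.Ioo_inter_Ioo]
  exact key _ _ le_sup_right inf_le_right

/-- Stieltjes inversion: a measure whose Stieltjes transform `m` has continuous boundary values on
an interval, with imaginary part `π f`, has density `f` there. -/
theorem hasDensityOn_of_tendsto {ρ : Measure ℝ} [IsFiniteMeasure ρ] {m : ℂ → ℂ}
    (hmU : ∀ z ∈ upperHalf, m z ∈ upperHalf)
    (hm : ∀ z ∈ upperHalf, m z = ∫ x : ℝ, 1 / ((x : ℂ) - z) ∂ρ) {a b : ℝ} {f : ℝ → ℝ}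
    (hf : ContinuousOn f (Set.Ioo a b))
    (h : ∀ E ∈ Set.Ioo a b,
      Tendsto (fun z => (m z).im) (𝓝[upperHalf] (E : ℂ)) (𝓝 (Real.pi * f E))) :
    HasDensityOn ρ (Set.Ioo a b) ((Set.Ioo a b).indicator f) := by
  have hf0 : ∀ E ∈ Set.Ioo a b, 0 ≤ f E := by
    intro E hE
    have := neBot_nhdsWithin_upperHalf E
    have h1 : 0 ≤ Real.pi * f E := by
      refine ge_of_tendsto (h E hE) ?_
      filter_upwards [self_mem_nhdsWithin] with z hz using le_of_lt (hmU z hz)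
    exact nonneg_of_mul_nonneg_right h1 Real.pi_pos
  have hmeas : Measurable ((Set.Ioo a b).indicator f) := by
    have h0 : ContinuousOn (fun _ : ℝ => (0 : ℝ)) (Set.Ioo a b)ᶜ := continuousOn_const
    have := hf.measurable_piecewise h0 measurableSet_Ioo
    rw [← Set.piecewise_eq_indicator]
    exact this
  refine ⟨hmeas, fun x => Set.indicator_nonneg hf0 x, ?_⟩
  rw [← restrict_withDensity measurableSet_Ioo]
  refine restrict_Ioo_eq_of_Ioo fun c d hc hcd hd => ?_
  have hsub : Set.Icc c d ⊆ Set.Ioo a b := Set.Icc_subset_Ioo hc hd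
  have hatom : ∀ E ∈ Set.Ioo a b, ρ {E} = 0 := fun E hE =>
    measure_singleton_eq_zero hm (h E hE)
  have hlim1 := tendsto_integral_im_stieltjes ρ hcd
    (hatom c (hsub ⟨le_rfl, hcd.le⟩)) (hatom d (hsub ⟨hcd.le, le_rfl⟩))
  obtain ⟨C, η₀, hη₀, hC⟩ := exists_bound_of_tendsto isCompact_Icc fun E hE => h E (hsub hE)
  have hlim2 : Tendsto (fun η : ℝ =>
      ∫ E in c..d, (∫ x : ℝ, 1 / ((x : ℂ) - (E + η * Complex.I)) ∂ρ).im) (𝓝[>] 0)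
      (𝓝 (∫ E in c..d, Real.pi * f E)) := by
    have hev : ∀ᶠ η : ℝ in 𝓝[>] 0, 0 < η ∧ η < η₀ := by
      filter_upwards [Ioo_mem_nhdsGT hη₀] with η hη using hη
    refine intervalIntegral.tendsto_integral_filter_of_dominated_convergence (fun _ => C) ?_ ?_
      (by simp) ?_
    · filter_upwards [hev] with η hη
      refine Measurable.aestronglyMeasurable ?_
      simp_rw [im_stieltjes ρ _ hη.1]
      have hcont : Continuous (Function.uncurry fun E x : ℝ => η / ((x - E) ^ 2 + η ^ 2)) := by
        unfold Function.uncurry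
        have := hη.1
        exact continuous_const.div (by fun_prop) fun p => by positivity
      exact (hcont.stronglyMeasurable.integral_prod_right (ν := ρ)).measurable
    · filter_upwards [hev] with η hη
      refine Eventually.of_forall fun E hE => ?_
      rw [Set.uIoc_of_le hcd.le] at hE
      rw [← hm _ (ofReal_add_mul_I_mem_upperHalf hη.1)]
      exact hC E (Set.Ioc_subset_Icc_self hE) η hη.1 hη.2
    · refine Eventually.of_forall fun E hE => ?_
      rw [Set.uIoc_of_le hcd.le] at hE
      refine ((h E (hsub (Set.Ioc_subset_Icc_self hE))).comp (tendsto_ofReal_add_mul_I E)).congr' ?_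
      filter_upwards [hev] with η hη
      simp only [Function.comp]
      rw [hm _ (ofReal_add_mul_I_mem_upperHalf hη.1)]
  have heq := tendsto_nhds_unique hlim1 hlim2
  rw [intervalIntegral.integral_const_mul] at heq
  have heq' := mul_left_cancel₀ Real.pi_ne_zero heq
  have hint : IntegrableOn f (Set.Ioo c d) :=
    ((hf.mono hsub).integrableOn_Icc).mono_set Set.Ioo_subset_Icc_self
  rw [withDensity_apply _ measurableSet_Ioo]
  have h3 : ∫⁻ x in Set.Ioo c d, ENNReal.ofReal ((Set.Ioo a b).indicator f x)
      = ∫⁻ x in Set.Ioo c d, ENNReal.ofReal (f x) := by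
    refine setLIntegral_congr_fun measurableSet_Ioo fun x hx => ?_
    rw [Set.indicator_of_mem (hsub (Set.Ioo_subset_Icc_self hx))]
  rw [h3, ← ofReal_integral_eq_lintegral_ofReal hint, ← integral_Ioc_eq_integral_Ioo,
    ← intervalIntegral.integral_of_le hcd.le, ← heq', ofReal_measureReal]
  filter_upwards [ae_restrict_mem measurableSet_Ioo] with x hx
  exact hf0 x (hsub (Set.Ioo_subset_Icc_self hx))

end QuadEdge

namespace QuadEdge

/-! ### Left edges of a measure whose Stieltjes transform inverts a given function -/

/-- `m` is the Stieltjes transform of `ρ` and a right inverse of `Z` on the upper half-plane. -/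
structure IsStieltjesInverse (ρ : Measure ℝ) (m Z : ℂ → ℂ) : Prop where
  mapsTo : ∀ z ∈ upperHalf, m z ∈ upperHalf
  analytic : AnalyticOnNhd ℂ m upperHalf
  tendsto_zero : Tendsto m (Bornology.cobounded ℂ ⊓ 𝓟 upperHalf) (𝓝 0)
  rightInverse : ∀ z ∈ upperHalf, Z (m z) = z
  eq_integral : ∀ z ∈ upperHalf, m z = ∫ x : ℝ, 1 / ((x : ℂ) - z) ∂ρ

/-- `I` is an interval starting at `0` on which `Z` is real with non-vanishing derivative. At its
left end `Z w ∼ -1 / w`. At its right end, in the coordinate `g` (with `g 0 = x₀` or `g 0 = ∞`),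
`Z (g w) = τ - w ^ k * h w` with `h 0 = c > 0`; so `Z` maps `I` onto `(-∞, τ)`. -/
structure IsEdgeBranch (Z g h N : ℂ → ℂ) (I : Set ℝ) (τ c : ℝ) (k : ℕ) : Prop where
  isOpen : IsOpen I
  isPreconnected : IsPreconnected I
  near_zero : ∀ᶠ x : ℝ in 𝓝[>] 0, x ∈ I
  analytic : ∀ x ∈ I, AnalyticAt ℂ Z (x : ℂ)
  deriv_ne_zero : ∀ x ∈ I, deriv Z (x : ℂ) ≠ 0
  real : ∀ x ∈ I, (Z (x : ℂ)).im = 0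
  analytic_N : AnalyticAt ℂ N 0
  N_zero : N 0 = -1
  eq_N_div : ∀ᶠ w in 𝓝[≠] (0 : ℂ), Z w = N w / w
  k_ne_zero : k ≠ 0
  analytic_h : AnalyticAt ℂ h 0
  h_zero : h 0 = c
  c_pos : 0 < c
  analytic_g : ∀ᶠ w in 𝓝[≠] (0 : ℂ), AnalyticAt ℂ g w
  comp_eq : ∀ᶠ w in 𝓝[≠] (0 : ℂ), Z (g w) = τ - w ^ k * h w
  mem : ∀ᶠ t : ℝ in 𝓝[>] 0, ∃ x ∈ I, g t = x

section

variable {ρ : Measure ℝ} {m Z g h N : ℂ → ℂ} {I : Set ℝ} {τ c : ℝ} {k : ℕ}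

theorem IsEdgeBranch.tendsto_boundary (hB : IsEdgeBranch Z g h N I τ c k)
    (hS : IsStieltjesInverse ρ m Z) :
    ∀ x ∈ I, Tendsto m (𝓝[upperHalf] (Z x)) (𝓝 (x : ℂ)) := by
  have h1 := tendsto_boundary_near_zero hB.analytic_N hB.N_zero hB.eq_N_div hS.mapsTo
    hS.rightInverse hS.tendsto_zero
  obtain ⟨x₁, hx₁, hx₁I⟩ := (h1.and hB.near_zero).exists
  intro x hx
  exact tendsto_boundary_of_tendsto hB.isOpen hB.isPreconnected hB.analytic hB.deriv_ne_zero
    hB.real hS.analytic hS.rightInverse hx₁I hx₁ hx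

theorem IsEdgeBranch.exists_eq (hB : IsEdgeBranch Z g h N I τ c k) {E : ℝ} (hE : E < τ) :
    ∃ x ∈ I, Z x = E := by
  have hcont : ContinuousOn (fun x : ℝ => (Z x).re) I := fun x hx =>
    (Complex.continuous_re.continuousAt.comp
      (ContinuousAt.comp (f := fun x : ℝ => (x : ℂ)) (hB.analytic x hx).continuousAt
        Complex.continuous_ofReal.continuousAt)).continuousWithinAt
  -- `Z` is very negative near `0`
  have hlow : ∃ x ∈ I, (Z x).re ≤ E := by
    have hNre : ∀ᶠ w in 𝓝 (0 : ℂ), (N w).re < -(1 / 2) := by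
      have := (Complex.continuous_re.continuousAt.comp hB.analytic_N.continuousAt).tendsto
      simp only [Function.comp, hB.N_zero, Complex.neg_re, Complex.one_re] at this
      exact this.eventually (gt_mem_nhds (by norm_num))
    have hNre' := tendsto_ofReal_nhdsGT.eventually (mem_nhdsWithin_of_mem_nhds hNre)
    have hsmall : ∀ᶠ x : ℝ in 𝓝[>] 0, x < 1 / (2 * (|E| + 1)) := by
      filter_upwards [Ioo_mem_nhdsGT (show (0 : ℝ) < 1 / (2 * (|E| + 1)) by positivity)] with x hx
        using hx.2
    obtain ⟨x, ⟨h1, h2⟩, h3, h4, h5⟩ := ((hNre'.and hB.near_zero).and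
      ((tendsto_ofReal_nhdsGT.eventually hB.eq_N_div).and
        (hsmall.and self_mem_nhdsWithin))).exists
    have h5' : (0 : ℝ) < x := h5
    refine ⟨x, h2, ?_⟩
    rw [h3, Complex.div_ofReal_re, div_le_iff₀ h5']
    have h1' : (N (x : ℂ)).re < -(1 / 2) := h1
    rw [lt_div_iff₀ (by positivity)] at h4
    have := neg_abs_le E
    nlinarith [abs_nonneg E]
  -- and close to `τ` near the other end
  have hhigh : ∃ x ∈ I, E ≤ (Z x).re := by
    have h0 : Tendsto (fun w : ℂ => ((τ : ℂ) - w ^ k * h w).re) (𝓝 0) (𝓝 τ) := by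
      have : ContinuousAt (fun w : ℂ => ((τ : ℂ) - w ^ k * h w).re) 0 :=
        Complex.continuous_re.continuousAt.comp
          (continuousAt_const.sub ((continuousAt_id.pow k).mul hB.analytic_h.continuousAt))
      have := this.tendsto
      simpa [hB.k_ne_zero] using this
    have h1 := tendsto_ofReal_nhdsGT.eventually
      (mem_nhdsWithin_of_mem_nhds (h0.eventually (lt_mem_nhds hE)))
    obtain ⟨t, h1, ⟨x, hx, hgx⟩, h3⟩ :=
      (h1.and (hB.mem.and (tendsto_ofReal_nhdsGT.eventually hB.comp_eq))).exists
    refine ⟨x, hx, ?_⟩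
    rw [← hgx, h3]
    exact le_of_lt h1
  obtain ⟨x₁, hx₁, h1⟩ := hlow
  obtain ⟨x₂, hx₂, h2⟩ := hhigh
  obtain ⟨x, hx, hxE⟩ := hB.isPreconnected.intermediate_value hx₁ hx₂ hcont ⟨h1, h2⟩
  refine ⟨x, hx, ?_⟩
  apply Complex.ext
  · simpa using hxE
  · simpa using hB.real x hx

theorem IsEdgeBranch.measure_Iio [IsFiniteMeasure ρ] (hB : IsEdgeBranch Z g h N I τ c k)
    (hS : IsStieltjesInverse ρ m Z) : ρ (Set.Iio τ) = 0 := by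
  have h1 : ∀ n : ℕ, ρ (Set.Ioo (τ - n) τ) = 0 := by
    intro n
    have := hasDensityOn_of_tendsto hS.mapsTo hS.eq_integral (a := τ - n) (b := τ)
      (f := fun _ => 0) continuousOn_const ?_
    · have h2 := congrArg (fun μ : Measure ℝ => μ Set.univ) this.2.2
      simpa using h2
    · intro E hE
      obtain ⟨x, hx, hxE⟩ := hB.exists_eq hE.2
      have h2 := hB.tendsto_boundary hS x hx
      rw [hxE] at h2
      have h3 := (Complex.continuous_im.tendsto (x : ℂ)).comp h2
      simpa [Function.comp_def] using h3
  have h2 : Set.Iio τ = ⋃ n : ℕ, Set.Ioo (τ - n) τ := by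
    ext x
    simp only [Set.mem_Iio, Set.mem_iUnion, Set.mem_Ioo]
    constructor
    · intro hx
      obtain ⟨n, hn⟩ := exists_nat_gt (τ - x)
      exact ⟨n, by linarith, hx⟩
    · rintro ⟨n, -, hx⟩
      exact hx
  rw [h2]
  exact measure_iUnion_null h1

theorem tendsto_edgeRoot {k : ℕ} (hk : k ≠ 0) (τ : ℝ) :
    Tendsto (edgeRoot k τ) (𝓝[≠] (τ : ℂ)) (𝓝[≠] 0) := by
  refine tendsto_nhdsWithin_iff.2 ⟨?_, Eventually.of_forall fun z => edgeRoot_ne_zero k τ z⟩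
  rw [Metric.tendsto_nhds]
  intro ε hε
  filter_upwards [self_mem_nhdsWithin,
    mem_nhdsWithin_of_mem_nhds (Metric.ball_mem_nhds (τ : ℂ) (pow_pos hε k))] with z h1 h2
  rw [dist_zero_right]
  exact norm_edgeRoot_lt hk h1 hε.le (by simpa [dist_eq_norm] using h2)

theorem tendsto_ofReal_nhdsGT' (τ : ℝ) :
    Tendsto (fun x : ℝ => (x : ℂ)) (𝓝[>] τ) (𝓝[≠] (τ : ℂ)) := by
  refine tendsto_nhdsWithin_iff.2 ⟨?_, ?_⟩
  · exact (Complex.continuous_ofReal.tendsto τ).mono_left nhdsWithin_le_nhds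
  · filter_upwards [self_mem_nhdsWithin] with x hx
    simpa using (ne_of_gt hx)

theorem sub_mem_slitPlane_of_lt {τ E : ℝ} (hE : τ < E) : (E : ℂ) - τ ∈ Complex.slitPlane := by
  rw [← Complex.ofReal_sub]
  exact Or.inl (by simpa using hE)

/-- Just to the right of the edge, `ρ` has a density, which is read off the expansion of `m`. -/
theorem IsEdgeBranch.exists_density [IsFiniteMeasure ρ] (hB : IsEdgeBranch Z g h N I τ c k)
    (hS : IsStieltjesInverse ρ m Z) :
    ∃ ψ : ℂ → ℂ, ∃ a : ℝ, AnalyticAt ℂ ψ 0 ∧ ψ 0 = 0 ∧ 0 < a ∧ HasDerivAt ψ a 0 ∧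
      (∀ᶠ z in 𝓝[upperHalf] (τ : ℂ), m z = g (ψ (edgeRoot k τ z))) ∧
      ∃ κ > 0, HasDensityOn ρ (Set.Ioo τ (τ + κ)) ((Set.Ioo τ (τ + κ)).indicator
        fun E => (g (ψ (edgeRoot k τ E))).im / Real.pi) := by
  obtain ⟨ψ, a, h1, h2, h3, h4, h5, h6⟩ := exists_edge_expansion hB.k_ne_zero hB.analytic
    hB.deriv_ne_zero hB.real hS.analytic hS.rightInverse (hB.tendsto_boundary hS) hB.analytic_h
    hB.h_zero hB.c_pos hB.analytic_g hB.comp_eq hB.mem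
  refine ⟨ψ, a, h1, h2, h3, h4, h6, ?_⟩
  have hψt : Tendsto ψ (𝓝[≠] 0) (𝓝[≠] 0) := by
    refine tendsto_nhdsWithin_iff.2 ⟨?_, h5⟩
    have := h1.continuousAt.tendsto
    rw [h2] at this
    exact this.mono_left nhdsWithin_le_nhds
  have hu : ∀ᶠ u in 𝓝[≠] (0 : ℂ), ContinuousAt (fun u => g (ψ u)) u := by
    filter_upwards [hψt.eventually hB.analytic_g,
      mem_nhdsWithin_of_mem_nhds h1.eventually_analyticAt] with u e1 e2
    exact ContinuousAt.comp (f := ψ) e1.continuousAt e2.continuousAt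
  have hE : ∀ᶠ E : ℝ in 𝓝[>] τ, ContinuousAt (fun z => g (ψ (edgeRoot k τ z))) E := by
    filter_upwards [((tendsto_edgeRoot hB.k_ne_zero τ).comp (tendsto_ofReal_nhdsGT' τ)).eventually
      hu, self_mem_nhdsWithin] with E e1 e2
    exact ContinuousAt.comp (f := edgeRoot k τ) e1
      (analyticAt_edgeRoot k (sub_mem_slitPlane_of_lt e2)).continuousAt
  obtain ⟨r, hr, hball⟩ := Metric.eventually_nhds_iff_ball.1 (eventually_nhdsWithin_iff.1 h6)
  obtain ⟨b, hb, hIoo⟩ := mem_nhdsGT_iff_exists_Ioo_subset.1 hE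
  have hb' : τ < b := hb
  refine ⟨min r (b - τ), lt_min hr (sub_pos.2 hb), ?_⟩
  have hmem : ∀ E ∈ Set.Ioo τ (τ + min r (b - τ)),
      ContinuousAt (fun z => g (ψ (edgeRoot k τ z))) (E : ℂ) := by
    intro E hE
    refine hIoo ⟨hE.1, hE.2.trans_le ?_⟩
    have := min_le_right r (b - τ)
    linarith
  refine hasDensityOn_of_tendsto hS.mapsTo hS.eq_integral ?_ ?_
  · intro E hE
    refine ContinuousAt.continuousWithinAt ?_
    exact (Complex.continuous_im.continuousAt.comp (ContinuousAt.comp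
      (f := fun x : ℝ => (x : ℂ)) (hmem E hE) Complex.continuous_ofReal.continuousAt)).div_const _
  · intro E hE
    have e1 : Tendsto (fun z => (g (ψ (edgeRoot k τ z))).im) (𝓝[upperHalf] (E : ℂ))
        (𝓝 (g (ψ (edgeRoot k τ E))).im) :=
      ((Complex.continuous_im.continuousAt.comp (hmem E hE)).tendsto).mono_left nhdsWithin_le_nhds
    rw [mul_div_cancel₀ _ Real.pi_ne_zero]
    refine e1.congr' ?_
    have hEb : (E : ℂ) ∈ Metric.ball (τ : ℂ) r := by
      rw [mem_ball_iff_norm, ← Complex.ofReal_sub, Complex.norm_real, Real.norm_eq_abs,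
        abs_of_pos (sub_pos.2 hE.1)]
      have := min_le_left r (b - τ)
      linarith [hE.2]
    filter_upwards [self_mem_nhdsWithin,
      mem_nhdsWithin_of_mem_nhds (Metric.isOpen_ball.mem_nhds hEb)] with z e2 e3
    rw [hball z e3 e2]

/-- Asymptotics of the expansion of `m` on the real line, to the right of the edge. -/
theorem tendsto_div_edgeRoot {ψ : ℂ → ℂ} {a : ℝ} (hψ0 : ψ 0 = 0) (hψ : HasDerivAt ψ a 0)
    {k : ℕ} (hk : k ≠ 0) (τ : ℝ) :
    Tendsto (fun E : ℝ => ψ (edgeRoot k τ E) / (((E - τ) ^ ((k : ℝ)⁻¹) : ℝ) : ℂ)) (𝓝[>] τ)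
      (𝓝 (a * Complex.exp (-(Real.pi / k : ℝ) * Complex.I))) := by
  have h1 : Tendsto (fun u => ψ u / u) (𝓝[≠] 0) (𝓝 (a : ℂ)) := by
    have := hψ.tendsto_slope_zero
    simp only [zero_add, hψ0, sub_zero, smul_eq_mul] at this
    refine this.congr fun u => ?_
    rw [div_eq_inv_mul]
  have h2 := (h1.comp ((tendsto_edgeRoot hk τ).comp (tendsto_ofReal_nhdsGT' τ))).mul_const
    (Complex.exp (-(Real.pi / k : ℝ) * Complex.I))
  refine h2.congr' ?_
  filter_upwards [self_mem_nhdsWithin] with E hE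
  have h3 := edgeRoot_of_lt k (show τ < E from hE)
  have h4 : (((E - τ) ^ ((k : ℝ)⁻¹) : ℝ) : ℂ) ≠ 0 := by
    have : 0 < (E - τ) ^ ((k : ℝ)⁻¹) := Real.rpow_pos_of_pos (sub_pos.2 hE) _
    exact_mod_cast this.ne'
  have h5 := edgeRoot_ne_zero k τ E
  simp only [Function.comp]
  rw [div_mul_eq_mul_div, div_eq_div_iff h5 h4, h3]
  ring

theorem HasDensityOn.mono {S T : Set ℝ} {f : ℝ → ℝ} (hf : HasDensityOn ρ T f)
    (hS : MeasurableSet S) (hST : S ⊆ T) : HasDensityOn ρ S f := by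
  refine ⟨hf.1, hf.2.1, ?_⟩
  have h := congrArg (fun μ : Measure ℝ => μ.restrict S) hf.2.2
  rwa [Measure.restrict_restrict_of_subset hST, restrict_withDensity hS,
    Measure.restrict_restrict_of_subset hST] at h

/-- A density asymptotic to `L (E - τ)^p` with `L > 0` gives the exponent `p`. -/
theorem hasLeftEdgeExponent_of_tendsto {τ p κ L : ℝ} {f : ℝ → ℝ} (hκ : 0 < κ)
    (hf : HasDensityOn ρ (Set.Ioo τ (τ + κ)) f) (hL : 0 < L)
    (h : Tendsto (fun E => f E / (E - τ) ^ p) (𝓝[>] τ) (𝓝 L)) :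
    HasLeftEdgeExponent ρ τ p := by
  have h1 : ∀ᶠ E in 𝓝[>] τ, f E / (E - τ) ^ p ∈ Set.Icc (L / 2) (2 * L) :=
    h.eventually (Icc_mem_nhds (by linarith) (by linarith))
  obtain ⟨b, hb, hIoo⟩ := mem_nhdsGT_iff_exists_Ioo_subset.1 h1
  have hb' : τ < b := hb
  refine ⟨min κ (b - τ), lt_min hκ (sub_pos.2 hb), f, ?_, L / 2, by linarith, 2 * L, by linarith, ?_⟩
  · refine hf.mono measurableSet_Ioo (Set.Ioo_subset_Ioo_right ?_)
    have := min_le_left κ (b - τ)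
    linarith
  · intro E hE
    have hEb : E ∈ Set.Ioo τ b := ⟨hE.1, hE.2.trans_le (by have := min_le_right κ (b - τ); linarith)⟩
    have h2 := hIoo hEb
    have h3 : 0 < (E - τ) ^ p := Real.rpow_pos_of_pos (sub_pos.2 hE.1) _
    exact ⟨(le_div_iff₀ h3).1 h2.1, (div_le_iff₀ h3).1 h2.2⟩

theorem isLeast_support_of_exponent {τ p : ℝ} (h0 : ρ (Set.Iio τ) = 0)
    (h : HasLeftEdgeExponent ρ τ p) : IsLeast ρ.support τ := by
  constructor
  · rw [Measure.mem_support_iff_forall]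
    intro U hU
    obtain ⟨κ, hκ, f, hf, c, hc, C, -, hcC⟩ := h
    obtain ⟨ε, hε, hball⟩ := Metric.mem_nhds_iff.1 hU
    set S := Set.Ioo τ (τ + min κ ε) with hS
    have hSκ : S ⊆ Set.Ioo τ (τ + κ) := Set.Ioo_subset_Ioo_right (by
      have := min_le_left κ ε; linarith)
    have hSU : S ⊆ U := by
      intro x hx
      apply hball
      rw [Metric.mem_ball, Real.dist_eq, abs_of_pos (sub_pos.2 hx.1)]
      have := min_le_right κ ε
      linarith [hx.2]
    refine lt_of_lt_of_le ?_ (measure_mono hSU)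
    have h1 := congrArg (fun μ : Measure ℝ => μ Set.univ) (hf.mono measurableSet_Ioo hSκ).2.2
    simp only [Measure.restrict_apply MeasurableSet.univ, Set.univ_inter,
      withDensity_apply _ MeasurableSet.univ, Measure.restrict_univ] at h1
    rw [h1, setLIntegral_pos_iff hf.1.ennreal_ofReal]
    have h2 : Function.support (fun x => ENNReal.ofReal (f x)) ∩ S = S := by
      refine Set.inter_eq_right.2 fun x hx => ?_
      have h3 := (hcC x (hSκ hx)).1
      have h4 : 0 < (x - τ) ^ p := Real.rpow_pos_of_pos (sub_pos.2 hx.1) _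
      have : 0 < f x := lt_of_lt_of_le (mul_pos hc h4) h3
      simpa using this
    rw [h2, hS, Real.volume_Ioo]
    simpa using ⟨hκ, hε⟩
  · intro x hx
    by_contra hlt
    rw [Measure.mem_support_iff_forall] at hx
    exact (hx _ (Iio_mem_nhds (not_le.1 hlt))).ne' h0

theorem sin_pi_div_pos {k : ℕ} (hk : 2 ≤ k) : 0 < Real.sin (Real.pi / k) := by
  have hk0 : (0 : ℝ) < k := by positivity
  have hk1 : (1 : ℝ) < k := by exact_mod_cast hk
  exact Real.sin_pos_of_pos_of_lt_pi (by positivity) (div_lt_self Real.pi_pos hk1)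

theorem tendsto_congr_indicator {f F : ℝ → ℝ} {τ κ L : ℝ} (hκ : 0 < κ)
    (h : Tendsto (fun E => f E / F E) (𝓝[>] τ) (𝓝 L)) :
    Tendsto (fun E => (Set.Ioo τ (τ + κ)).indicator f E / F E) (𝓝[>] τ) (𝓝 L) := by
  refine h.congr' ?_
  filter_upwards [Ioo_mem_nhdsGT (show τ < τ + κ by linarith)] with E hE
  rw [Set.indicator_of_mem hE]

/-- An edge at which `m` is infinite: the density diverges like `(E - τ)^(-1/k)`. -/
theorem IsEdgeBranch.exponent_of_inv [IsFiniteMeasure ρ] (hk : 2 ≤ k)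
    (hB : IsEdgeBranch Z (fun w => w⁻¹) h N I τ c k) (hS : IsStieltjesInverse ρ m Z) :
    HasLeftEdgeExponent ρ τ (-(k : ℝ)⁻¹) := by
  obtain ⟨ψ, a, -, hψ0, ha, hψ, -, κ, hκ, hd⟩ := hB.exists_density hS
  have h1 := (tendsto_div_edgeRoot hψ0 hψ hB.k_ne_zero τ).inv₀
    (mul_ne_zero (by exact_mod_cast ha.ne') (Complex.exp_ne_zero _))
  have h2 := ((Complex.continuous_im.tendsto _).comp h1).div_const Real.pi
  have h3 : ((a * Complex.exp (-(Real.pi / k : ℝ) * Complex.I))⁻¹).im / Real.pi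
      = a⁻¹ * Real.sin (Real.pi / k) / Real.pi := by
    rw [mul_inv, ← Complex.exp_neg, ← Complex.ofReal_inv, Complex.im_ofReal_mul, neg_mul, neg_neg,
      Complex.exp_ofReal_mul_I_im]
  rw [h3] at h2
  refine hasLeftEdgeExponent_of_tendsto hκ hd
    (div_pos (mul_pos (inv_pos.2 ha) (sin_pi_div_pos hk)) Real.pi_pos)
    (tendsto_congr_indicator hκ (h2.congr' ?_))
  filter_upwards [self_mem_nhdsWithin] with E hE
  have hE' : 0 ≤ E - τ := (sub_pos.2 (show τ < E from hE)).le
  simp only [Function.comp]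
  rw [inv_div, div_eq_mul_inv _ (ψ _), Complex.im_ofReal_mul, Real.rpow_neg hE', div_inv_eq_mul]
  ring

theorem hasDensityOn_symm_Ioo {τ κ : ℝ} {f : ℝ → ℝ} (h0 : ρ (Set.Iio τ) = 0) (h1 : ρ {τ} = 0)
    (hd : HasDensityOn ρ (Set.Ioo τ (τ + κ)) ((Set.Ioo τ (τ + κ)).indicator f)) :
    HasDensityOn ρ (Set.Ioo (τ - κ) (τ + κ)) ((Set.Ioo τ (τ + κ)).indicator f) := by
  refine ⟨hd.1, hd.2.1, ?_⟩
  have hIic : ρ (Set.Iic τ) = 0 := by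
    rw [← Set.Iio_union_right]
    exact measure_union_null h0 h1
  have hind : (fun x => ENNReal.ofReal ((Set.Ioo τ (τ + κ)).indicator f x))
      = (Set.Ioo τ (τ + κ)).indicator fun x => ENNReal.ofReal (f x) := by
    ext x
    by_cases hx : x ∈ Set.Ioo τ (τ + κ)
    · rw [Set.indicator_of_mem hx, Set.indicator_of_mem hx]
    · rw [Set.indicator_of_notMem hx, Set.indicator_of_notMem hx, ENNReal.ofReal_zero]
  rcases le_or_gt κ 0 with hκ | hκ
  · rw [Set.Ioo_eq_empty (by linarith)]
    simp
  have hsub : Set.Ioo τ (τ + κ) ⊆ Set.Ioo (τ - κ) (τ + κ) :=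
    Set.Ioo_subset_Ioo_left (by linarith)
  have hae : Set.Ioo (τ - κ) (τ + κ) =ᵐ[ρ] Set.Ioo τ (τ + κ) := by
    have hne : ∀ᵐ x ∂ρ, x ∉ Set.Iic τ := measure_eq_zero_iff_ae_notMem.1 hIic
    filter_upwards [hne] with x hx
    have hx' : τ < x := not_le.1 hx
    refine propext ⟨fun h => ⟨hx', h.2⟩, fun h => hsub h⟩
  rw [Measure.restrict_congr_set hae, hd.2.2, hind, withDensity_indicator measurableSet_Ioo,
    withDensity_indicator measurableSet_Ioo, Measure.restrict_restrict_of_subset le_rfl,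
    Measure.restrict_restrict_of_subset hsub]

/-- An edge at which `m` is finite is a regular one. -/
theorem IsEdgeBranch.regular_of_finite [IsFiniteMeasure ρ] {x₀ : ℂ} (hx₀ : x₀.im = 0)
    (hB : IsEdgeBranch Z (fun w => x₀ - w) h N I τ c 2) (hS : IsStieltjesInverse ρ m Z) :
    IsRegularEdge ρ τ ∧ HasLeftEdgeExponent ρ τ (1 / 2) := by
  obtain ⟨ψ, a, hψan, hψ0, ha, hψ, hm, κ, hκ, hd⟩ := hB.exists_density hS
  have h0 := hB.measure_Iio hS
  have h1 := tendsto_div_edgeRoot hψ0 hψ (two_ne_zero (α := ℕ)) τ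
  have h2 := (((Complex.continuous_im.tendsto _).comp h1).neg).div_const Real.pi
  have h3 : -(a * Complex.exp (-(Real.pi / (2 : ℕ) : ℝ) * Complex.I)).im / Real.pi
      = a / Real.pi := by
    rw [Complex.im_ofReal_mul, ← Complex.ofReal_neg, Complex.exp_ofReal_mul_I_im, Real.sin_neg]
    simp
  rw [h3] at h2
  have hpos : 0 < a / Real.pi := div_pos ha Real.pi_pos
  have hlim : Tendsto (fun E => (Set.Ioo τ (τ + κ)).indicator
      (fun E => (x₀ - ψ (edgeRoot 2 τ (E : ℝ))).im / Real.pi) E / (E - τ) ^ (1 / 2 : ℝ)) (𝓝[>] τ)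
      (𝓝 (a / Real.pi)) := by
    refine tendsto_congr_indicator hκ (h2.congr' ?_)
    filter_upwards [self_mem_nhdsWithin] with E hE
    simp only [Function.comp]
    rw [Complex.div_ofReal_im, Complex.sub_im, hx₀]
    norm_num
    ring
  have hexp := hasLeftEdgeExponent_of_tendsto hκ hd hpos hlim
  refine ⟨⟨κ, hκ, _, hasDensityOn_symm_Ioo h0 ?_ hd, a / Real.pi, hpos.ne', ?_⟩, hexp⟩
  · -- `m` stays bounded at the edge, so there is no atom
    have hle : 𝓝[upperHalf] (τ : ℂ) ≤ 𝓝[≠] (τ : ℂ) :=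
      nhdsWithin_mono _ fun z hz => ne_ofReal_of_mem_upperHalf hz
    have e1 : Tendsto (fun z => x₀ - ψ (edgeRoot 2 τ z)) (𝓝[upperHalf] (τ : ℂ)) (𝓝 (x₀ - ψ 0)) :=
      ((hψan.continuousAt.tendsto.mono_left nhdsWithin_le_nhds).comp
        ((tendsto_edgeRoot two_ne_zero τ).mono_left hle)).const_sub x₀
    have e2 : Tendsto m (𝓝[upperHalf] (τ : ℂ)) (𝓝 (x₀ - ψ 0)) :=
      e1.congr' (hm.mono fun z hz => hz.symm)
    exact measure_singleton_eq_zero hS.eq_integral ((Complex.continuous_im.tendsto _).comp e2)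
  · have hle : 𝓝[ρ.support \ {τ}] τ ≤ 𝓝[>] τ := by
      refine nhdsWithin_mono _ fun x hx => ?_
      have := (isLeast_support_of_exponent h0 hexp).2 hx.1
      exact lt_of_le_of_ne this (fun h => hx.2 h.symm)
    refine (hlim.mono_left hle).congr' ?_
    filter_upwards [hle self_mem_nhdsWithin] with E hE
    have hE' : τ < E := hE
    rw [Real.sqrt_eq_rpow, abs_sub_comm, abs_of_pos (sub_pos.2 hE')]

end

end QuadEdge

namespace QuadEdge

noncomputable section

/-! ### The rational function inverted by the Stieltjes transform -/

/-- For `s = 1`, the function `Z` with `Z (m z) = z` obtained from the Dyson equation of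
`(v^* X - ξ) (v^* X - ξ)^*` after diagonalising `Â`: the `αᵢ` are eigenvalues of `Â`. For `s = -1`
it is the reflected function `m ↦ -Z (-m)` (with `d` in place of `-d`), which belongs to the image
of the measure under `x ↦ -x`. -/
def zFn (s d q₁ α₁ q₂ α₂ : ℝ) (m : ℂ) : ℂ :=
  d - 1 / m + s / (1 + s * m)
    + s * (q₁ / (1 + 2 * s * α₁ * m) ^ 2 + q₂ / (1 + 2 * s * α₂ * m) ^ 2)

/-- The derivative of `zFn` on the real line. -/
def zDeriv (s q₁ α₁ q₂ α₂ x : ℝ) : ℝ :=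
  1 / x ^ 2 - s ^ 2 / (1 + s * x) ^ 2
    - 4 * s ^ 2 * (q₁ * α₁ / (1 + 2 * s * α₁ * x) ^ 3 + q₂ * α₂ / (1 + 2 * s * α₂ * x) ^ 3)

/-- The real points at which no denominator of `zFn` vanishes. -/
structure IsRegularPoint (s α₁ α₂ x : ℝ) : Prop where
  ne_zero : x ≠ 0
  ne₀ : 1 + s * x ≠ 0
  ne₁ : 1 + 2 * s * α₁ * x ≠ 0
  ne₂ : 1 + 2 * s * α₂ * x ≠ 0

section

variable {s d q₁ α₁ q₂ α₂ : ℝ}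

theorem IsRegularPoint.cast {x : ℝ} (h : IsRegularPoint s α₁ α₂ x) :
    (x : ℂ) ≠ 0 ∧ 1 + (s : ℂ) * x ≠ 0 ∧ 1 + 2 * (s : ℂ) * α₁ * x ≠ 0 ∧
      1 + 2 * (s : ℂ) * α₂ * x ≠ 0 := by
  refine ⟨?_, ?_, ?_, ?_⟩
  · exact_mod_cast h.ne_zero
  · exact_mod_cast h.ne₀
  · exact_mod_cast h.ne₁
  · exact_mod_cast h.ne₂

theorem analyticAt_zFn {x : ℝ} (h : IsRegularPoint s α₁ α₂ x) :
    AnalyticAt ℂ (zFn s d q₁ α₁ q₂ α₂) x := by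
  obtain ⟨h1, h2, h3, h4⟩ := h.cast
  unfold zFn
  fun_prop (disch := first | assumption | exact pow_ne_zero _ (by assumption))

theorem zFn_im {x : ℝ} : (zFn s d q₁ α₁ q₂ α₂ x).im = 0 := by
  have : zFn s d q₁ α₁ q₂ α₂ x = ((d - 1 / x + s / (1 + s * x)
    + s * (q₁ / (1 + 2 * s * α₁ * x) ^ 2 + q₂ / (1 + 2 * s * α₂ * x) ^ 2) : ℝ) : ℂ) := by
    unfold zFn
    push_cast
    ring
  rw [this, Complex.ofReal_im]

theorem hasDerivAt_div_sq {q t x : ℂ} (h : 1 + t * x ≠ 0) :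
    HasDerivAt (fun m : ℂ => q / (1 + t * m) ^ 2) (-(2 * q * t / (1 + t * x) ^ 3)) x := by
  have h1 : HasDerivAt (fun m : ℂ => 1 + t * m) t x := by
    simpa using ((hasDerivAt_id x).const_mul t).const_add 1
  have h2 := ((h1.pow 2).inv (pow_ne_zero 2 h)).const_mul q
  refine (h2.congr_deriv ?_).congr_of_eventuallyEq (Eventually.of_forall fun m => ?_)
  · simp only [Pi.pow_apply]
    push_cast
    field_simp
  · simp [div_eq_mul_inv]

theorem hasDerivAt_zFn {x : ℝ} (h : IsRegularPoint s α₁ α₂ x) :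
    HasDerivAt (zFn s d q₁ α₁ q₂ α₂) ((zDeriv s q₁ α₁ q₂ α₂ x : ℝ) : ℂ) (x : ℂ) := by
  obtain ⟨h1, h2, h3, h4⟩ := h.cast
  have e1 : HasDerivAt (fun m : ℂ => 1 / m) (-(1 / (x : ℂ) ^ 2)) (x : ℂ) := by
    simpa [one_div] using hasDerivAt_inv h1
  have e2 : HasDerivAt (fun m : ℂ => s / (1 + s * m)) (-(s ^ 2 / (1 + s * (x : ℂ)) ^ 2))
      (x : ℂ) := by
    have h5 : HasDerivAt (fun m : ℂ => 1 + (s : ℂ) * m) s (x : ℂ) := by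
      simpa using ((hasDerivAt_id (x : ℂ)).const_mul (s : ℂ)).const_add 1
    have h6 := (h5.inv h2).const_mul (s : ℂ)
    refine (h6.congr_deriv ?_).congr_of_eventuallyEq (Eventually.of_forall fun m => ?_)
    · ring
    · simp [div_eq_mul_inv]
  have e3 := (((e1.const_sub (d : ℂ)).add e2).add
    (((hasDerivAt_div_sq (q := q₁) h3).add (hasDerivAt_div_sq (q := q₂) h4)).const_mul (s : ℂ)))
  refine (e3.congr_deriv ?_).congr_of_eventuallyEq (Eventually.of_forall fun m => ?_)
  · unfold zDeriv
    push_cast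
    ring
  · simp [zFn]

theorem zFn_N_analytic :
    AnalyticAt ℂ (fun m : ℂ => -1 + m * (d + s / (1 + s * m)
      + s * (q₁ / (1 + 2 * s * α₁ * m) ^ 2 + q₂ / (1 + 2 * s * α₂ * m) ^ 2))) 0 := by
  have h0 : (1 : ℂ) + s * 0 ≠ 0 := by simp
  have h1 : (1 : ℂ) + 2 * s * α₁ * 0 ≠ 0 := by simp
  have h2 : (1 : ℂ) + 2 * s * α₂ * 0 ≠ 0 := by simp
  fun_prop (disch := first | assumption | exact pow_ne_zero _ (by assumption))

theorem zFn_eq_N_div : ∀ᶠ w : ℂ in 𝓝[≠] (0 : ℂ), zFn s d q₁ α₁ q₂ α₂ w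
    = (-1 + w * (d + s / (1 + s * w)
      + s * (q₁ / (1 + 2 * s * α₁ * w) ^ 2 + q₂ / (1 + 2 * s * α₂ * w) ^ 2))) / w := by
  filter_upwards [self_mem_nhdsWithin] with w hw
  have hw' : w ≠ 0 := hw
  unfold zFn
  rw [add_div, mul_div_cancel_left₀ _ hw']
  ring

/-! ### Edges at finite points -/

theorem taylor_inv {b y : ℂ} (hb : b ≠ 0) (hby : b - y ≠ 0) :
    1 / (b - y) = 1 / b + y / b ^ 2 + y ^ 2 * (1 / (b ^ 2 * (b - y))) := by
  field_simp
  ring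

theorem taylor_inv_sq {b y : ℂ} (hb : b ≠ 0) (hby : b - y ≠ 0) :
    1 / (b - y) ^ 2 = 1 / b ^ 2 + 2 * y / b ^ 3
      + y ^ 2 * ((3 * b - 2 * y) / (b ^ 3 * (b - y) ^ 2)) := by
  field_simp
  ring

/-- The quotient `(zFn x₀ - zFn (x₀ - w)) / w ^ 2` at a critical point `x₀`. -/
def critQuot (s q₁ α₁ q₂ α₂ x₀ : ℝ) (w : ℂ) : ℂ :=
  1 / (x₀ ^ 2 * (x₀ - w)) - s ^ 3 * (1 / ((1 + s * x₀) ^ 2 * (1 + s * x₀ - s * w)))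
    - s * (q₁ * (2 * s * α₁) ^ 2 * ((3 * (1 + 2 * s * α₁ * x₀) - 2 * (2 * s * α₁ * w)) /
          ((1 + 2 * s * α₁ * x₀) ^ 3 * (1 + 2 * s * α₁ * x₀ - 2 * s * α₁ * w) ^ 2))
      + q₂ * (2 * s * α₂) ^ 2 * ((3 * (1 + 2 * s * α₂ * x₀) - 2 * (2 * s * α₂ * w)) /
          ((1 + 2 * s * α₂ * x₀) ^ 3 * (1 + 2 * s * α₂ * x₀ - 2 * s * α₂ * w) ^ 2)))

/-- The value of `critQuot` at `0`, minus one half of the second derivative of `zFn`. -/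
def critConst (s q₁ α₁ q₂ α₂ x₀ : ℝ) : ℝ :=
  1 / x₀ ^ 3 - s ^ 3 / (1 + s * x₀) ^ 3 - 12 * s ^ 3 *
    (q₁ * α₁ ^ 2 / (1 + 2 * s * α₁ * x₀) ^ 4 + q₂ * α₂ ^ 2 / (1 + 2 * s * α₂ * x₀) ^ 4)

theorem critQuot_zero {x₀ : ℝ} (h : IsRegularPoint s α₁ α₂ x₀) :
    critQuot s q₁ α₁ q₂ α₂ x₀ 0 = critConst s q₁ α₁ q₂ α₂ x₀ := by
  obtain ⟨h1, h2, h3, h4⟩ := h.cast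
  have e : ∀ b q a : ℂ, b ≠ 0 → s * (q * (2 * s * a) ^ 2 * ((3 * b - 2 * (2 * s * a * 0)) /
      (b ^ 3 * (b - 2 * s * a * 0) ^ 2))) = 12 * s ^ 3 * (q * a ^ 2 / b ^ 4) := by
    intro b q a hb
    simp only [mul_zero, sub_zero]
    field_simp
    ring
  unfold critQuot critConst
  rw [mul_add, e _ _ _ h3, e _ _ _ h4]
  push_cast
  simp only [mul_zero, sub_zero]
  field_simp

theorem analyticAt_critQuot {x₀ : ℝ} (h : IsRegularPoint s α₁ α₂ x₀) :
    AnalyticAt ℂ (critQuot s q₁ α₁ q₂ α₂ x₀) 0 := by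
  obtain ⟨h1, h2, h3, h4⟩ := h.cast
  have e1 : (x₀ : ℂ) ^ 2 * (x₀ - 0) ≠ 0 := by simpa using h1
  have e2 : (1 + (s : ℂ) * x₀) ^ 2 * (1 + s * x₀ - s * 0) ≠ 0 := by simpa using h2
  have e3 : (1 + 2 * (s : ℂ) * α₁ * x₀) ^ 3 * (1 + 2 * s * α₁ * x₀ - 2 * s * α₁ * 0) ^ 2 ≠ 0 := by
    simpa using h3
  have e4 : (1 + 2 * (s : ℂ) * α₂ * x₀) ^ 3 * (1 + 2 * s * α₂ * x₀ - 2 * s * α₂ * 0) ^ 2 ≠ 0 := by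
    simpa using h4
  unfold critQuot
  fun_prop (disch := assumption)

theorem zFn_sub_eq {x₀ : ℝ} (h : IsRegularPoint s α₁ α₂ x₀)
    (hD : zDeriv s q₁ α₁ q₂ α₂ x₀ = 0) : ∀ᶠ w : ℂ in 𝓝[≠] (0 : ℂ),
    zFn s d q₁ α₁ q₂ α₂ (x₀ - w)
      = (zFn s d q₁ α₁ q₂ α₂ x₀).re - w ^ 2 * critQuot s q₁ α₁ q₂ α₂ x₀ w := by
  obtain ⟨h1, h2, h3, h4⟩ := h.cast
  have hre : (((zFn s d q₁ α₁ q₂ α₂ x₀).re : ℝ) : ℂ) = zFn s d q₁ α₁ q₂ α₂ x₀ := by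
    apply Complex.ext <;> simp [zFn_im]
  have hne : ∀ b t : ℂ, b ≠ 0 → ∀ᶠ w : ℂ in 𝓝[≠] (0 : ℂ), b - t * w ≠ 0 := by
    intro b t hb
    refine mem_nhdsWithin_of_mem_nhds ?_
    have : ContinuousAt (fun w : ℂ => b - t * w) 0 := by fun_prop
    exact this.eventually_ne (by simpa using hb)
  have hD' : 1 / (x₀ : ℂ) ^ 2 - s ^ 2 / (1 + s * x₀) ^ 2 - 4 * s ^ 2 *
      (q₁ * α₁ / (1 + 2 * s * α₁ * x₀) ^ 3 + q₂ * α₂ / (1 + 2 * s * α₂ * x₀) ^ 3) = 0 := by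
    have := congrArg (fun r : ℝ => (r : ℂ)) hD
    simp only [zDeriv] at this
    push_cast at this
    exact this
  filter_upwards [hne _ 1 h1, hne _ s h2, hne _ (2 * s * α₁) h3, hne _ (2 * s * α₂) h4]
    with w e1 e2 e3 e4
  rw [one_mul] at e1
  rw [hre]
  have t1 := taylor_inv h1 e1
  have t2 := taylor_inv h2 e2
  have t3 := taylor_inv_sq h3 e3
  have t4 := taylor_inv_sq h4 e4
  have r2 : 1 + (s : ℂ) * (x₀ - w) = 1 + s * x₀ - s * w := by ring
  have r3 : 1 + 2 * (s : ℂ) * α₁ * (x₀ - w) = 1 + 2 * s * α₁ * x₀ - 2 * s * α₁ * w := by ring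
  have r4 : 1 + 2 * (s : ℂ) * α₂ * (x₀ - w) = 1 + 2 * s * α₂ * x₀ - 2 * s * α₂ * w := by ring
  unfold zFn critQuot
  rw [r2, r3, r4, div_eq_mul_one_div (s : ℂ) (1 + s * x₀ - s * w),
    div_eq_mul_one_div (q₁ : ℂ) ((1 + 2 * s * α₁ * x₀ - 2 * s * α₁ * w) ^ 2),
    div_eq_mul_one_div (q₂ : ℂ) ((1 + 2 * s * α₂ * x₀ - 2 * s * α₂ * w) ^ 2), t1, t2, t3, t4]
  linear_combination (-w) * hD'

theorem continuousAt_zDeriv {x : ℝ} (h : IsRegularPoint s α₁ α₂ x) :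
    ContinuousAt (zDeriv s q₁ α₁ q₂ α₂) x := by
  obtain ⟨h1, h2, h3, h4⟩ := h
  unfold zDeriv
  fun_prop (disch := exact pow_ne_zero _ (by assumption))

theorem zDeriv_pos_near_zero : ∀ᶠ x : ℝ in 𝓝[>] 0, 0 < zDeriv s q₁ α₁ q₂ α₂ x := by
  have h0 : (1 + s * 0 : ℝ) ≠ 0 := by simp
  have h1 : (1 + 2 * s * α₁ * 0 : ℝ) ≠ 0 := by simp
  have h2 : (1 + 2 * s * α₂ * 0 : ℝ) ≠ 0 := by simp
  have hc : ContinuousAt (fun x : ℝ => 1 - x ^ 2 * (s ^ 2 / (1 + s * x) ^ 2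
    + 4 * s ^ 2 * (q₁ * α₁ / (1 + 2 * s * α₁ * x) ^ 3 + q₂ * α₂ / (1 + 2 * s * α₂ * x) ^ 3))) 0 := by
    fun_prop (disch := exact pow_ne_zero _ (by assumption))
  have h3 := hc.tendsto.eventually (lt_mem_nhds (show (0 : ℝ) < _ by simp))
  filter_upwards [mem_nhdsWithin_of_mem_nhds h3, self_mem_nhdsWithin] with x hx hx0
  have hx0' : (0 : ℝ) < x := hx0
  have hx' : (0 : ℝ) < 1 - x ^ 2 * (s ^ 2 / (1 + s * x) ^ 2
    + 4 * s ^ 2 * (q₁ * α₁ / (1 + 2 * s * α₁ * x) ^ 3 + q₂ * α₂ / (1 + 2 * s * α₂ * x) ^ 3)) := hx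
  have : zDeriv s q₁ α₁ q₂ α₂ x = (1 - x ^ 2 * (s ^ 2 / (1 + s * x) ^ 2
    + 4 * s ^ 2 * (q₁ * α₁ / (1 + 2 * s * α₁ * x) ^ 3
      + q₂ * α₂ / (1 + 2 * s * α₂ * x) ^ 3))) / x ^ 2 := by
    unfold zDeriv
    rw [sub_div, mul_div_cancel_left₀ _ (pow_ne_zero 2 hx0'.ne')]
    ring
  rw [this]
  positivity

theorem exists_first_zero {D : ℝ → ℝ} {X : ℝ} (hX : 0 < X) (hD : ContinuousOn D (Set.Ioc 0 X))
    (h0 : ∀ᶠ x in 𝓝[>] 0, 0 < D x) (hDX : D X ≤ 0) :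
    ∃ x₀ ∈ Set.Ioc 0 X, D x₀ = 0 ∧ ∀ x ∈ Set.Ioo 0 x₀, 0 < D x := by
  obtain ⟨b, hb, hIoo⟩ := mem_nhdsGT_iff_exists_Ioo_subset.1 h0
  have hb0 : 0 < b := hb
  have hbX : b ≤ X := by
    by_contra hlt
    exact absurd (show 0 < D X from hIoo ⟨hX, not_le.1 hlt⟩) (not_lt.2 hDX)
  have hsub : Set.Icc b X ⊆ Set.Ioc 0 X := fun x hx => ⟨hb0.trans_le hx.1, hx.2⟩
  have hK : IsCompact (Set.Icc b X ∩ D ⁻¹' Set.Iic 0) :=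
    isCompact_Icc.of_isClosed_subset
      ((hD.mono hsub).preimage_isClosed_of_isClosed isClosed_Icc isClosed_Iic)
      Set.inter_subset_left
  obtain ⟨x₀, hx₀, hmin⟩ := hK.exists_isLeast ⟨X, ⟨hbX, le_rfl⟩, hDX⟩
  have hx₀I : x₀ ∈ Set.Ioc 0 X := hsub hx₀.1
  have hpos : ∀ x ∈ Set.Ioo 0 x₀, 0 < D x := by
    intro x hx
    by_contra hle
    rcases lt_or_ge x b with h | h
    · exact hle (hIoo ⟨hx.1, h⟩)
    · have := hmin ⟨⟨h, hx.2.le.trans hx₀I.2⟩, not_lt.1 hle⟩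
      exact absurd hx.2 (not_lt.2 this)
  refine ⟨x₀, hx₀I, le_antisymm hx₀.2 ?_, hpos⟩
  have hlim : Tendsto D (𝓝[Set.Ioo 0 x₀] x₀) (𝓝 (D x₀)) :=
    (hD x₀ hx₀I).mono fun x hx => ⟨hx.1, hx.2.le.trans hx₀I.2⟩
  have : (𝓝[Set.Ioo 0 x₀] x₀).NeBot := by
    rw [← mem_closure_iff_nhdsWithin_neBot, closure_Ioo hx₀I.1.ne]
    exact ⟨hx₀I.1.le, le_rfl⟩
  exact ge_of_tendsto hlim (by filter_upwards [self_mem_nhdsWithin] with x hx using (hpos x hx).le)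

theorem pos_of_pos_right {t x x₀ : ℝ} (h : 0 < 1 + t * x₀) (hx : 0 < x) (hxx : x ≤ x₀) :
    0 < 1 + t * x := by
  rcases le_or_gt 0 t with ht | ht
  · positivity
  · nlinarith

/-- The first critical point `x₀` of `zFn` to the right of `0` is a finite edge if the second
derivative is negative there. -/
theorem isEdgeBranch_of_critical {x₀ : ℝ} (hx₀ : 0 < x₀) (h₀ : 0 < 1 + s * x₀)
    (h₁ : 0 < 1 + 2 * s * α₁ * x₀) (h₂ : 0 < 1 + 2 * s * α₂ * x₀)
    (hD : zDeriv s q₁ α₁ q₂ α₂ x₀ = 0)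
    (hpos : ∀ x ∈ Set.Ioo 0 x₀, 0 < zDeriv s q₁ α₁ q₂ α₂ x)
    (hc : 0 < critConst s q₁ α₁ q₂ α₂ x₀) :
    IsEdgeBranch (zFn s d q₁ α₁ q₂ α₂) (fun w : ℂ => x₀ - w) (critQuot s q₁ α₁ q₂ α₂ x₀)
      (fun m : ℂ => -1 + m * (d + s / (1 + s * m)
        + s * (q₁ / (1 + 2 * s * α₁ * m) ^ 2 + q₂ / (1 + 2 * s * α₂ * m) ^ 2)))
      (Set.Ioo 0 x₀) (zFn s d q₁ α₁ q₂ α₂ x₀).re (critConst s q₁ α₁ q₂ α₂ x₀) 2 := by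
  have hreg : ∀ x, 0 < x → x ≤ x₀ → IsRegularPoint s α₁ α₂ x := fun x hx hxx =>
    ⟨hx.ne', (pos_of_pos_right h₀ hx hxx).ne', (pos_of_pos_right h₁ hx hxx).ne',
      (pos_of_pos_right h₂ hx hxx).ne'⟩
  refine
    { isOpen := isOpen_Ioo
      isPreconnected := isPreconnected_Ioo
      near_zero := Ioo_mem_nhdsGT hx₀
      analytic := fun x hx => analyticAt_zFn (hreg x hx.1 hx.2.le)
      deriv_ne_zero := fun x hx => ?_
      real := fun x _ => zFn_im
      analytic_N := zFn_N_analytic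
      N_zero := by simp
      eq_N_div := zFn_eq_N_div
      k_ne_zero := two_ne_zero
      analytic_h := analyticAt_critQuot (hreg x₀ hx₀ le_rfl)
      h_zero := critQuot_zero (hreg x₀ hx₀ le_rfl)
      c_pos := hc
      analytic_g := Eventually.of_forall fun w => analyticAt_const.sub analyticAt_id
      comp_eq := zFn_sub_eq (hreg x₀ hx₀ le_rfl) hD
      mem := ?_ }
  · rw [(hasDerivAt_zFn (hreg x hx.1 hx.2.le)).deriv]
    exact_mod_cast (hpos x hx).ne'
  · filter_upwards [Ioo_mem_nhdsGT hx₀] with t ht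
    exact ⟨x₀ - t, ⟨by linarith [ht.2], by linarith [ht.1]⟩, by push_cast; rfl⟩

/-! ### The edge at infinity -/

/-- `Σ qᵢ / (4 αᵢ²)`: the leading coefficient of `Z - d` at infinity is this number minus `1`, so
`1` is its critical value. -/
def edgeParam (q₁ α₁ q₂ α₂ : ℝ) : ℝ := q₁ / (4 * α₁ ^ 2) + q₂ / (4 * α₂ ^ 2)

theorem div_one_add_le {α x : ℝ} (h0 : 0 < α) (h1 : α ≤ 1) (hx : 0 < x) :
    α / (1 + 2 * 1 * α * x) ≤ 1 / (1 + 2 * x) := by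
  rw [div_le_div_iff₀ (by positivity) (by positivity)]
  nlinarith

theorem zDeriv_pos (hα₁ : 0 < α₁) (hα₁' : α₁ ≤ 1) (hα₂ : 0 < α₂) (hα₂' : α₂ ≤ 1) (hq₁ : 0 ≤ q₁)
    (hq₂ : 0 ≤ q₂) (hS : edgeParam q₁ α₁ q₂ α₂ ≤ 1) {x : ℝ} (hx : 0 < x) :
    0 < zDeriv 1 q₁ α₁ q₂ α₂ x := by
  have key : ∀ q α : ℝ, 0 < α → α ≤ 1 → 0 ≤ q →
      4 * (q * α / (1 + 2 * 1 * α * x) ^ 3) ≤ q / (4 * α ^ 2) * (16 / (1 + 2 * x) ^ 3) := by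
    intro q α h0 h1 hq
    have h2 : (α / (1 + 2 * 1 * α * x)) ^ 3 ≤ (1 / (1 + 2 * x)) ^ 3 :=
      pow_le_pow_left₀ (by positivity) (div_one_add_le h0 h1 hx) 3
    have h3 : 4 * (q * α / (1 + 2 * 1 * α * x) ^ 3)
        = q / (4 * α ^ 2) * 16 * (α / (1 + 2 * 1 * α * x)) ^ 3 := by
      field_simp
      ring
    rw [h3, mul_assoc]
    refine mul_le_mul_of_nonneg_left ?_ (by positivity)
    rw [div_pow, div_pow, one_pow] at h2
    calc 16 * (α / (1 + 2 * 1 * α * x)) ^ 3 ≤ 16 * (1 / (1 + 2 * x) ^ 3) := by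
          rw [div_pow]; linarith
      _ = 16 / (1 + 2 * x) ^ 3 := by ring
  have k1 := key q₁ α₁ hα₁ hα₁' hq₁
  have k2 := key q₂ α₂ hα₂ hα₂' hq₂
  have k3 : edgeParam q₁ α₁ q₂ α₂ * (16 / (1 + 2 * x) ^ 3) ≤ 16 / (1 + 2 * x) ^ 3 :=
    mul_le_of_le_one_left (by positivity) hS
  have k4 : 16 / (1 + 2 * x) ^ 3 < 1 / x ^ 2 - 1 ^ 2 / (1 + 1 * x) ^ 2 := by
    have e : 1 / x ^ 2 - 1 ^ 2 / (1 + 1 * x) ^ 2 = (1 + 2 * x) / (x ^ 2 * (1 + x) ^ 2) := by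
      field_simp
      ring
    rw [e, div_lt_div_iff₀ (by positivity) (by positivity)]
    nlinarith [sq_nonneg (x * (1 + x)), mul_pos hx (show 0 < 1 + x by linarith)]
  unfold edgeParam at k3
  unfold zDeriv
  nlinarith

/-- The part of an `IsEdgeBranch` at infinity that does not depend on the order of the edge. -/
theorem isEdgeBranch_inv {h : ℂ → ℂ} {c : ℝ} {k : ℕ} (hα₁ : 0 < α₁) (hα₁' : α₁ ≤ 1)
    (hα₂ : 0 < α₂) (hα₂' : α₂ ≤ 1) (hq₁ : 0 ≤ q₁) (hq₂ : 0 ≤ q₂)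
    (hS : edgeParam q₁ α₁ q₂ α₂ ≤ 1) (hk : k ≠ 0) (hh : AnalyticAt ℂ h 0) (hh0 : h 0 = c)
    (hc : 0 < c)
    (hZ : ∀ᶠ w : ℂ in 𝓝[≠] (0 : ℂ), zFn 1 d q₁ α₁ q₂ α₂ w⁻¹ = d - w ^ k * h w) :
    IsEdgeBranch (zFn 1 d q₁ α₁ q₂ α₂) (fun w : ℂ => w⁻¹) h
      (fun m : ℂ => -1 + m * (d + (1 : ℝ) / (1 + (1 : ℝ) * m)
        + (1 : ℝ) * (q₁ / (1 + 2 * (1 : ℝ) * α₁ * m) ^ 2 + q₂ / (1 + 2 * (1 : ℝ) * α₂ * m) ^ 2)))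
      (Set.Ioi 0) d c k := by
  have hreg : ∀ x : ℝ, 0 < x → IsRegularPoint 1 α₁ α₂ x := fun x hx =>
    ⟨hx.ne', by positivity, by positivity, by positivity⟩
  refine
    { isOpen := isOpen_Ioi
      isPreconnected := isPreconnected_Ioi
      near_zero := self_mem_nhdsWithin
      analytic := fun x hx => analyticAt_zFn (hreg x hx)
      deriv_ne_zero := fun x hx => ?_
      real := fun x _ => zFn_im
      analytic_N := zFn_N_analytic
      N_zero := by simp
      eq_N_div := zFn_eq_N_div
      k_ne_zero := hk
      analytic_h := hh
      h_zero := hh0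
      c_pos := hc
      analytic_g := ?_
      comp_eq := hZ
      mem := ?_ }
  · rw [(hasDerivAt_zFn (hreg x hx)).deriv]
    exact_mod_cast (zDeriv_pos hα₁ hα₁' hα₂ hα₂' hq₁ hq₂ hS hx).ne'
  · filter_upwards [self_mem_nhdsWithin] with w hw using analyticAt_inv hw
  · filter_upwards [self_mem_nhdsWithin] with t ht
    exact ⟨t⁻¹, Set.mem_Ioi.2 (inv_pos.2 ht), by push_cast; rfl⟩

theorem eventually_add_ne {b : ℝ} (hb : b ≠ 0) : ∀ᶠ w : ℂ in 𝓝[≠] (0 : ℂ), w + b ≠ 0 := by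
  refine mem_nhdsWithin_of_mem_nhds ?_
  have : ContinuousAt (fun w : ℂ => w + b) 0 := by fun_prop
  exact this.eventually_ne (by simpa using hb)

theorem zFn_inv (hα₁ : 0 < α₁) (hα₂ : 0 < α₂) : ∀ᶠ w : ℂ in 𝓝[≠] (0 : ℂ),
    w ≠ 0 ∧ w + 1 ≠ 0 ∧ w + 2 * α₁ ≠ 0 ∧ w + 2 * α₂ ≠ 0 ∧
    zFn 1 d q₁ α₁ q₂ α₂ w⁻¹ = d - w ^ 2 * (1 / (w + 1)
      - (q₁ / (w + 2 * α₁) ^ 2 + q₂ / (w + 2 * α₂) ^ 2)) := by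
  filter_upwards [self_mem_nhdsWithin, eventually_add_ne one_ne_zero,
    eventually_add_ne (show 2 * α₁ ≠ 0 by positivity),
    eventually_add_ne (show 2 * α₂ ≠ 0 by positivity)] with w h0 h1 h2 h3
  have h0' : w ≠ 0 := h0
  push_cast at h1 h2 h3
  refine ⟨h0', h1, h2, h3, ?_⟩
  have e : ∀ q a : ℂ, w + 2 * a ≠ 0 →
      q / (1 + 2 * ((1 : ℝ) : ℂ) * a * w⁻¹) ^ 2 = w ^ 2 * (q / (w + 2 * a) ^ 2) := by
    intro q a ha
    have h4 : 1 + 2 * ((1 : ℝ) : ℂ) * a * w⁻¹ = (w + 2 * a) / w := by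
      push_cast
      field_simp
    rw [h4]
    field_simp
  have e0 : ((1 : ℝ) : ℂ) / (1 + ((1 : ℝ) : ℂ) * w⁻¹) = w / (w + 1) := by
    have h4 : 1 + ((1 : ℝ) : ℂ) * w⁻¹ = (w + 1) / w := by
      push_cast
      field_simp
    rw [h4]
    push_cast
    field_simp
  unfold zFn
  rw [e _ _ h2, e _ _ h3, e0]
  push_cast
  field_simp
  ring

theorem exists_isEdgeBranch_inv_two (hα₁ : 0 < α₁) (hα₁' : α₁ ≤ 1) (hα₂ : 0 < α₂) (hα₂' : α₂ ≤ 1)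
    (hq₁ : 0 ≤ q₁) (hq₂ : 0 ≤ q₂) (hS : edgeParam q₁ α₁ q₂ α₂ < 1) :
    ∃ h N I c, IsEdgeBranch (zFn 1 d q₁ α₁ q₂ α₂) (fun w : ℂ => w⁻¹) h N I d c 2 := by
  refine ⟨fun w : ℂ => 1 / (w + 1) - (q₁ / (w + 2 * α₁) ^ 2 + q₂ / (w + 2 * α₂) ^ 2), _, _,
    1 - edgeParam q₁ α₁ q₂ α₂,
    isEdgeBranch_inv hα₁ hα₁' hα₂ hα₂' hq₁ hq₂ hS.le two_ne_zero ?_ ?_ (by linarith) ?_⟩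
  · have h0 : (0 : ℂ) + 1 ≠ 0 := by simp
    have h1 : (0 : ℂ) + 2 * α₁ ≠ 0 := by simpa using hα₁.ne'
    have h2 : (0 : ℂ) + 2 * α₂ ≠ 0 := by simpa using hα₂.ne'
    fun_prop (disch := first | assumption | exact pow_ne_zero _ (by assumption))
  · unfold edgeParam
    push_cast
    ring
  · exact (zFn_inv hα₁ hα₂).mono fun w h => h.2.2.2.2

theorem exists_isEdgeBranch_inv_three (hα₁ : 0 < α₁) (hα₁' : α₁ < 1) (hα₂ : 0 < α₂)
    (hα₂' : α₂ < 1) (hq₁ : 0 ≤ q₁) (hq₂ : 0 ≤ q₂) (hS : edgeParam q₁ α₁ q₂ α₂ = 1) :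
    ∃ h N I c, IsEdgeBranch (zFn 1 d q₁ α₁ q₂ α₂) (fun w : ℂ => w⁻¹) h N I d c 3 := by
  refine ⟨fun w : ℂ => -(1 / (w + 1)) + (q₁ / (4 * α₁ ^ 2) * ((w + 4 * α₁) / (w + 2 * α₁) ^ 2)
      + q₂ / (4 * α₂ ^ 2) * ((w + 4 * α₂) / (w + 2 * α₂) ^ 2)), _, _,
    -1 + (q₁ / (4 * α₁ ^ 2) * (1 / α₁) + q₂ / (4 * α₂ ^ 2) * (1 / α₂)),
    isEdgeBranch_inv hα₁ hα₁'.le hα₂ hα₂'.le hq₁ hq₂ hS.le three_ne_zero ?_ ?_ ?_ ?_⟩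
  · have h0 : (0 : ℂ) + 1 ≠ 0 := by simp
    have h1 : (0 : ℂ) + 2 * α₁ ≠ 0 := by simpa using hα₁.ne'
    have h2 : (0 : ℂ) + 2 * α₂ ≠ 0 := by simpa using hα₂.ne'
    fun_prop (disch := first | assumption | exact pow_ne_zero _ (by assumption))
  · have h1 : (α₁ : ℂ) ≠ 0 := by exact_mod_cast hα₁.ne'
    have h2 : (α₂ : ℂ) ≠ 0 := by exact_mod_cast hα₂.ne'
    push_cast
    simp only [zero_add]
    have e : ∀ a : ℂ, a ≠ 0 → 4 * a / (2 * a) ^ 2 = 1 / a := by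
      intro a ha
      field_simp
      norm_num
    rw [e _ h1, e _ h2]
    norm_num
  · -- at least one of the two nonnegative weights is positive, and both factors exceed `1`
    unfold edgeParam at hS
    have e1 : 1 < 1 / α₁ := by rwa [lt_div_iff₀ hα₁, one_mul]
    have e2 : 1 < 1 / α₂ := by rwa [lt_div_iff₀ hα₂, one_mul]
    have p1 : 0 ≤ q₁ / (4 * α₁ ^ 2) := by positivity
    have p2 : 0 ≤ q₂ / (4 * α₂ ^ 2) := by positivity
    rcases p1.eq_or_lt with h | h
    · rw [← h] at hS ⊢
      nlinarith
    · nlinarith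
  · filter_upwards [zFn_inv (d := d) (q₁ := q₁) (q₂ := q₂) hα₁ hα₂] with w ⟨h0, h1, h2, h3, h4⟩
    have a1 : (α₁ : ℂ) ≠ 0 := by exact_mod_cast hα₁.ne'
    have a2 : (α₂ : ℂ) ≠ 0 := by exact_mod_cast hα₂.ne'
    have hS' : (q₁ : ℂ) / (4 * α₁ ^ 2) + q₂ / (4 * α₂ ^ 2) = 1 := by
      have := congrArg (fun r : ℝ => (r : ℂ)) hS
      simp only [edgeParam] at this
      push_cast at this
      exact this
    have e : ∀ q a : ℂ, a ≠ 0 → w + 2 * a ≠ 0 → q / (w + 2 * a) ^ 2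
        = q / (4 * a ^ 2) - w * (q / (4 * a ^ 2) * ((w + 4 * a) / (w + 2 * a) ^ 2)) := by
      intro q a ha hwa
      field_simp
      ring
    have e0 : 1 / (w + 1) = 1 - w * (1 / (w + 1)) := by
      field_simp
      ring
    rw [h4, e _ _ a1 h2, e _ _ a2 h3]
    linear_combination (-w ^ 2) * e0 + w ^ 2 * hS'

theorem exists_isEdgeBranch_inv_four (hα₂ : 0 < α₂) (hα₂' : α₂ ≤ 1) :
    ∃ h N I c, IsEdgeBranch (zFn 1 d 4 1 0 α₂) (fun w : ℂ => w⁻¹) h N I d c 4 := by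
  refine ⟨fun w : ℂ => 1 / ((w + 1) * (w + 2) ^ 2), _, _, 1 / 4,
    isEdgeBranch_inv one_pos le_rfl hα₂ hα₂' (by norm_num) le_rfl ?_ four_ne_zero ?_ ?_
      (by norm_num) ?_⟩
  · norm_num [edgeParam]
  · have h0 : ((0 : ℂ) + 1) * (0 + 2) ^ 2 ≠ 0 := by norm_num
    fun_prop (disch := assumption)
  · norm_num
  · filter_upwards [zFn_inv (d := d) (q₁ := 4) (q₂ := 0) one_pos hα₂] with w ⟨h0, h1, h2, h3, h4⟩
    rw [h4]
    push_cast at h2 ⊢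
    rw [mul_one] at h2 ⊢
    field_simp
    ring

end

end

end QuadEdge

namespace QuadEdge

noncomputable section

section

variable {s d q₁ α₁ q₂ α₂ : ℝ}

/-! ### Existence of finite edges -/

/-- For `s = 1` the second derivative is negative at every critical point. -/
theorem critConst_pos (hα₁ : 0 < α₁) (hα₁' : α₁ ≤ 1) (hα₂ : 0 < α₂) (hα₂' : α₂ ≤ 1)
    (hq₁ : 0 ≤ q₁) (hq₂ : 0 ≤ q₂) {x : ℝ} (hx : 0 < x) (hD : zDeriv 1 q₁ α₁ q₂ α₂ x = 0) :
    0 < critConst 1 q₁ α₁ q₂ α₂ x := by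
  have key : ∀ q α : ℝ, 0 < α → α ≤ 1 → 0 ≤ q → q * α ^ 2 / (1 + 2 * 1 * α * x) ^ 4
      ≤ q * α / (1 + 2 * 1 * α * x) ^ 3 * (1 / (1 + 2 * x)) := by
    intro q α h0 h1 hq
    have h3 : q * α ^ 2 / (1 + 2 * 1 * α * x) ^ 4
        = q * α / (1 + 2 * 1 * α * x) ^ 3 * (α / (1 + 2 * 1 * α * x)) := by
      field_simp
    rw [h3]
    exact mul_le_mul_of_nonneg_left (div_one_add_le h0 h1 hx) (by positivity)
  have k1 := key q₁ α₁ hα₁ hα₁' hq₁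
  have k2 := key q₂ α₂ hα₂ hα₂' hq₂
  unfold zDeriv at hD
  have e1 : q₁ * α₁ / (1 + 2 * 1 * α₁ * x) ^ 3 + q₂ * α₂ / (1 + 2 * 1 * α₂ * x) ^ 3
      = (1 / x ^ 2 - 1 / (1 + x) ^ 2) / 4 := by
    rw [one_mul, one_pow] at hD
    linarith
  have e2 : q₁ * α₁ ^ 2 / (1 + 2 * 1 * α₁ * x) ^ 4 + q₂ * α₂ ^ 2 / (1 + 2 * 1 * α₂ * x) ^ 4
      ≤ (1 / x ^ 2 - 1 / (1 + x) ^ 2) / 4 * (1 / (1 + 2 * x)) := by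
    rw [← e1, add_mul]
    exact add_le_add k1 k2
  have e3 : 1 / x ^ 3 - 1 / (1 + x) ^ 3
      - 12 * ((1 / x ^ 2 - 1 / (1 + x) ^ 2) / 4 * (1 / (1 + 2 * x))) = 1 / (x ^ 3 * (1 + x) ^ 3) := by
    field_simp
    ring
  have e4 : 0 < 1 / (x ^ 3 * (1 + x) ^ 3) := by positivity
  unfold critConst
  rw [one_mul, one_pow]
  linarith

theorem exists_zDeriv_nonpos (hα₁ : 0 < α₁) (hα₂ : 0 < α₂) (hS : 1 < edgeParam q₁ α₁ q₂ α₂) :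
    ∃ X > 0, zDeriv 1 q₁ α₁ q₂ α₂ X ≤ 0 := by
  have h0 : (1 + 0 : ℝ) ≠ 0 := by simp
  have h1 : (0 + 2 * α₁ : ℝ) ≠ 0 := by simpa using hα₁.ne'
  have h2 : (0 + 2 * α₂ : ℝ) ≠ 0 := by simpa using hα₂.ne'
  have hc : ContinuousAt (fun w : ℝ => (2 + w) / (1 + w) ^ 2
      - 4 * (q₁ * α₁ / (w + 2 * α₁) ^ 3 + q₂ * α₂ / (w + 2 * α₂) ^ 3)) 0 := by
    fun_prop (disch := exact pow_ne_zero _ (by assumption))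
  have e : ∀ q α : ℝ, 0 < α → 4 * (q * α / (0 + 2 * α) ^ 3) = 2 * (q / (4 * α ^ 2)) := by
    intro q α h
    field_simp
    ring
  have hneg : (2 + 0 : ℝ) / (1 + 0) ^ 2
      - 4 * (q₁ * α₁ / (0 + 2 * α₁) ^ 3 + q₂ * α₂ / (0 + 2 * α₂) ^ 3) < 0 := by
    rw [mul_add, e _ _ hα₁, e _ _ hα₂]
    unfold edgeParam at hS
    norm_num
    linarith
  obtain ⟨w, hw, hw0⟩ := (((hc.tendsto.eventually (gt_mem_nhds hneg)).filter_mono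
    (nhdsWithin_le_nhds (s := Set.Ioi 0))).and self_mem_nhdsWithin).exists
  have hw0' : (0 : ℝ) < w := hw0
  refine ⟨w⁻¹, inv_pos.2 hw0', ?_⟩
  have e1 : ∀ q α : ℝ, 0 < α → q * α / (1 + 2 * 1 * α * w⁻¹) ^ 3
      = w ^ 3 * (q * α / (w + 2 * α) ^ 3) := by
    intro q α h
    have : 1 + 2 * 1 * α * w⁻¹ = (w + 2 * α) / w := by
      field_simp
    rw [this]
    field_simp
  have e2 : 1 / w⁻¹ ^ 2 - 1 ^ 2 / (1 + 1 * w⁻¹) ^ 2 = w ^ 3 * ((2 + w) / (1 + w) ^ 2) := by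
    have : 1 + 1 * w⁻¹ = (1 + w) / w := by
      field_simp
      ring
    rw [this]
    field_simp
    ring
  unfold zDeriv
  rw [e1 _ _ hα₁, e1 _ _ hα₂, e2]
  have hw' : (2 + w) / (1 + w) ^ 2
      - 4 * (q₁ * α₁ / (w + 2 * α₁) ^ 3 + q₂ * α₂ / (w + 2 * α₂) ^ 3) < 0 := hw
  have := mul_neg_of_pos_of_neg (pow_pos hw0' 3) hw'
  nlinarith

theorem exists_isEdgeBranch_left (hα₁ : 0 < α₁) (hα₁' : α₁ ≤ 1) (hα₂ : 0 < α₂) (hα₂' : α₂ ≤ 1)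
    (hq₁ : 0 ≤ q₁) (hq₂ : 0 ≤ q₂) (hS : 1 < edgeParam q₁ α₁ q₂ α₂) :
    ∃ (x₀ : ℝ) (h N : ℂ → ℂ) (I : Set ℝ) (τ c : ℝ),
      IsEdgeBranch (zFn 1 d q₁ α₁ q₂ α₂) (fun w : ℂ => x₀ - w) h N I τ c 2 := by
  obtain ⟨X, hX, hDX⟩ := exists_zDeriv_nonpos hα₁ hα₂ hS
  have hreg : ∀ x : ℝ, 0 < x → IsRegularPoint 1 α₁ α₂ x := fun x hx =>
    ⟨hx.ne', by positivity, by positivity, by positivity⟩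
  obtain ⟨x₀, hx₀, hD, hpos⟩ := exists_first_zero hX
    (fun x hx => (continuousAt_zDeriv (hreg x hx.1)).continuousWithinAt) zDeriv_pos_near_zero hDX
  have h0 : 0 < x₀ := hx₀.1
  exact ⟨x₀, _, _, _, _, _, isEdgeBranch_of_critical h0 (by positivity) (by positivity)
    (by positivity) hD hpos (critConst_pos hα₁ hα₁' hα₂ hα₂' hq₁ hq₂ h0 hD)⟩

/-- For `s = -1` there is always a finite edge in `(0, 1 / 2]`: the part of `Z` without the weights
`qᵢ` has its critical point at `1 / 2`, and the other terms are decreasing and concave. If `α₁ = 1`,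
the pole at `1 / 2` moves the critical point to the left of it. -/
theorem exists_isEdgeBranch_right (hα₁ : 0 < α₁) (hα₂ : 0 < α₂)
    (hα₂' : α₂ < 1) (hq₁ : 0 ≤ q₁) (hq₂ : 0 ≤ q₂) (hα₁' : α₁ < 1 ∨ (α₁ = 1 ∧ 0 < q₁ ∧ q₂ = 0)) :
    ∃ (x₀ : ℝ) (h N : ℂ → ℂ) (I : Set ℝ) (τ c : ℝ),
      IsEdgeBranch (zFn (-1) d q₁ α₁ q₂ α₂) (fun w : ℂ => x₀ - w) h N I τ c 2 := by
  have hX : ∃ X : ℝ, 0 < X ∧ X ≤ 1 / 2 ∧ 0 < 1 + 2 * (-1) * α₁ * X ∧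
      0 < 1 + 2 * (-1) * α₂ * X ∧ zDeriv (-1) q₁ α₁ q₂ α₂ X ≤ 0 := by
    rcases hα₁' with h | ⟨rfl, hq, rfl⟩
    · have p1 : 0 < 1 + 2 * (-1) * α₁ * (1 / 2) := by linarith
      have p2 : 0 < 1 + 2 * (-1) * α₂ * (1 / 2) := by linarith
      refine ⟨1 / 2, by norm_num, le_rfl, p1, p2, ?_⟩
      unfold zDeriv
      have : 0 ≤ 4 * (-1 : ℝ) ^ 2 * (q₁ * α₁ / (1 + 2 * (-1) * α₁ * (1 / 2)) ^ 3
        + q₂ * α₂ / (1 + 2 * (-1) * α₂ * (1 / 2)) ^ 3) := by positivity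
      norm_num at this ⊢
      exact this
    · -- with `1 - 2 X = ε`, the pole dominates: `1 / X² ≤ 16 ≤ 4 q₁ / ε³`
      set ε := min (1 / 2) (q₁ / 4) with hε
      have h1 : 0 < ε := lt_min (by norm_num) (by positivity)
      have h2 : ε ≤ 1 / 2 := min_le_left _ _
      have h3 : ε ≤ q₁ / 4 := min_le_right _ _
      refine ⟨1 / 2 - ε / 2, by linarith, by linarith, by linarith, ?_, ?_⟩
      · nlinarith
      · have e1 : 1 + 2 * (-1) * 1 * (1 / 2 - ε / 2) = ε := by ring
        have e2 : 1 / (1 / 2 - ε / 2) ^ 2 ≤ 16 := by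
          rw [div_le_iff₀ (by nlinarith)]
          nlinarith
        have e3 : 16 ≤ 4 * (q₁ / ε ^ 3) := by
          have h5 : ε ^ 3 ≤ ε := pow_le_of_le_one h1.le (by linarith) three_ne_zero
          rw [← mul_div_assoc, le_div_iff₀ (by positivity)]
          linarith
        unfold zDeriv
        rw [e1]
        have e4 : 0 ≤ (-1 : ℝ) ^ 2 / (1 + -1 * (1 / 2 - ε / 2)) ^ 2 := by positivity
        have e5 : (4 : ℝ) * (-1) ^ 2 * (q₁ * 1 / ε ^ 3
          + 0 * α₂ / (1 + 2 * (-1) * α₂ * (1 / 2 - ε / 2)) ^ 3) = 4 * (q₁ / ε ^ 3) := by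
          rw [zero_mul, zero_div]
          ring
        rw [e5]
        linarith
  obtain ⟨X, hX0, hX1, hX2, hX3, hDX⟩ := hX
  have hp : ∀ x : ℝ, 0 < x → x ≤ X → 0 < 1 + -1 * x ∧ 0 < 1 + 2 * (-1) * α₁ * x ∧
      0 < 1 + 2 * (-1) * α₂ * x := fun x h0 h1 =>
    ⟨by linarith, pos_of_pos_right hX2 h0 h1, pos_of_pos_right hX3 h0 h1⟩
  have hreg : ∀ x : ℝ, 0 < x → x ≤ X → IsRegularPoint (-1) α₁ α₂ x := fun x h0 h1 =>
    ⟨h0.ne', (hp x h0 h1).1.ne', (hp x h0 h1).2.1.ne', (hp x h0 h1).2.2.ne'⟩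
  obtain ⟨x₀, hx₀, hD, hpos⟩ := exists_first_zero hX0
    (fun x hx => (continuousAt_zDeriv (hreg x hx.1 hx.2)).continuousWithinAt)
    zDeriv_pos_near_zero hDX
  have h0 : 0 < x₀ := hx₀.1
  obtain ⟨p0, p1, p2⟩ := hp x₀ hx₀.1 hx₀.2
  refine ⟨x₀, _, _, _, _, _, isEdgeBranch_of_critical h0 p0 p1 p2 hD hpos ?_⟩
  unfold critConst
  have e1 : 0 < 1 / x₀ ^ 3 := by positivity
  have e2 : 0 < 1 / (1 + -1 * x₀) ^ 3 := by positivity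
  have e3 : 0 ≤ q₁ * α₁ ^ 2 / (1 + 2 * (-1) * α₁ * x₀) ^ 4
    + q₂ * α₂ ^ 2 / (1 + 2 * (-1) * α₂ * x₀) ^ 4 := by positivity
  have e4 : (-1 : ℝ) ^ 3 / (1 + -1 * x₀) ^ 3 = -(1 / (1 + -1 * x₀) ^ 3) := by ring
  rw [e4]
  linarith

/-! ### Reflection -/

theorem zFn_neg (w : ℂ) : zFn (-1) (-d) q₁ α₁ q₂ α₂ (-w) = -zFn 1 d q₁ α₁ q₂ α₂ w := by
  unfold zFn
  push_cast
  simp only [mul_neg, neg_mul, neg_neg, one_mul, mul_one, one_div, inv_neg]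
  ring

theorem zFn_conj (w : ℂ) : zFn s d q₁ α₁ q₂ α₂ (starRingEnd ℂ w)
    = starRingEnd ℂ (zFn s d q₁ α₁ q₂ α₂ w) := by
  simp [zFn, map_ofNat]

theorem neg_conj_mem_upperHalf {z : ℂ} (hz : z ∈ upperHalf) : -starRingEnd ℂ z ∈ upperHalf := by
  have : 0 < z.im := hz
  simpa [upperHalf] using this

theorem IsStieltjesInverse.reflect {ρ : Measure ℝ} {m : ℂ → ℂ}
    (h : IsStieltjesInverse ρ m (zFn 1 d q₁ α₁ q₂ α₂)) :
    IsStieltjesInverse (ρ.map Neg.neg) (fun z => -starRingEnd ℂ (m (-starRingEnd ℂ z)))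
      (zFn (-1) (-d) q₁ α₁ q₂ α₂) where
  mapsTo z hz := neg_conj_mem_upperHalf (h.mapsTo _ (neg_conj_mem_upperHalf hz))
  analytic := by
    refine DifferentiableOn.analyticOnNhd (fun z hz => ?_) isOpen_upperHalf
    have h1 : DifferentiableAt ℂ (fun w => m (-w)) (starRingEnd ℂ z) := by
      refine DifferentiableAt.comp (f := fun w : ℂ => -w) _ ?_ differentiableAt_id.neg
      exact (h.analytic _ (neg_conj_mem_upperHalf hz)).differentiableAt
    have h2 := h1.conj_conj
    simp only [Complex.conj_conj, Function.comp_def] at h2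
    exact h2.neg.differentiableWithinAt
  tendsto_zero := by
    have h1 : Tendsto (fun z : ℂ => -starRingEnd ℂ z) (Bornology.cobounded ℂ ⊓ 𝓟 upperHalf)
        (Bornology.cobounded ℂ ⊓ 𝓟 upperHalf) := by
      refine tendsto_inf.2 ⟨?_, ?_⟩
      · rw [← tendsto_norm_atTop_iff_cobounded]
        simp only [norm_neg, RCLike.norm_conj]
        exact tendsto_norm_cobounded_atTop.mono_left inf_le_left
      · rw [tendsto_principal]
        filter_upwards [mem_inf_of_right (mem_principal_self upperHalf)] with z hz
          using neg_conj_mem_upperHalf hz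
    have h2 := ((Complex.continuous_conj.tendsto 0).comp (h.tendsto_zero.comp h1)).neg
    simpa [Function.comp_def] using h2
  rightInverse z hz := by
    rw [zFn_neg, zFn_conj, h.rightInverse _ (neg_conj_mem_upperHalf hz)]
    simp
  eq_integral z hz := by
    rw [h.eq_integral _ (neg_conj_mem_upperHalf hz), ← integral_conj, ← integral_neg]
    refine Eq.trans ?_ ((Homeomorph.neg ℝ).measurableEmbedding.integral_map (μ := ρ)
      (fun x : ℝ => 1 / ((x : ℂ) - z))).symm
    refine integral_congr_ae (Eventually.of_forall fun x => ?_)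
    simp only [Homeomorph.coe_neg, map_div₀, map_sub, map_neg, map_one, Complex.conj_conj,
      Complex.conj_ofReal, Complex.ofReal_neg]
    rw [← div_neg]
    congr 1
    ring

theorem mem_support_map_neg {ρ : Measure ℝ} {x : ℝ} :
    x ∈ (ρ.map Neg.neg).support ↔ -x ∈ ρ.support := by
  rw [Measure.mem_support_iff_forall, Measure.mem_support_iff_forall]
  have hmap : ∀ U : Set ℝ, (ρ.map Neg.neg) U = ρ (Neg.neg ⁻¹' U) := fun U =>
    (Homeomorph.neg ℝ).measurableEmbedding.map_apply ρ U
  constructor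
  · intro h U hU
    have := h (Neg.neg ⁻¹' U) (continuous_neg.continuousAt.preimage_mem_nhds hU)
    rw [hmap] at this
    simpa [Set.preimage_preimage] using this
  · intro h U hU
    rw [hmap]
    refine h _ (continuous_neg.continuousAt.preimage_mem_nhds ?_)
    simpa using hU

theorem HasDensityOn.of_map_neg {ρ : Measure ℝ} {S : Set ℝ} {f : ℝ → ℝ}
    (hf : HasDensityOn (ρ.map Neg.neg) S f) (hS : MeasurableSet S) :
    HasDensityOn ρ (Neg.neg ⁻¹' S) (fun x => f (-x)) := by
  refine ⟨hf.1.comp measurable_neg, fun x => hf.2.1 _, ?_⟩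
  ext A hA
  have h1 := congrArg (fun μ : Measure ℝ => μ (Neg.neg ⁻¹' A)) hf.2.2
  have hA' : MeasurableSet (Neg.neg ⁻¹' A) := measurable_neg hA
  simp only [withDensity_apply _ hA', Measure.restrict_apply hA',
    Measure.map_apply measurable_neg (hA'.inter hS), Measure.restrict_restrict hA'] at h1
  have h2 : Neg.neg ⁻¹' (Neg.neg ⁻¹' A ∩ S) = A ∩ Neg.neg ⁻¹' S := by
    ext x; simp
  rw [h2] at h1
  rw [Measure.restrict_apply hA, h1, withDensity_apply _ hA, Measure.restrict_restrict hA, ← h2]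
  exact ((Measure.measurePreserving_neg (volume : Measure ℝ)).setLIntegral_comp_preimage
    (hA'.inter hS) hf.1.ennreal_ofReal).symm

theorem IsRegularEdge.of_map_neg {ρ : Measure ℝ} {τ : ℝ} (h : IsRegularEdge (ρ.map Neg.neg) τ) :
    IsRegularEdge ρ (-τ) := by
  obtain ⟨δ, hδ, f, hf, L, hL, hlim⟩ := h
  refine ⟨δ, hδ, fun x => f (-x), ?_, L, hL, ?_⟩
  · have := hf.of_map_neg measurableSet_Ioo
    have hS : Neg.neg ⁻¹' Set.Ioo (τ - δ) (τ + δ) = Set.Ioo (-τ - δ) (-τ + δ) := by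
      ext x
      simp only [Set.mem_preimage, Set.mem_Ioo]
      constructor <;> rintro ⟨h1, h2⟩ <;> constructor <;> linarith
    rwa [hS] at this
  · have hneg : Tendsto (fun x : ℝ => -x) (𝓝[ρ.support \ {-τ}] (-τ))
        (𝓝[(ρ.map Neg.neg).support \ {τ}] τ) := by
      refine tendsto_nhdsWithin_iff.2 ⟨?_, ?_⟩
      · exact (continuous_neg.tendsto' (-τ) τ (neg_neg τ)).mono_left nhdsWithin_le_nhds
      · filter_upwards [self_mem_nhdsWithin] with x hx
        refine ⟨mem_support_map_neg.2 (by simpa using hx.1), fun h => hx.2 ?_⟩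
        have : -x = τ := h
        simp [← this]
    refine (hlim.comp hneg).congr fun x => ?_
    simp only [Function.comp]
    congr 2
    rw [← abs_neg]
    congr 1
    ring

/-- The edges of a measure whose Stieltjes transform inverts `zFn`. -/
theorem edges_of_isStieltjesInverse {ρ : Measure ℝ} [IsFiniteMeasure ρ] {m : ℂ → ℂ}
    (h : IsStieltjesInverse ρ m (zFn 1 d q₁ α₁ q₂ α₂)) (hα₁ : 0 < α₁) (hα₂ : 0 < α₂)
    (hα₂' : α₂ < 1) (hq₁ : 0 ≤ q₁) (hq₂ : 0 ≤ q₂) (hα₁' : α₁ < 1 ∨ (α₁ = 1 ∧ 0 < q₁ ∧ q₂ = 0)) :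
    ∃ τm τp : ℝ, IsLeast ρ.support τm ∧ IsGreatest ρ.support τp ∧ IsRegularEdge ρ τp ∧
      (edgeParam q₁ α₁ q₂ α₂ < 1 → HasLeftEdgeExponent ρ τm (-1 / 2)) ∧
      (edgeParam q₁ α₁ q₂ α₂ = 1 → α₁ < 1 → HasLeftEdgeExponent ρ τm (-1 / 3)) ∧
      (edgeParam q₁ α₁ q₂ α₂ = 1 → α₁ = 1 → HasLeftEdgeExponent ρ τm (-1 / 4)) ∧
      (1 < edgeParam q₁ α₁ q₂ α₂ → IsRegularEdge ρ τm ∧ HasLeftEdgeExponent ρ τm (1 / 2)) := by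
  have hα₁'' : α₁ ≤ 1 := hα₁'.elim le_of_lt fun h => h.1.le
  have hright : ∃ τp : ℝ, IsGreatest ρ.support τp ∧ IsRegularEdge ρ τp := by
    obtain ⟨x₀, _, _, _, τ, _, hB⟩ :=
      exists_isEdgeBranch_right (d := -d) hα₁ hα₂ hα₂' hq₁ hq₂ hα₁'
    have hr := h.reflect
    obtain ⟨hreg, hexp⟩ := hB.regular_of_finite (Complex.ofReal_im x₀) hr
    have hleast := isLeast_support_of_exponent (hB.measure_Iio hr) hexp
    refine ⟨-τ, ⟨mem_support_map_neg.1 hleast.1, fun x hx => ?_⟩, hreg.of_map_neg⟩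
    have := hleast.2 (mem_support_map_neg.2 (by simpa using hx) : -x ∈ _)
    linarith
  obtain ⟨τp, hτp, hτp'⟩ := hright
  rcases lt_trichotomy (edgeParam q₁ α₁ q₂ α₂) 1 with hS | hS | hS
  · obtain ⟨_, _, _, _, hB⟩ :=
      exists_isEdgeBranch_inv_two (d := d) hα₁ hα₁'' hα₂ hα₂'.le hq₁ hq₂ hS
    have hexp := hB.exponent_of_inv le_rfl h
    refine ⟨d, τp, isLeast_support_of_exponent (hB.measure_Iio h) hexp, hτp, hτp', fun _ => ?_,
      fun h' => absurd h' hS.ne, fun h' => absurd h' hS.ne, fun h' => absurd h' hS.not_gt⟩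
    convert hexp using 1
    norm_num
  · rcases hα₁' with hα | ⟨rfl, -, rfl⟩
    · obtain ⟨_, _, _, _, hB⟩ :=
        exists_isEdgeBranch_inv_three (d := d) hα₁ hα hα₂ hα₂' hq₁ hq₂ hS
      have hexp := hB.exponent_of_inv (by norm_num) h
      refine ⟨d, τp, isLeast_support_of_exponent (hB.measure_Iio h) hexp, hτp, hτp',
        fun h' => absurd hS h'.ne, fun _ _ => ?_, fun _ h' => absurd h' hα.ne,
        fun h' => absurd hS h'.ne'⟩
      convert hexp using 1
      norm_num
    · obtain rfl : q₁ = 4 := by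
        unfold edgeParam at hS
        norm_num at hS
        linarith
      obtain ⟨_, _, _, _, hB⟩ := exists_isEdgeBranch_inv_four (d := d) hα₂ hα₂'.le
      have hexp := hB.exponent_of_inv (by norm_num) h
      refine ⟨d, τp, isLeast_support_of_exponent (hB.measure_Iio h) hexp, hτp, hτp',
        fun h' => absurd hS h'.ne, fun _ h' => absurd h' (lt_irrefl _), fun _ _ => ?_,
        fun h' => absurd hS h'.ne'⟩
      convert hexp using 1
      norm_num
  · obtain ⟨x₀, _, _, _, τ, _, hB⟩ :=
      exists_isEdgeBranch_left (d := d) hα₁ hα₁'' hα₂ hα₂'.le hq₁ hq₂ hS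
    obtain ⟨hreg, hexp⟩ := hB.regular_of_finite (Complex.ofReal_im x₀) h
    exact ⟨τ, τp, isLeast_support_of_exponent (hB.measure_Iio h) hexp, hτp, hτp',
      fun h' => absurd h' hS.not_gt, fun h' => absurd h' hS.ne', fun h' => absurd h' hS.ne',
      fun _ => ⟨hreg, hexp⟩⟩

end

end

end QuadEdge

namespace QuadEdge

/-! ### The Dyson equation of the polynomial -/

section

open Matrix

variable {l : ℕ} {v : EuclideanSpace ℂ (Fin l)}

theorem sum_re_sq (v : EuclideanSpace ℂ (Fin l)) : ∑ i, (v i).re * (v i).re = sigma v ^ 2 := by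
  rw [sigma, EuclideanSpace.norm_sq_eq]
  refine Finset.sum_congr rfl fun i _ => ?_
  rw [reVec, Real.norm_eq_abs, sq_abs]
  simp [sq]

theorem sum_im_sq (hv : ‖v‖ = 1) : ∑ i, (v i).im * (v i).im = 1 - sigma v ^ 2 := by
  have h1 : ‖v‖ ^ 2 = ∑ i, ‖v i‖ ^ 2 := EuclideanSpace.norm_sq_eq v
  have h2 : ∑ i, ‖v i‖ ^ 2 = ∑ i, (v i).re * (v i).re + ∑ i, (v i).im * (v i).im := by
    rw [← Finset.sum_add_distrib]
    refine Finset.sum_congr rfl fun i _ => ?_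
    rw [Complex.sq_norm, Complex.normSq_apply]
  rw [hv, h2, sum_re_sq] at h1
  linarith

theorem sum_re_mul_im (v : EuclideanSpace ℂ (Fin l)) : ∑ i, (v i).re * (v i).im = mu v := by
  rw [mu, PiLp.inner_apply]
  refine Finset.sum_congr rfl fun i _ => ?_
  simp [reVec, imVec, mul_comm]

theorem sum_conj_mul (hv : ‖v‖ = 1) : ∑ i, v i * starRingEnd ℂ (v i) = 1 := by
  have h1 : ‖v‖ ^ 2 = ∑ i, ‖v i‖ ^ 2 := EuclideanSpace.norm_sq_eq v
  have h2 : ∑ i, v i * starRingEnd ℂ (v i) = ((∑ i, ‖v i‖ ^ 2 : ℝ) : ℂ) := by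
    push_cast
    exact Finset.sum_congr rfl fun i _ => Complex.mul_conj' (v i)
  rw [h2, ← h1, hv]
  norm_num

theorem redA_mul_self (hv : ‖v‖ = 1) : redA v * redA v = redA v := by
  ext i j
  simp only [Matrix.mul_apply, redA, Matrix.of_apply]
  calc ∑ k, starRingEnd ℂ (v i) * v k * (starRingEnd ℂ (v k) * v j)
      = starRingEnd ℂ (v i) * v j * ∑ k, v k * starRingEnd ℂ (v k) := by
        rw [Finset.mul_sum]
        exact Finset.sum_congr rfl fun k _ => by ring
    _ = starRingEnd ℂ (v i) * v j := by rw [sum_conj_mul hv, mul_one]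

theorem trace_redA (hv : ‖v‖ = 1) : (redA v).trace = 1 := by
  rw [← sum_conj_mul hv]
  exact Finset.sum_congr rfl fun i _ => by simp [redA, mul_comm]

/-- `A` is a rank one projection. -/
theorem trace_redA_mul_inv (hv : ‖v‖ = 1) {m : ℂ} (hm : 1 + m ≠ 0) :
    (redA v * (1 + m • redA v)⁻¹).trace = 1 / (1 + m) := by
  have hinv : (1 + m • redA v)⁻¹ = 1 - (m / (1 + m)) • redA v := by
    refine Matrix.inv_eq_right_inv ?_
    rw [add_mul, mul_sub, mul_sub, one_mul, mul_one, smul_mul_smul_comm, redA_mul_self hv, one_mul]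
    have : m • redA v = (m / (1 + m)) • redA v + (m * (m / (1 + m))) • redA v := by
      rw [← add_smul]
      congr 1
      field_simp
    rw [this]
    abel
  rw [hinv, mul_sub, mul_one, mul_smul_comm, redA_mul_self hv, Matrix.trace_sub,
    Matrix.trace_smul, trace_redA hv, smul_eq_mul]
  field_simp
  ring

theorem hat_redA_apply (i j : Fin l) :
    hat (redA v) i j = ((v i).re * (v j).re + (v i).im * (v j).im : ℂ) := by
  apply Complex.ext <;> simp [hat, redA] <;> ring

theorem hat_redA_mulVec (u : Fin l → ℂ) (i : Fin l) :
    (hat (redA v)).mulVec u i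
      = (∑ j, ((v j).re : ℂ) * u j) * (v i).re + (∑ j, ((v j).im : ℂ) * u j) * (v i).im := by
  rw [Matrix.mulVec, dotProduct, Finset.sum_mul, Finset.sum_mul, ← Finset.sum_add_distrib]
  refine Finset.sum_congr rfl fun j _ => ?_
  rw [hat_redA_apply]
  ring

/-- `Â` is real symmetric and positive semidefinite, so `1 + t Â` is invertible for non-real `t`. -/
theorem isUnit_det_one_add_smul_hat {t : ℂ} (ht : t.im ≠ 0) :
    IsUnit (1 + t • hat (redA v)).det := by
  rw [isUnit_iff_ne_zero]
  intro h0
  obtain ⟨u, hu, hu0⟩ := Matrix.exists_mulVec_eq_zero_iff.2 h0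
  set p := ∑ j, ((v j).re : ℂ) * u j with hp
  set q := ∑ j, ((v j).im : ℂ) * u j with hq
  have h1 : ∀ i, u i + t * (p * (v i).re + q * (v i).im) = 0 := by
    intro i
    have := congrFun hu0 i
    rwa [Matrix.add_mulVec, Matrix.one_mulVec, Matrix.smul_mulVec, Pi.add_apply, Pi.smul_apply,
      hat_redA_mulVec, smul_eq_mul] at this
  have hp' : starRingEnd ℂ p = ∑ j, starRingEnd ℂ (u j) * (v j).re := by
    rw [hp, map_sum]
    exact Finset.sum_congr rfl fun j _ => by simp [mul_comm]
  have hq' : starRingEnd ℂ q = ∑ j, starRingEnd ℂ (u j) * (v j).im := by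
    rw [hq, map_sum]
    exact Finset.sum_congr rfl fun j _ => by simp [mul_comm]
  have h2 : ∑ i, starRingEnd ℂ (u i) * u i
      + t * (p * starRingEnd ℂ p + q * starRingEnd ℂ q) = 0 := by
    rw [hp', hq', Finset.mul_sum, Finset.mul_sum, ← Finset.sum_add_distrib, Finset.mul_sum,
      ← Finset.sum_add_distrib]
    refine Finset.sum_eq_zero fun i _ => ?_
    linear_combination starRingEnd ℂ (u i) * h1 i
  have h3 : t.im * (Complex.normSq p + Complex.normSq q) = 0 := by
    have h4 : (∑ i, starRingEnd ℂ (u i) * u i).im = 0 := by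
      rw [Complex.im_sum]
      refine Finset.sum_eq_zero fun i _ => ?_
      simp
      ring
    have h5 := congrArg Complex.im h2
    rw [Complex.add_im, h4, Complex.mul_conj, Complex.mul_conj, ← Complex.ofReal_add,
      Complex.mul_im] at h5
    simpa using h5
  have h4 : Complex.normSq p + Complex.normSq q = 0 := (mul_eq_zero.1 h3).resolve_left ht
  have hp0 : p = 0 := Complex.normSq_eq_zero.1
    (by linarith [Complex.normSq_nonneg p, Complex.normSq_nonneg q])
  have hq0 : q = 0 := Complex.normSq_eq_zero.1
    (by linarith [Complex.normSq_nonneg p, Complex.normSq_nonneg q])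
  refine hu (funext fun i => ?_)
  simpa [hp0, hq0] using h1 i

theorem one_add_smul_mulVec_of_eigen {B : Matrix (Fin l) (Fin l) ℂ} {u : Fin l → ℂ} {α t : ℂ}
    (hu : B.mulVec u = α • u) : (1 + t • B).mulVec u = (1 + t * α) • u := by
  rw [Matrix.add_mulVec, Matrix.one_mulVec, Matrix.smul_mulVec, hu, smul_smul, add_smul, one_smul]

theorem inv_mulVec_of_eigen {B : Matrix (Fin l) (Fin l) ℂ} (hB : IsUnit B.det) {u : Fin l → ℂ}
    {β : ℂ} (hβ : β ≠ 0) (hu : B.mulVec u = β • u) : B⁻¹.mulVec u = β⁻¹ • u := by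
  have h1 : B⁻¹.mulVec (B.mulVec u) = u := by
    rw [Matrix.mulVec_mulVec, Matrix.nonsing_inv_mul _ hB, Matrix.one_mulVec]
  rw [hu, Matrix.mulVec_smul] at h1
  rw [eq_inv_smul_iff₀ hβ]
  exact h1

theorem one_add_mul_ofReal_ne_zero {m : ℂ} (hm : m ∈ upperHalf) {a : ℝ} (ha : a ≠ 0) :
    1 + m * a ≠ 0 := by
  intro h
  have h1 := congrArg Complex.im h
  have hm' : 0 < m.im := hm
  simp only [Complex.add_im, Complex.one_im, Complex.im_mul_ofReal, zero_add, Complex.zero_im,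
    mul_eq_zero] at h1
  exact h1.elim hm'.ne' ha

theorem resolvent_mulVec_of_eigen {m : ℂ} (hm : m ∈ upperHalf) {u : Fin l → ℂ} {α : ℝ} (hα : α ≠ 0)
    (hu : (hat (redA v)).mulVec u = (α : ℂ) • u) :
    (((1 + (2 * m) • hat (redA v))⁻¹) ^ 2 * (1 + m • hat (redA v))).mulVec u
      = ((1 + m * α) / (1 + 2 * m * α) ^ 2) • u := by
  have hm' : 0 < m.im := hm
  have hne : 1 + 2 * m * (α : ℂ) ≠ 0 := by
    have := one_add_mul_ofReal_ne_zero hm (a := 2 * α) (by simpa using hα)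
    push_cast at this
    rwa [show 1 + 2 * m * (α : ℂ) = 1 + m * (2 * α) by ring]
  have hdet : IsUnit (1 + (2 * m) • hat (redA v)).det :=
    isUnit_det_one_add_smul_hat (by simpa using hm'.ne')
  have h1 := inv_mulVec_of_eigen hdet hne (one_add_smul_mulVec_of_eigen hu)
  rw [← Matrix.mulVec_mulVec, one_add_smul_mulVec_of_eigen hu, pow_two, ← Matrix.mulVec_mulVec,
    Matrix.mulVec_smul, Matrix.mulVec_smul, h1, Matrix.mulVec_smul, h1, smul_smul, smul_smul]
  congr 1
  field_simp

/-- `u` is an eigenvector of `Â` (with real entries) for the eigenvalue `α`. -/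
def IsHatEigenvector (v : EuclideanSpace ℂ (Fin l)) (u : Fin l → ℝ) (α : ℝ) : Prop :=
  ∀ i, (∑ j, (v j).re * u j) * (v i).re + (∑ j, (v j).im * u j) * (v i).im = α * u i

theorem IsHatEigenvector.mulVec {u : Fin l → ℝ} {α : ℝ} (h : IsHatEigenvector v u α) :
    (hat (redA v)).mulVec (fun i => (u i : ℂ)) = (α : ℂ) • fun i => (u i : ℂ) := by
  ext i
  rw [hat_redA_mulVec, Pi.smul_apply, smul_eq_mul]
  exact_mod_cast h i

/-- `γ` in terms of a decomposition `Re v = c₁ u₁ + c₂ u₂` into eigenvectors of `Â`. -/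
theorem gammaFn_eq (hv : ‖v‖ = 1) (ξ : ℝ) {u₁ u₂ : Fin l → ℝ} {c₁ c₂ α₁ α₂ : ℝ} (hα₁ : α₁ ≠ 0)
    (hα₂ : α₂ ≠ 0) (h₁ : IsHatEigenvector v u₁ α₁) (h₂ : IsHatEigenvector v u₂ α₂)
    (hx : ∀ i, (v i).re = c₁ * u₁ i + c₂ * u₂ i) {m : ℂ} (hm : m ∈ upperHalf) :
    gammaFn (redA v) (redB v ξ) (redC ξ) m = -(1 / (1 + m))
      + m * (4 * ξ ^ 2 * (c₁ * (∑ i, (v i).re * u₁ i : ℝ) * ((1 + m * α₁) / (1 + 2 * m * α₁) ^ 2)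
        + c₂ * (∑ i, (v i).re * u₂ i : ℝ) * ((1 + m * α₂) / (1 + 2 * m * α₂) ^ 2))) - ξ ^ 2 := by
  have h1m : 1 + m ≠ 0 := by simpa using one_add_mul_ofReal_ne_zero hm one_ne_zero
  have hb : (fun i => ((redB v ξ i : ℝ) : ℂ))
      = (-2 * ξ * c₁ : ℂ) • (fun i => (u₁ i : ℂ)) + (-2 * ξ * c₂ : ℂ) • (fun i => (u₂ i : ℂ)) := by
    ext i
    simp only [redB, Pi.add_apply, Pi.smul_apply, smul_eq_mul]
    rw [hx i]
    push_cast
    ring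
  have hdot : ∀ u : Fin l → ℝ, (fun i => ((redB v ξ i : ℝ) : ℂ)) ⬝ᵥ (fun i => (u i : ℂ))
      = -2 * ξ * (∑ i, (v i).re * u i : ℝ) := by
    intro u
    simp only [dotProduct, redB]
    push_cast
    rw [Finset.mul_sum]
    exact Finset.sum_congr rfl fun i _ => by ring
  unfold gammaFn
  rw [trace_redA_mul_inv hv h1m]
  nth_rewrite 2 [hb]
  rw [Matrix.mulVec_add, Matrix.mulVec_smul, Matrix.mulVec_smul,
    resolvent_mulVec_of_eigen hm hα₁ h₁.mulVec, resolvent_mulVec_of_eigen hm hα₂ h₂.mulVec,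
    dotProduct_add, dotProduct_smul, dotProduct_smul, dotProduct_smul, dotProduct_smul, hdot, hdot]
  simp only [smul_eq_mul, redC]
  push_cast
  ring

/-- The Dyson equation reads `Z (m z) = z` with a rational function `Z`. -/
theorem isStieltjesInverse_of_eigen (hv : ‖v‖ = 1) {ξ : ℝ} {u₁ u₂ : Fin l → ℝ}
    {c₁ c₂ α₁ α₂ p₁ p₂ : ℝ} (hα₁ : α₁ ≠ 0)
    (hα₂ : α₂ ≠ 0) (h₁ : IsHatEigenvector v u₁ α₁) (h₂ : IsHatEigenvector v u₂ α₂)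
    (hx : ∀ i, (v i).re = c₁ * u₁ i + c₂ * u₂ i)
    (hp₁ : c₁ * ∑ i, (v i).re * u₁ i = p₁ * α₁) (hp₂ : c₂ * ∑ i, (v i).re * u₂ i = p₂ * α₂)
    {ρ : Measure ℝ} {m : ℂ → ℂ} (hm : IsDysonSolution (redA v) (redB v ξ) (redC ξ) m)
    (hρ : ∀ z ∈ upperHalf, m z = ∫ x : ℝ, 1 / ((x : ℂ) - z) ∂ρ) :
    IsStieltjesInverse ρ m
      (zFn 1 (ξ ^ 2 * (1 - p₁ - p₂)) (ξ ^ 2 * p₁) α₁ (ξ ^ 2 * p₂) α₂) where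
  mapsTo z hz := hm.mapsTo hz
  analytic := hm.analytic
  tendsto_zero := by
    have h1 : Tendsto (fun z : ℂ => z⁻¹) (Bornology.cobounded ℂ ⊓ 𝓟 upperHalf) (𝓝 0) :=
      tendsto_inv₀_cobounded.mono_left inf_le_left
    have h2 := h1.mul hm.tendsto
    rw [zero_mul] at h2
    refine h2.congr' ?_
    filter_upwards [mem_inf_of_right (mem_principal_self upperHalf)] with z hz
    have hz0 : z ≠ 0 := by
      rintro rfl
      simp [upperHalf] at hz
    field_simp
  rightInverse z hz := by
    have hmz := hm.mapsTo hz
    have h1 := hm.eqn z hz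
    rw [gammaFn_eq hv ξ hα₁ hα₂ h₁ h₂ hx hmz] at h1
    have hp₁' : (c₁ : ℂ) * (∑ i, (v i).re * u₁ i : ℝ) = p₁ * α₁ := by exact_mod_cast hp₁
    have hp₂' : (c₂ : ℂ) * (∑ i, (v i).re * u₂ i : ℝ) = p₂ * α₂ := by exact_mod_cast hp₂
    rw [hp₁', hp₂'] at h1
    have key : ∀ (p : ℂ) (a : ℝ), a ≠ 0 → 4 * m z * (p * a * ((1 + m z * a) /
        (1 + 2 * m z * a) ^ 2)) = p - p / (1 + 2 * (1 : ℝ) * a * m z) ^ 2 := by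
      intro p a ha
      have hne : 1 + 2 * m z * (a : ℂ) ≠ 0 := by
        have := one_add_mul_ofReal_ne_zero hmz (a := 2 * a) (by simpa using ha)
        push_cast at this
        rwa [show 1 + 2 * m z * (a : ℂ) = 1 + m z * (2 * a) by ring]
      rw [show 1 + 2 * ((1 : ℝ) : ℂ) * a * m z = 1 + 2 * m z * a by push_cast; ring]
      calc 4 * m z * (p * a * ((1 + m z * a) / (1 + 2 * m z * a) ^ 2))
          = (p * (1 + 2 * m z * a) ^ 2 - p) / (1 + 2 * m z * a) ^ 2 := by ring
        _ = p - p / (1 + 2 * m z * a) ^ 2 := by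
          rw [sub_div, mul_div_cancel_right₀ _ (pow_ne_zero 2 hne)]
    have k1 := key p₁ α₁ hα₁
    have k2 := key p₂ α₂ hα₂
    unfold zFn
    rw [one_div]
    push_cast at k1 k2 ⊢
    rw [one_mul (m z)]
    linear_combination h1 + ξ ^ 2 * k1 + ξ ^ 2 * k2
  eq_integral := hρ

end

end QuadEdge

namespace QuadEdge

section

variable {l : ℕ} {v : EuclideanSpace ℂ (Fin l)}

/-! ### The spectral parameters of the vector -/

/-- If `v` is genuinely complex, then `Re v` and `Im v` are linearly independent, which is strict
Cauchy–Schwarz. -/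
theorem mu_sq_lt (hv : ‖v‖ = 1) (h : ¬ IsPhaseReal v) :
    mu v ^ 2 < sigma v ^ 2 * (1 - sigma v ^ 2) := by
  by_contra hle
  refine h ?_
  rcases (sq_nonneg (sigma v)).eq_or_lt with h0 | h0
  · -- `Re v = 0`
    have hre : ∀ i, (v i).re = 0 := by
      intro i
      have h1 := sum_re_sq v
      rw [← h0, Finset.sum_eq_zero_iff_of_nonneg fun i _ => mul_self_nonneg _] at h1
      exact mul_self_eq_zero.1 (h1 i (Finset.mem_univ i))
    refine ⟨Real.pi / 2, ⟨by linarith [Real.pi_pos], by linarith [Real.pi_pos]⟩,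
      fun i => (v i).im, fun i => ?_⟩
    push_cast
    rw [Complex.exp_pi_div_two_mul_I]
    apply Complex.ext <;> simp [hre i]
  · -- otherwise `Im v = t Re v`
    set t := mu v / sigma v ^ 2 with ht
    have h1 : ∑ i, ((v i).im - t * (v i).re) ^ 2
        = (1 - sigma v ^ 2) - mu v ^ 2 / sigma v ^ 2 := by
      have h2 : ∀ i, ((v i).im - t * (v i).re) ^ 2 = (v i).im * (v i).im
          - 2 * t * ((v i).re * (v i).im) + t ^ 2 * ((v i).re * (v i).re) := fun i => by ring
      simp_rw [h2]
      rw [Finset.sum_add_distrib, Finset.sum_sub_distrib, ← Finset.mul_sum, ← Finset.mul_sum,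
        sum_im_sq hv, sum_re_mul_im, sum_re_sq, ht]
      field_simp
      ring
    have h2 : ∑ i, ((v i).im - t * (v i).re) ^ 2 = 0 := by
      refine le_antisymm ?_ (Finset.sum_nonneg fun i _ => sq_nonneg _)
      rw [h1, sub_nonpos, le_div_iff₀ h0]
      linarith
    rw [Finset.sum_eq_zero_iff_of_nonneg fun i _ => sq_nonneg _] at h2
    have h3 : ∀ i, (v i).im = t * (v i).re := fun i => by
      have := pow_eq_zero_iff two_ne_zero |>.1 (h2 i (Finset.mem_univ i))
      linarith
    refine ⟨Complex.arg (1 + t * Complex.I), Complex.arg_mem_Ioc _,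
      fun i => ‖(1 + t * Complex.I : ℂ)‖ * (v i).re, fun i => ?_⟩
    have h4 := Complex.norm_mul_exp_arg_mul_I (1 + t * Complex.I)
    have h5 : v i = (1 + t * Complex.I) * (v i).re := by
      apply Complex.ext <;> simp [h3 i]
    refine h5.trans ?_
    push_cast
    linear_combination (-((v i).re : ℂ)) * h4

theorem sigma_nonneg (v : EuclideanSpace ℂ (Fin l)) : 0 ≤ sigma v := norm_nonneg _

theorem isHatEigenvector_add_smul (hv : ‖v‖ = 1) {a : ℝ}
    (ha : a * (sigma v ^ 2 + a * mu v) = mu v + a * (1 - sigma v ^ 2)) :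
    IsHatEigenvector v (fun i => (v i).re + a * (v i).im) (sigma v ^ 2 + a * mu v) := by
  intro i
  have h1 : ∑ j, (v j).re * ((v j).re + a * (v j).im) = sigma v ^ 2 + a * mu v := by
    rw [← sum_re_sq, ← sum_re_mul_im, Finset.mul_sum, ← Finset.sum_add_distrib]
    exact Finset.sum_congr rfl fun j _ => by ring
  have h2 : ∑ j, (v j).im * ((v j).re + a * (v j).im) = mu v + a * (1 - sigma v ^ 2) := by
    rw [← sum_im_sq hv, ← sum_re_mul_im, Finset.mul_sum, ← Finset.sum_add_distrib]
    exact Finset.sum_congr rfl fun j _ => by ring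
  rw [h1, h2, ← ha]
  ring

theorem isHatEigenvector_zero (v : EuclideanSpace ℂ (Fin l)) (α : ℝ) :
    IsHatEigenvector v (fun _ => 0) α := by
  intro i
  simp

/-- `a₊` and `a₋` are the roots `a` of `μ a² - (1 - 2 σ²) a - μ = 0`, for which `Re v + a Im v` is
an eigenvector of `Â`. -/
theorem aPlus_add_aMinus (v : EuclideanSpace ℂ (Fin l)) :
    aPlus v + aMinus v = (1 - 2 * sigma v ^ 2) / mu v := by
  unfold aPlus aMinus
  by_cases hμ : mu v = 0
  · simp [hμ]
  · field_simp
    ring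

theorem aPlus_mul_aMinus (v : EuclideanSpace ℂ (Fin l)) : aPlus v * aMinus v = -1 := by
  unfold aPlus aMinus
  have h := Real.sq_sqrt (show 0 ≤ ((1 - 2 * sigma v ^ 2) / (2 * mu v)) ^ 2 + 1 by positivity)
  linear_combination -h

/-- For genuinely complex `v` both eigenvalues of `Â` on the span of `Re v` and `Im v` lie in
`(0, 1)`, as they are positive with sum `1`. The components of `Re v` along the eigenvectors
`Re v + a Im v` have weight `1 / (1 + a²)`, which identifies `s` with the edge parameter. -/
theorem exists_params_of_not_isPhaseReal (hv : ‖v‖ = 1) (h : ¬ IsPhaseReal v) (ξ : ℝ)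
    {ρ : Measure ℝ} {m : ℂ → ℂ} (hm : IsDysonSolution (redA v) (redB v ξ) (redC ξ) m)
    (hρ : ∀ z ∈ upperHalf, m z = ∫ x : ℝ, 1 / ((x : ℂ) - z) ∂ρ) :
    ∃ d q₁ α₁ q₂ α₂ : ℝ, IsStieltjesInverse ρ m (zFn 1 d q₁ α₁ q₂ α₂) ∧ 0 < α₁ ∧ α₁ < 1 ∧
      0 < α₂ ∧ α₂ < 1 ∧ 0 ≤ q₁ ∧ 0 ≤ q₂ ∧
      edgeParam q₁ α₁ q₂ α₂ = (sConst v * ξ / 2) ^ 2 := by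
  have hlt := mu_sq_lt hv h
  have hs0 : 0 < sigma v ^ 2 := by
    by_contra h0
    have h0' : sigma v ^ 2 = 0 := le_antisymm (not_lt.1 h0) (sq_nonneg _)
    rw [h0', zero_mul] at hlt
    exact absurd hlt (not_lt.2 (sq_nonneg _))
  have hs1 : sigma v ^ 2 < 1 := by
    by_contra h0
    nlinarith [sq_nonneg (mu v)]
  have hsq : ∀ t : ℝ, (t * ξ / 2) ^ 2 = t ^ 2 * ξ ^ 2 / 4 := fun t => by ring
  by_cases hμ : mu v = 0
  · -- `Re v` is itself an eigenvector
    have hx : IsHatEigenvector v (fun i => (v i).re + 0 * (v i).im) (sigma v ^ 2 + 0 * mu v) :=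
      isHatEigenvector_add_smul hv (by rw [hμ]; ring)
    simp only [zero_mul, add_zero] at hx
    refine ⟨_, _, _, _, _, isStieltjesInverse_of_eigen (c₁ := 1) (c₂ := 0) (p₁ := 1) (p₂ := 0) hv
      hs0.ne' (one_half_pos (α := ℝ)).ne' hx (isHatEigenvector_zero v (1 / 2)) (by simp) ?_ (by simp)
      hm hρ, hs0, hs1, by norm_num, by norm_num, by positivity, by simp, ?_⟩
    · rw [sum_re_sq, one_mul]
    · unfold edgeParam sConst
      rw [if_pos hμ, hsq, Real.sq_sqrt (by positivity)]
      field_simp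
      ring
  · have hsum := aPlus_add_aMinus v
    have hprod := aPlus_mul_aMinus v
    set a := aPlus v with ha
    set b := aMinus v with hb
    have hsum' : mu v * (a + b) = 1 - 2 * sigma v ^ 2 := by
      rw [hsum]
      field_simp
    have ha0 : a ≠ 0 := by
      intro h0
      rw [h0, zero_mul] at hprod
      norm_num at hprod
    have ea : a * (sigma v ^ 2 + a * mu v) = mu v + a * (1 - sigma v ^ 2) := by
      linear_combination a * hsum' - mu v * hprod
    have eb : b * (sigma v ^ 2 + b * mu v) = mu v + b * (1 - sigma v ^ 2) := by
      linear_combination b * hsum' - mu v * hprod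
    set α := sigma v ^ 2 + a * mu v with hα
    set β := sigma v ^ 2 + b * mu v with hβ
    have hαβ : α + β = 1 := by rw [hα, hβ]; linear_combination hsum'
    have hαβ' : 0 < α * β := by
      have : α * β = sigma v ^ 2 * (1 - sigma v ^ 2) - mu v ^ 2 := by
        rw [hα, hβ]; linear_combination sigma v ^ 2 * hsum' + mu v ^ 2 * hprod
      rw [this]
      linarith
    have hα0 : 0 < α := by
      by_contra h0
      have : α ≤ 0 := not_lt.1 h0
      nlinarith
    have hβ0 : 0 < β := by
      by_contra h0
      have : β ≤ 0 := not_lt.1 h0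
      nlinarith
    have hb' : b = -1 / a := by
      field_simp
      linarith
    have hpsum : 1 / (1 + a ^ 2) + 1 / (1 + b ^ 2) = 1 := by
      rw [hb']
      field_simp
      ring
    have hpsum' : a / (1 + a ^ 2) + b / (1 + b ^ 2) = 0 := by
      rw [hb']
      field_simp
      ring
    have hdot : ∀ c : ℝ, ∑ i, (v i).re * ((v i).re + c * (v i).im) = sigma v ^ 2 + c * mu v := by
      intro c
      rw [← sum_re_sq, ← sum_re_mul_im, Finset.mul_sum, ← Finset.sum_add_distrib]
      exact Finset.sum_congr rfl fun j _ => by ring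
    have hterm : ∀ c : ℝ, 0 < sigma v ^ 2 + c * mu v →
        c * (sigma v ^ 2 + c * mu v) = mu v + c * (1 - sigma v ^ 2) →
        sTerm v c = 1 / ((1 + c ^ 2) * (sigma v ^ 2 + c * mu v) ^ 2) := by
      intro c hc hce
      have h1 : sigma v ^ 2 + c ^ 2 * (1 - sigma v ^ 2) + 2 * c * mu v
          = (1 + c ^ 2) * (sigma v ^ 2 + c * mu v) := by
        linear_combination -c * hce
      rw [sTerm, h1, one_div]
      ring
    refine ⟨_, _, _, _, _, isStieltjesInverse_of_eigen (c₁ := 1 / (1 + a ^ 2))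
      (c₂ := 1 / (1 + b ^ 2)) (p₁ := 1 / (1 + a ^ 2)) (p₂ := 1 / (1 + b ^ 2)) hv
      hα0.ne' hβ0.ne' (isHatEigenvector_add_smul hv ea) (isHatEigenvector_add_smul hv eb) ?_ ?_ ?_
      hm hρ, hα0, by linarith, hβ0, by linarith, by positivity, by positivity, ?_⟩
    · intro i
      linear_combination -(v i).re * hpsum - (v i).im * hpsum'
    · rw [hdot]
    · rw [hdot]
    · have hta : sTerm v a = 1 / ((1 + a ^ 2) * α ^ 2) := hterm a hα0 ea
      have htb : sTerm v b = 1 / ((1 + b ^ 2) * β ^ 2) := hterm b hβ0 eb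
      unfold edgeParam sConst
      rw [if_neg hμ, hsq, ← ha, ← hb, hta, htb, Real.sq_sqrt (by positivity)]
      field_simp

/-- For `v = e^{iφ} w` with real `w`, the vector `Re v` is an eigenvector of `Â` for the eigenvalue
`1`, with weight `σ²`. -/
theorem exists_params_of_isPhaseReal (hv : ‖v‖ = 1) (h : IsPhaseReal v) (ξ : ℝ)
    {ρ : Measure ℝ} {m : ℂ → ℂ} (hm : IsDysonSolution (redA v) (redB v ξ) (redC ξ) m)
    (hρ : ∀ z ∈ upperHalf, m z = ∫ x : ℝ, 1 / ((x : ℂ) - z) ∂ρ) :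
    ∃ d q₁ α₁ α₂ : ℝ, IsStieltjesInverse ρ m (zFn 1 d q₁ α₁ 0 α₂) ∧ 0 < α₁ ∧
      (α₁ < 1 ∧ q₁ = 0 ∨ (α₁ = 1 ∧ 0 < q₁)) ∧ 0 < α₂ ∧ α₂ < 1 ∧ 0 ≤ q₁ ∧
      edgeParam q₁ α₁ 0 α₂ = (sigma v * ξ / 2) ^ 2 := by
  obtain ⟨φ, -, w, hw⟩ := h
  have hre : ∀ i, (v i).re = Real.cos φ * w i := fun i => by
    rw [hw i, Complex.re_mul_ofReal, Complex.exp_ofReal_mul_I_re]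
  have him : ∀ i, (v i).im = Real.sin φ * w i := fun i => by
    rw [hw i, Complex.im_mul_ofReal, Complex.exp_ofReal_mul_I_im]
  have hw1 : ∑ i, w i * w i = 1 := by
    have h1 := sum_im_sq hv
    rw [← sum_re_sq, eq_sub_iff_add_eq, ← Finset.sum_add_distrib] at h1
    rw [← h1]
    refine Finset.sum_congr rfl fun i _ => ?_
    rw [hre, him]
    linear_combination (-(w i) ^ 2) * Real.sin_sq_add_cos_sq φ
  have hx : IsHatEigenvector v (fun i => (v i).re) 1 := by
    intro i
    have h1 : ∑ j, (v j).re * (v j).re = Real.cos φ ^ 2 := by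
      rw [← mul_one (Real.cos φ ^ 2), ← hw1, Finset.mul_sum]
      exact Finset.sum_congr rfl fun j _ => by rw [hre]; ring
    have h2 : ∑ j, (v j).im * (v j).re = Real.sin φ * Real.cos φ := by
      rw [← mul_one (Real.sin φ * Real.cos φ), ← hw1, Finset.mul_sum]
      exact Finset.sum_congr rfl fun j _ => by rw [hre, him]; ring
    rw [h1, h2]
    beta_reduce
    rw [hre, him]
    linear_combination Real.cos φ * w i * Real.sin_sq_add_cos_sq φ
  have hS := isStieltjesInverse_of_eigen (c₁ := 1) (c₂ := 0) (p₁ := sigma v ^ 2) (p₂ := 0) hv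
    one_ne_zero (one_half_pos (α := ℝ)).ne' hx (isHatEigenvector_zero v (1 / 2)) (by simp)
    (by rw [sum_re_sq, one_mul, mul_one]) (by simp) hm hρ
  rw [mul_zero] at hS
  have hq : 0 ≤ ξ ^ 2 * sigma v ^ 2 := by positivity
  rcases hq.eq_or_lt with h0 | h0
  · -- the eigenvalue is irrelevant when its weight vanishes
    refine ⟨ξ ^ 2 * (1 - sigma v ^ 2 - 0), 0, 1 / 2, 1 / 2, ?_, by norm_num,
      Or.inl ⟨by norm_num, rfl⟩, by norm_num, by norm_num, le_rfl, ?_⟩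
    · convert hS using 1
      ext z
      rw [← h0]
      simp [zFn]
    · rw [div_pow, mul_pow, mul_comm (sigma v ^ 2), ← h0]
      simp [edgeParam]
  · refine ⟨_, _, _, _, hS, one_pos, Or.inr ⟨rfl, h0⟩, by norm_num, by norm_num, hq, ?_⟩
    unfold edgeParam
    ring

theorem isPhaseReal_of_isRealVec (h : IsRealVec v) : IsPhaseReal v := by
  refine ⟨0, ⟨by linarith [Real.pi_pos], Real.pi_pos.le⟩, fun i => (v i).re, fun i => ?_⟩
  apply Complex.ext <;> simp [h i]

theorem sigma_eq_one_of_isRealVec (hv : ‖v‖ = 1) (h : IsRealVec v) : sigma v = 1 := by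
  have h1 := sum_im_sq hv
  simp only [h _, mul_zero, Finset.sum_const_zero] at h1
  nlinarith [sigma_nonneg v]

theorem half_sq_lt_one {t : ℝ} (h0 : 0 ≤ t) (h : t < 2) : (t / 2) ^ 2 < 1 := by
  nlinarith

theorem one_lt_half_sq {t : ℝ} (h : 2 < t) : 1 < (t / 2) ^ 2 := by
  nlinarith

end

end QuadEdge

theorem proposition2p5 {l : ℕ} (v : EuclideanSpace ℂ (Fin l)) (hv : ‖v‖ = 1)
    (ξ : ℝ) (hξ : 0 ≤ ξ) (ρ : Measure ℝ)
    (hρ : IsLimitingSpectralMeasure (redA v) (redB v ξ) (redC ξ) ρ) :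
    ∃ τm τp : ℝ, IsLeast ρ.support τm ∧ IsGreatest ρ.support τp ∧
      IsRegularEdge ρ τp ∧
      (ξ = 0 → HasLeftEdgeExponent ρ τm (-1 / 2)) ∧
      (IsRealVec v → ξ < 2 → HasLeftEdgeExponent ρ τm (-1 / 2)) ∧
      (IsRealVec v → ξ = 2 → HasLeftEdgeExponent ρ τm (-1 / 4)) ∧
      (¬ IsPhaseReal v → sConst v * ξ < 2 → HasLeftEdgeExponent ρ τm (-1 / 2)) ∧
      (¬ IsPhaseReal v → sConst v * ξ = 2 → HasLeftEdgeExponent ρ τm (-1 / 3)) ∧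
      -- vectors `e^{iφ} w` with `w` real: `ξ` is replaced by `‖Re v‖ ξ = |cos φ| ξ`
      (IsPhaseReal v → sigma v * ξ < 2 → HasLeftEdgeExponent ρ τm (-1 / 2)) ∧
      (IsPhaseReal v → sigma v * ξ = 2 → HasLeftEdgeExponent ρ τm (-1 / 4)) ∧
      (¬ (ξ = 0 ∨ (IsPhaseReal v ∧ sigma v * ξ ≤ 2) ∨
          (¬ IsPhaseReal v ∧ sConst v * ξ ≤ 2)) →
        IsRegularEdge ρ τm ∧ HasLeftEdgeExponent ρ τm (1 / 2)) := by
  obtain ⟨hprob, m, hm, hmρ⟩ := hρ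
  by_cases hph : IsPhaseReal v
  · obtain ⟨d, q₁, α₁, α₂, hS, hα₁, hα₁', hα₂, hα₂', hq₁, hE⟩ :=
      exists_params_of_isPhaseReal hv hph ξ hm hmρ
    obtain ⟨τm, τp, h1, h2, h3, h4, -, h6, h7⟩ := edges_of_isStieltjesInverse hS hα₁ hα₂ hα₂' hq₁
      le_rfl (hα₁'.imp (fun h => h.1) fun h => ⟨h.1, h.2, rfl⟩)
    rw [hE] at h4 h6 h7
    have hnn : 0 ≤ sigma v * ξ := mul_nonneg (sigma_nonneg v) hξ
    have hlt : sigma v * ξ < 2 → HasLeftEdgeExponent ρ τm (-1 / 2) := fun h =>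
      h4 (half_sq_lt_one hnn h)
    have heq : sigma v * ξ = 2 → HasLeftEdgeExponent ρ τm (-1 / 4) := fun h => by
      have h1' : (sigma v * ξ / 2) ^ 2 = 1 := by rw [h]; norm_num
      refine h6 h1' (hα₁'.elim (fun h' => ?_) fun h' => h'.1)
      rw [h1', h'.2] at hE
      simp [edgeParam] at hE
    refine ⟨τm, τp, h1, h2, h3, fun h => hlt (by rw [h]; norm_num), fun hr h => hlt ?_,
      fun hr h => heq ?_, fun h => absurd hph h, fun h => absurd hph h, fun _ => hlt, fun _ => heq,
      fun h => h7 (one_lt_half_sq ?_)⟩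
    · rwa [sigma_eq_one_of_isRealVec hv hr, one_mul]
    · rwa [sigma_eq_one_of_isRealVec hv hr, one_mul]
    · by_contra hle
      exact h (Or.inr (Or.inl ⟨hph, not_lt.1 hle⟩))
  · obtain ⟨d, q₁, α₁, q₂, α₂, hS, hα₁, hα₁', hα₂, hα₂', hq₁, hq₂, hE⟩ :=
      exists_params_of_not_isPhaseReal hv hph ξ hm hmρ
    obtain ⟨τm, τp, h1, h2, h3, h4, h5, -, h7⟩ := edges_of_isStieltjesInverse hS hα₁ hα₂ hα₂' hq₁
      hq₂ (Or.inl hα₁')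
    rw [hE] at h4 h5 h7
    have hnn : 0 ≤ sConst v * ξ := mul_nonneg (Real.sqrt_nonneg _) hξ
    have hlt : sConst v * ξ < 2 → HasLeftEdgeExponent ρ τm (-1 / 2) := fun h =>
      h4 (half_sq_lt_one hnn h)
    refine ⟨τm, τp, h1, h2, h3, fun h => hlt (by rw [h]; norm_num),
      fun hr => absurd (isPhaseReal_of_isRealVec hr) hph,
      fun hr => absurd (isPhaseReal_of_isRealVec hr) hph, fun _ => hlt,
      fun _ h => h5 (by rw [h]; norm_num) hα₁', fun h => absurd h hph, fun h => absurd h hph,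
      fun h => h7 (one_lt_half_sq ?_)⟩
    by_contra hle
    exact h (Or.inr (Or.inr ⟨hph, not_lt.1 hle⟩))
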